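/- **Setting.** All quantities are dimensionless (monolayer lattice constant $1$). Let $a_1=(\tfrac12,\tfrac{\sqrt3}2)$, $a_2=(-\tfrac12,\tfrac{\sqrt3}2)$, with reciprocal vectors $b_1=\tfrac{4\pi}{\sqrt3}(\tfrac{\sqrt3}2,\tfrac12)$, $b_2=\tfrac{4\pi}{\sqrt3}(-\tfrac{\sqrt3}2,\tfrac12)$, site shifts $\tau^A=0$, $\tau^B=(0,\tfrac1{\sqrt3})$, and Dirac point $\kappa=(\tfrac{4\pi}3,0)$. Let $R(\zeta)$ be the counterclockwise rotation by $\zeta$. For a twist angle $\theta>0$ and an interlayer displacement $\mathfrak d\in\mathbb R^2$ put $\theta_1=-\theta$, $\theta_2=\theta$, and for the layers $i=1,2$: $a_{i,j}=R(\theta_i/2)a_j$, $b_{i,j}=R(\theta_i/2)b_j$, $\kappa_i=R(\theta_i/2)\kappa$, $\tau_1^\sigma=R(-\tfrac\theta2)(\tau^\sigma-\tfrac{\mathfrak d}2)$, $\tau_2^\sigma=R(\tfrac\theta2)(\tau^\sigma+\tfrac{\mathfrak d}2)$, and $\Lambda_i=\mathbb Za_{i,1}+\mathbb Za_{i,2}$.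 Let $\mathcal H=\ell^2(\Lambda_1;\mathbb C^2)\oplus\ell^2(\Lambda_2;\mathbb C^2)$ with its standard norm, with elements $\psi=((\psi_i)^\sigma_{R_i})$, $\sigma\in\{A,B\}$. For $h^\sharp$ real-valued and $\ell>0$ let $h(r;\ell)=h^\sharp(\sqrt{|r|^2+\ell^2})$, $r\in\mathbb R^2$, and $\hat h(\xi;\ell)=\int_{\mathbb R^2}e^{-i\xi\cdot r}h(r;\ell)\,dr$; this is real and depends on $\xi$ only through $|\xi|$. The tight-binding Hamiltonian $H$ on $\mathcal H$ is $$(H\psi)_{i,R_i}=-\tfrac2{\sqrt3}\begin{pmatrix}\psi^B_{R_i}+\psi^B_{R_i-a_{i,1}}+\psi^B_{R_i-a_{i,2}}\\ \psi^A_{R_i}+\psi^A_{R_i+a_{i,1}}+\psi^A_{R_i+a_{i,2}}\end{pmatrix}+\Big(\tfrac{\sqrt3}2\sum_{R_j\in\Lambda_j}\sum_{\sigma'}h(R_i+\tau_i^\sigma-R_j-\tau_j^{\sigma'};\ell)\,\psi^{\sigma'}_{R_j}\Big)_{\sigma=A,B},\qquad j\neq i .$$ Let $\mathfrak s_1=\kappa_1-\kappa_2$,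 $\mathfrak s_2=\mathfrak s_1+b_{1,2}-b_{2,2}$, $\mathfrak s_3=\mathfrak s_1-b_{1,1}+b_{2,1}$, $T_1^{\sigma\sigma'}=1$, $T_2^{\sigma\sigma'}=e^{i(b_{1,2}\cdot\tau_1^\sigma-b_{2,2}\cdot\tau_2^{\sigma'})}$, $T_3^{\sigma\sigma'}=e^{i(-b_{1,1}\cdot\tau_1^\sigma+b_{2,1}\cdot\tau_2^{\sigma'})}$, $T_\theta(r)=\sum_{n=1}^3T_ne^{-i\mathfrak s_n\cdot r}$. With $\vec\sigma=(\sigma_1,\sigma_2)$ the Pauli matrices, the scaled Bistritzer–MacDonald Hamiltonian on $L^2(\mathbb R^2;\mathbb C^4)$, with domain $H^1(\mathbb R^2;\mathbb C^4)$, is $$H_{BM}=\begin{pmatrix}\vec\sigma\cdot(-i\nabla_X)&\mathcal T(X)\\ \mathcal T^\dagger(X)&\vec\sigma\cdot(-i\nabla_X)\end{pmatrix},\qquad \mathcal T(X)=\lambda_0T_\theta(X/\gamma).$$ The wave packet with envelopes $f=(f_1^A,f_1^B,f_2^A,f_2^B)$ (continuous functions) is $\big(W_\gamma[f]_i\big)^\sigma_{R_i}=\gamma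 f_i^\sigma(\gamma(R_i+\tau_i^\sigma))\,e^{i\kappa_i\cdot(R_i+\tau_i^\sigma)}$. **Hypotheses on the hopping function.** There are constants $C_1,C_2,C_3,D_1,D_2,\ell_0>0$ with $1\le D_1/D_2<2$ such that for all $\ell\ge\ell_0$: $h(\cdot;\ell)$ is integrable and $h(r;\ell)=\frac1{(2\pi)^2}\int_{\mathbb R^2} e^{i\xi\cdot r}\hat h(\xi;\ell)\,d\xi$ for every $r\in\mathbb R^2$ (equivalently, given the other hypotheses, $h(\cdot;\ell)$ is continuous); $$|\hat h(\xi;\ell)|\le C_2e^{-D_2\ell|\xi|}\ \ (\xi\in\mathbb R^2),\qquad \hat h(\xi;\ell)\ge C_1e^{-D_1\ell|\xi|}\ \ (|\xi|=|\kappa|);$$ $$|\hat h(\xi;\ell)-\hat h(\xi';\ell)|\le C_3e^{-D_2\ell\,d(0,[\xi,\xi'])}|\xi-\xi'|\ \ (\xi,\xi'\in\mathbb R^2),$$ where $d(0,[\xi,\xi'])$ is the distance from the origin to the segment $[\xi,\xi']$. **Theorem.** Let $\lambda_0,\lambda_1>0$. There are constants $c,\gamma_0,C>0$, depending only on $h^\sharp$,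 the constants in its hypotheses, $\lambda_0$ and $\lambda_1$, such that the following holds. (1) Let $\mathfrak d\in\mathbb R^2$, $0<\gamma<\gamma_0$, $\ell\ge\ell_0$ and $\theta>0$ satisfy $\hat h(|\kappa|;\ell)=\lambda_0\gamma$ and $\theta\le\lambda_1\gamma$, and let $f_0=(f_{i,0}^\sigma)$ satisfy $\|f_{i,0}^\sigma\|_{H^8(\mathbb R^2)}\le M$ for all $i,\sigma$. Then $i\partial_Tf=H_{BM}f$, $f(0)=f_0$ has a unique solution on $[0,\infty)$; $f(T)\in H^8$ (so $f(T)$ is continuous) for all $T\ge0$; $i\partial_\tau\psi=H\psi$, $\psi(0)=W_\gamma[f_0]$ has a unique solution in $\mathcal H$ on $[0,\infty)$; and $$\psi(\tau)=W_\gamma[f(\gamma\tau)]+\eta(\tau),\qquad \|\eta(\tau)\|_{\mathcal H}\le C\,M\,\gamma^{1+c}\,\tau\qquad\text{for all }\tau\ge0 .$$ (2) Consequently, for all fixed $0\le\nu<c$, $C_1'>0$ and $M\ge0$, $$\lim_{\gamma\downarrow0}\ \sup_{0\le\tau\le C_1'\gamma^{-(1+\nu)}}\|\eta(\tau)\|_{\mathcal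 H}=0,$$ uniformly over all $\mathfrak d,\ell\ge\ell_0,\theta>0,f_0$ allowed in (1) with this $M$. -/

import Mathlib

open MeasureTheory Set Filter Topology TemperedDistribution
open scoped SchwartzMap LineDeriv ENNReal

noncomputable section

namespace TBG

/-! ### Geometry

All quantities are non-dimensionalized, so that the monolayer lattice constant is `1`.  Layers
`1, 2` are indexed by `0, 1 : Fin 2`; sublattices `A, B` are indexed by `0, 1 : Fin 2`; and the
lattice vectors and reciprocal lattice vectors number `1, 2` are indexed by `0, 1 : Fin 2`. -/

/-- The Euclidean plane. -/
abbrev Plane : Type := EuclideanSpace ℝ (Fin 2)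

/-- Counterclockwise rotation by the angle `ζ`. -/
def rot (ζ : ℝ) (v : Plane) : Plane :=
  !₂[Real.cos ζ * v 0 - Real.sin ζ * v 1, Real.sin ζ * v 0 + Real.cos ζ * v 1]

/-- The monolayer lattice vectors. -/
def latticeVec : Fin 2 → Plane :=
  ![!₂[1 / 2, Real.sqrt 3 / 2], !₂[-1 / 2, Real.sqrt 3 / 2]]

/-- The distance between the two atoms of a cell. -/
def bondLength : ℝ := 1 / Real.sqrt 3

/-- The monolayer reciprocal lattice vectors. -/
def recipVec : Fin 2 → Plane :=
  ![(4 * Real.pi / (3 * bondLength)) • !₂[Real.sqrt 3 / 2, 1 / 2],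
    (4 * Real.pi / (3 * bondLength)) • !₂[-Real.sqrt 3 / 2, 1 / 2]]

/-- The site shifts `τ^A`, `τ^B` within a cell. -/
def siteShift : Fin 2 → Plane := ![0, !₂[0, bondLength]]

/-- The monolayer Dirac point `κ`. -/
def diracPt : Plane := !₂[4 * Real.pi / 3, 0]

/-- Layer `1` is rotated by `-θ/2` and layer `2` by `θ/2`. -/
def layerAngle (θ : ℝ) : Fin 2 → ℝ := ![-θ / 2, θ / 2]

/-- The lattice vectors `a_{i,j}` of layer `i`. -/
def layerLatticeVec (θ : ℝ) (i j : Fin 2) : Plane := rot (layerAngle θ i) (latticeVec j)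

/-- The reciprocal lattice vectors `b_{i,j}` of layer `i`. -/
def layerRecipVec (θ : ℝ) (i j : Fin 2) : Plane := rot (layerAngle θ i) (recipVec j)

/-- The Dirac point `κ_i` of layer `i`. -/
def layerDiracPt (θ : ℝ) (i : Fin 2) : Plane := rot (layerAngle θ i) diracPt

/-- The site shifts `τ_i^σ` of layer `i`, with interlayer displacement `d`. -/
def layerSiteShift (d : Plane) (θ : ℝ) (i σ : Fin 2) : Plane :=
  rot (layerAngle θ i) (siteShift σ + (![-1 / 2, 1 / 2] i : ℝ) • d)

/-- Atomic sites: a layer, a cell (the integer coordinates of the lattice vector `R_i` in the basis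
`a_{i,1}, a_{i,2}`) and a sublattice. -/
abbrev Site : Type := Fin 2 × (ℤ × ℤ) × Fin 2

/-- The position `R_i + τ_i^σ` of a site. -/
def sitePos (d : Plane) (θ : ℝ) (n : Site) : Plane :=
  (n.2.1.1 : ℝ) • layerLatticeVec θ n.1 0 + (n.2.1.2 : ℝ) • layerLatticeVec θ n.1 1 +
    layerSiteShift d θ n.1 n.2.2

/-! ### Interlayer hopping function -/

/-- The interlayer hopping function `h(r; ℓ) = h♯(√(|r|² + ℓ²))`. -/
def hop (hs : ℝ → ℝ) (r : Plane) (ℓ : ℝ) : ℝ := hs (Real.sqrt (‖r‖ ^ 2 + ℓ ^ 2))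

/-- The two-dimensional Fourier transform `ĥ(ξ; ℓ) = ∫ e^{-i ξ·r} h(r; ℓ) dr`. -/
def hopFT (hs : ℝ → ℝ) (ξ : Plane) (ℓ : ℝ) : ℂ :=
  ∫ r : Plane, Complex.exp (-Complex.I * (inner ℝ ξ r : ℝ)) * (hop hs r ℓ : ℂ)

/-- Since `h` is real and even, its Fourier transform is real. -/
theorem hopFT_im (hs : ℝ → ℝ) (ξ : Plane) (ℓ : ℝ) : (hopFT hs ξ ℓ).im = 0 := by
  rw [← Complex.conj_eq_iff_im]
  unfold hopFT
  rw [← integral_conj, ← integral_neg_eq_self]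
  congr 1
  funext r
  simp [hop, ← Complex.exp_conj]

/-- The hypotheses on the interlayer hopping function. -/
structure HoppingAssumption (hs : ℝ → ℝ) (C₁ C₂ C₃ D₁ D₂ ℓ₀ : ℝ) : Prop where
  C₁_pos : 0 < C₁
  C₂_pos : 0 < C₂
  C₃_pos : 0 < C₃
  D₁_pos : 0 < D₁
  D₂_pos : 0 < D₂
  ℓ₀_pos : 0 < ℓ₀
  /-- The Fourier transform exists. -/
  integrable : ∀ ℓ, ℓ₀ ≤ ℓ → Integrable (fun r : Plane => hop hs r ℓ)
  /-- `h` and `ĥ` form a Fourier transform pair at every point (under the other hypotheses this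
  just says that `h(·; ℓ)` is continuous, and it gives a meaning to the values of `h(·; ℓ)` at
  single points). -/
  inversion : ∀ ℓ, ℓ₀ ≤ ℓ → ∀ r : Plane, (hop hs r ℓ : ℂ) =
    1 / (2 * (Real.pi : ℂ)) ^ 2 *
      ∫ ξ : Plane, Complex.exp (Complex.I * (inner ℝ ξ r : ℝ)) * hopFT hs ξ ℓ
  /-- The exponential upper bound, at every wave vector. -/
  upper : ∀ ℓ, ℓ₀ ≤ ℓ → ∀ ξ : Plane, ‖hopFT hs ξ ℓ‖ ≤ C₂ * Real.exp (-D₂ * ℓ * ‖ξ‖)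
  /-- The exponential lower bound, at the wave vectors of length `|κ|`. -/
  lower : ∀ ℓ, ℓ₀ ≤ ℓ → ∀ ξ : Plane, ‖ξ‖ = ‖diracPt‖ →
    C₁ * Real.exp (-D₁ * ℓ * ‖ξ‖) ≤ (hopFT hs ξ ℓ).re
  one_le_ratio : 1 ≤ D₁ / D₂
  ratio_lt_two : D₁ / D₂ < 2
  /-- The Lipschitz bound, weighted by the distance of the segment `[ξ, ξ']` to the origin. -/
  lipschitz : ∀ ℓ, ℓ₀ ≤ ℓ → ∀ ξ ξ' : Plane, ‖hopFT hs ξ ℓ - hopFT hs ξ' ℓ‖ ≤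
    C₃ * Real.exp (-D₂ * ℓ * Metric.infDist 0 (segment ℝ ξ ξ')) * ‖ξ - ξ'‖

/-! ### The tight-binding model -/

/-- The Hilbert space `ℓ²(ℤ²; ℂ²) ⊕ ℓ²(ℤ²; ℂ²)`. -/
abbrev TBSpace : Type := lp (fun _ : Site => ℂ) 2

/-- The intralayer (nearest-neighbour) part of the Hamiltonian. -/
def intralayer (ψ : Site → ℂ) (i : Fin 2) (m : ℤ × ℤ) (σ : Fin 2) : ℂ :=
  -(2 / Real.sqrt 3 : ℝ) *
    (if σ = 0 then ψ (i, m, 1) + ψ (i, (m.1 - 1, m.2), 1) + ψ (i, (m.1, m.2 - 1), 1)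
      else ψ (i, m, 0) + ψ (i, (m.1 + 1, m.2), 0) + ψ (i, (m.1, m.2 + 1), 0))

/-- The interlayer part of the Hamiltonian: a sum over the sites of the other layer. -/
def interlayer (hs : ℝ → ℝ) (d : Plane) (θ ℓ : ℝ) (ψ : Site → ℂ) (n : Site) : ℂ :=
  (Real.sqrt 3 / 2 : ℝ) * ∑' m : ℤ × ℤ, ∑ σ' : Fin 2,
    (hop hs (sitePos d θ n - sitePos d θ (n.1.rev, m, σ')) ℓ : ℂ) * ψ (n.1.rev, m, σ')

/-- The tight-binding Hamiltonian of twisted bilayer graphene. -/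
def tbHamiltonian (hs : ℝ → ℝ) (d : Plane) (θ ℓ : ℝ) (ψ : Site → ℂ) (n : Site) : ℂ :=
  intralayer ψ n.1 n.2.1 n.2.2 + interlayer hs d θ ℓ ψ n

/-- `ψ` solves `i ∂_τ ψ = H ψ` for `τ ≥ 0`, with the derivative taken in the Hilbert space. -/
def IsSchrodingerSolution (hs : ℝ → ℝ) (d : Plane) (θ ℓ : ℝ) (ψ : ℝ → TBSpace) : Prop :=
  ∀ τ, 0 ≤ τ → ∃ ψ' : TBSpace, HasDerivWithinAt ψ ψ' (Ici 0) τ ∧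
    ∀ n : Site, Complex.I * ψ' n = tbHamiltonian hs d θ ℓ (ψ τ) n

/-! ### Envelopes and Sobolev norms -/

/-- The complex space `L²(ℝ²)`. -/
abbrev L2 : Type := Lp ℂ 2 (volume : Measure Plane)

/-- Four-component envelopes `f_i^σ` in `L²(ℝ²; ℂ⁴)`, indexed by layer and sublattice. -/
abbrev Envelope : Type := Fin 2 → Fin 2 → L2

/-- The norm of the Sobolev space `H^s(ℝ²)`, as the `L²` norm of the Bessel potential of order `s`;
it is infinite outside `H^s(ℝ²)`. -/
def eSobolevNorm (s : ℝ) (u : 𝓢'(Plane, ℂ)) : ℝ≥0∞ :=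
  ⨅ (v : L2) (_ : besselPotential Plane ℂ s u = (v : 𝓢'(Plane, ℂ))), ‖v‖ₑ

theorem eSobolevNorm_lt_top_iff (s : ℝ) (u : 𝓢'(Plane, ℂ)) :
    eSobolevNorm s u < ⊤ ↔ MemSobolev s 2 u := by
  unfold eSobolevNorm MemSobolev
  simp [iInf_lt_iff]

/-- The `L²` class `u` has a continuous representative. -/
def HasContRep (u : L2) : Prop := ∃ g : Plane → ℂ, Continuous g ∧ g =ᵐ[volume] u

open Classical in
/-- The continuous representative of `u` (and `0` if there is none). -/
def contRep (u : L2) : Plane → ℂ := if h : HasContRep u then h.choose else 0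

theorem contRep_eq {u : L2} {g : Plane → ℂ} (hg : Continuous g) (h : g =ᵐ[volume] u) :
    contRep u = g := by
  have hu : HasContRep u := ⟨g, hg, h⟩
  unfold contRep
  rw [dif_pos hu]
  exact (hu.choose_spec.1.ae_eq_iff_eq volume hg).1 (hu.choose_spec.2.trans h.symm)

/-- The wave packet with envelopes `f`:
`γ f_i^σ(X) e^{i κ_i·(R_i + τ_i^σ)}` at `X = γ (R_i + τ_i^σ)`. -/
def wavePacket (d : Plane) (θ γ : ℝ) (f : Envelope) (n : Site) : ℂ :=
  γ * contRep (f n.1 n.2.2) (γ • sitePos d θ n) *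
    Complex.exp (Complex.I * (inner ℝ (layerDiracPt θ n.1) (sitePos d θ n) : ℝ))

/-! ### The scaled Bistritzer-MacDonald model -/

/-- The momentum shifts `𝔰_1, 𝔰_2, 𝔰_3`. -/
def momentumShift (θ : ℝ) : Fin 3 → Plane :=
  ![layerDiracPt θ 0 - layerDiracPt θ 1,
    layerDiracPt θ 0 - layerDiracPt θ 1 - layerRecipVec θ 1 1 + layerRecipVec θ 0 1,
    layerDiracPt θ 0 - layerDiracPt θ 1 + layerRecipVec θ 1 0 - layerRecipVec θ 0 0]

/-- The hopping matrices `T_1, T_2, T_3`. -/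
def hoppingMatrix (d : Plane) (θ : ℝ) (n : Fin 3) (σ σ' : Fin 2) : ℂ :=
  ![1,
    Complex.exp (Complex.I * (inner ℝ (layerRecipVec θ 0 1) (layerSiteShift d θ 0 σ) -
      inner ℝ (layerRecipVec θ 1 1) (layerSiteShift d θ 1 σ') : ℝ)),
    Complex.exp (Complex.I * (-inner ℝ (layerRecipVec θ 0 0) (layerSiteShift d θ 0 σ) +
      inner ℝ (layerRecipVec θ 1 0) (layerSiteShift d θ 1 σ') : ℝ))] n

/-- The moiré potential `T_θ(r) = ∑_n T_n e^{-i 𝔰_n·r}`. -/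
def moire (d : Plane) (θ : ℝ) (σ σ' : Fin 2) (r : Plane) : ℂ :=
  ∑ n : Fin 3, hoppingMatrix d θ n σ σ' *
    Complex.exp (-Complex.I * (inner ℝ (momentumShift θ n) r : ℝ))

/-- The scaled moiré potential `𝒯(X) = λ₀ T_θ(X / γ)`. -/
def scaledMoire (lam₀ : ℝ) (d : Plane) (θ γ : ℝ) (σ σ' : Fin 2) (X : Plane) : ℂ :=
  lam₀ * moire d θ σ σ' (γ⁻¹ • X)

/-- The interlayer blocks of the Hamiltonian: `𝒯(X)` in row `1`, and its conjugate transpose in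
row `2`. -/
def scaledMoireBlock (lam₀ : ℝ) (d : Plane) (θ γ : ℝ) (i σ σ' : Fin 2) (X : Plane) : ℂ :=
  if i = 0 then scaledMoire lam₀ d θ γ σ σ' X
  else (starRingEnd ℂ) (scaledMoire lam₀ d θ γ σ' σ X)

theorem temperate_cexp :
    (fun t : ℝ => Complex.exp (-Complex.I * (t : ℂ))).HasTemperateGrowth := by
  have hder (t : ℝ) : HasDerivAt (fun t : ℝ => Complex.exp (-Complex.I * (t : ℂ)))
      (Complex.exp (-Complex.I * (t : ℂ)) * -Complex.I) t := by
    have := ((Complex.ofRealCLM.hasDerivAt (x := t)).const_mul (-Complex.I)).cexp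
    simpa using this
  have hd : ∀ n, iteratedDeriv n (fun t : ℝ => Complex.exp (-Complex.I * (t : ℂ))) =
      fun t : ℝ => (-Complex.I) ^ n * Complex.exp (-Complex.I * (t : ℂ)) := by
    intro n
    induction n with
    | zero => simp
    | succ n ih =>
      rw [iteratedDeriv_succ, ih]
      funext t
      rw [((hder t).const_mul _).deriv]
      ring
  refine ⟨(contDiff_const.mul Complex.ofRealCLM.contDiff).cexp, fun n => ⟨0, 1, fun t => ?_⟩⟩
  rw [norm_iteratedFDeriv_eq_norm_iteratedDeriv, hd n]
  simp [Complex.norm_exp]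

theorem scaledMoire_temperate (lam₀ : ℝ) (d : Plane) (θ γ : ℝ) (σ σ' : Fin 2) :
    (scaledMoire lam₀ d θ γ σ σ').HasTemperateGrowth := by
  have h (w : Plane) :
      (fun X : Plane => Complex.exp (-Complex.I * (inner ℝ w X : ℝ))).HasTemperateGrowth :=
    temperate_cexp.comp (g := fun t : ℝ => Complex.exp (-Complex.I * (t : ℂ)))
      (f := fun X => inner ℝ w X) (by fun_prop)
  have := fun n => h (γ⁻¹ • momentumShift θ n)
  unfold scaledMoire moire
  simp_rw [inner_smul_right, ← real_inner_smul_left]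
  fun_prop

/-- The moiré potential is a legitimate multiplier of tempered distributions, so that
`smulLeftCLM` below is multiplication by it. -/
theorem scaledMoireBlock_temperate (lam₀ : ℝ) (d : Plane) (θ γ : ℝ) (i σ σ' : Fin 2) :
    (scaledMoireBlock lam₀ d θ γ i σ σ').HasTemperateGrowth := by
  unfold scaledMoireBlock
  split_ifs
  · exact scaledMoire_temperate ..
  · exact Function.HasTemperateGrowth.comp (g := fun z : ℂ => Complex.conjCLE z)
      (Complex.conjCLE.hasTemperateGrowth) (scaledMoire_temperate lam₀ d θ γ σ' σ)

/-- The Pauli matrices `σ_1, σ_2`. -/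
def pauli : Fin 2 → Matrix (Fin 2) (Fin 2) ℂ :=
  ![!![0, 1; 1, 0], !![0, -Complex.I; Complex.I, 0]]

/-- The scaled Bistritzer-MacDonald Hamiltonian, acting on envelopes in the sense of tempered
distributions: `σ·(-i∇)` within each layer and multiplication by the scaled moiré potential
between the layers. -/
def bmHamiltonian (lam₀ : ℝ) (d : Plane) (θ γ : ℝ) (f : Envelope) (i σ : Fin 2) :
    𝓢'(Plane, ℂ) :=
  (∑ σ' : Fin 2, ∑ j : Fin 2, pauli j σ σ' •
      (-Complex.I • ∂_{(EuclideanSpace.single j (1 : ℝ) : Plane)} (f i σ' : 𝓢'(Plane, ℂ)))) +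
    ∑ σ' : Fin 2, smulLeftCLM ℂ (scaledMoireBlock lam₀ d θ γ i σ σ')
      (f i.rev σ' : 𝓢'(Plane, ℂ))

/-- `f` solves `i ∂_T f = H_BM f` for `T ≥ 0` with initial value `f₀`: at all times it lies in the
domain `H¹(ℝ²; ℂ⁴)` of the Hamiltonian, and the derivative is taken in `L²(ℝ²; ℂ⁴)`. -/
def IsBMSolution (lam₀ : ℝ) (d : Plane) (θ γ : ℝ) (f₀ : Envelope) (f : ℝ → Envelope) : Prop :=
  f 0 = f₀ ∧ ∀ T, 0 ≤ T →
    (∀ i σ, MemSobolev 1 2 (f T i σ : 𝓢'(Plane, ℂ))) ∧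
    ∃ f' : Envelope, HasDerivWithinAt f f' (Ici 0) T ∧
      ∀ i σ, Complex.I • (f' i σ : 𝓢'(Plane, ℂ)) = bmHamiltonian lam₀ d θ γ (f T) i σ

/-! ### Parameter regime -/

/-- The scaling regime `ĥ(|κ|; ℓ) = λ₀ γ`, `0 < θ ≤ λ₁ γ`, `ℓ ≥ ℓ₀`, `γ > 0`. -/
structure Regime (hs : ℝ → ℝ) (ℓ₀ lam₀ lam₁ γ θ ℓ : ℝ) : Prop where
  γ_pos : 0 < γ
  θ_pos : 0 < θ
  le_ℓ : ℓ₀ ≤ ℓ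
  balance : hopFT hs diracPt ℓ = ((lam₀ * γ : ℝ) : ℂ)
  θ_le : θ ≤ lam₁ * γ

end TBG

end

/-! The theorem is a consistency estimate combined with unitarity. If the wave packet with envelope
f(γτ) satisfies the tight-binding equation up to a residual of norm K in ℓ², then Duhamel's formula
bounds the corrector by Kτ, because H is bounded and self-adjoint. Everything thus reduces to ‖H
W[f] − γ W[H_BM f]‖ ≤ C M γ^(1+c), uniformly in time, with c = D₂/D₁ − 1/2.

The residual is computed in momentum space. The intralayer part multiplies the Fourier transform of
the envelope by a sum of three phases that vanishes at the Dirac point and has the Dirac symbol as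
its linear term; the error is O(γ² + γθ) (`norm_intraSymbol_sub_le`). In the interlayer part,
Poisson summation (`inner_sampOp_sampOp`, `interOp_waveOp`) turns the sum over the sites of the
other layer into a sum over its reciprocal vectors G, with symbols ĥ(κ_j + G + γp). Three of the
points κ_j + G lie on the circle of radius |κ|; there ĥ = λ₀γ by radial symmetry, and these terms
form the Bistritzer-MacDonald potential. Displacing the argument by γp costs only γ^(1+c)|p|, by the
weighted Lipschitz bound. All other points have length at least 2|κ|. Since e^(−D₁ℓ|κ|) is at most a
constant times γ, ĥ is O(γ^(2D₂/D₁)) there, which beats γ because D₁/D₂ < 2. These estimates hold in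
discs of radius c|κ|; outside them the decay of the envelope's own Fourier transform supplies a
factor γ⁴ (`exists_isMultiplier_interResidual`).

The constants must not grow in time. The L² norm is conserved under the Bistritzer-MacDonald flow,
H_BM commutes with its flow, and by ellipticity H_BM f and f at one Sobolev order control f at the
next order; so Sobolev norms stay bounded by induction (`IsScaleSolution.norm_le`). Existence
follows from a Dyson series in the interaction picture of the explicit Dirac propagator
(`exists_isScaleSolution`).

An element of H^s is represented throughout as the function with Fourier transform (1 + |ξ|²)^(−s/2)
v, v in L², and operators are conjugated to this level s. The eight derivatives are spent as
follows: two on differentiating the free propagator, four on the residual, two on sampling at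
lattice sites. -/

noncomputable section

namespace TBG

/-! ### Bounded multipliers on `L²` -/

/-- `m` is measurable and bounded by `C`. -/
structure IsMultiplier (m : Plane → ℂ) (C : ℝ) : Prop where
  meas : Measurable m
  le : ∀ ξ, ‖m ξ‖ ≤ C

namespace IsMultiplier

variable {m m' : Plane → ℂ} {C C' : ℝ}

theorem nonneg (h : IsMultiplier m C) : 0 ≤ C := (norm_nonneg _).trans (h.le 0)

theorem memLp (h : IsMultiplier m C) (v : L2) : MemLp (fun ξ => m ξ * v ξ) 2 volume :=
  (Lp.memLp v).of_le_mul (h.meas.aestronglyMeasurable.mul (Lp.aestronglyMeasurable v))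
    (Eventually.of_forall fun ξ => by
      rw [norm_mul]; exact mul_le_mul_of_nonneg_right (h.le ξ) (norm_nonneg _))

theorem mul (h : IsMultiplier m C) (h' : IsMultiplier m' C') :
    IsMultiplier (fun ξ => m ξ * m' ξ) (C * C') :=
  ⟨h.meas.mul h'.meas, fun ξ => by
    rw [norm_mul]; exact mul_le_mul (h.le ξ) (h'.le ξ) (norm_nonneg _) h.nonneg⟩

theorem add (h : IsMultiplier m C) (h' : IsMultiplier m' C') :
    IsMultiplier (fun ξ => m ξ + m' ξ) (C + C') :=
  ⟨h.meas.add h'.meas, fun ξ => (norm_add_le _ _).trans (add_le_add (h.le ξ) (h'.le ξ))⟩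

theorem sub (h : IsMultiplier m C) (h' : IsMultiplier m' C') :
    IsMultiplier (fun ξ => m ξ - m' ξ) (C + C') :=
  ⟨h.meas.sub h'.meas, fun ξ => (norm_sub_le _ _).trans (add_le_add (h.le ξ) (h'.le ξ))⟩

theorem const (c : ℂ) : IsMultiplier (fun _ => c) ‖c‖ := ⟨measurable_const, fun _ => le_rfl⟩

theorem const_mul (c : ℂ) (h : IsMultiplier m C) : IsMultiplier (fun ξ => c * m ξ) (‖c‖ * C) :=
  (const c).mul h

theorem pow (h : IsMultiplier m C) (n : ℕ) : IsMultiplier (fun ξ => m ξ ^ n) (C ^ n) :=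
  ⟨h.meas.pow_const n, fun ξ => by
    rw [norm_pow]; exact pow_le_pow_left₀ (norm_nonneg _) (h.le ξ) n⟩

theorem conj (h : IsMultiplier m C) : IsMultiplier (fun ξ => (starRingEnd ℂ) (m ξ)) C :=
  ⟨Complex.continuous_conj.measurable.comp h.meas, fun ξ => by
    rw [RCLike.norm_conj]; exact h.le ξ⟩

theorem comp_add (h : IsMultiplier m C) (q : Plane) : IsMultiplier (fun ξ => m (ξ + q)) C :=
  ⟨h.meas.comp (measurable_add_const q), fun _ => h.le _⟩

theorem mono (h : IsMultiplier m C) (hC : C ≤ C') : IsMultiplier m C' :=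
  ⟨h.meas, fun ξ => (h.le ξ).trans hC⟩

end IsMultiplier

open Classical in
/-- Multiplication by `m` on `L²` (and `0` if `m` is not a bounded measurable function). -/
def mulOp (m : Plane → ℂ) : L2 →L[ℂ] L2 :=
  if h : ∃ C, IsMultiplier m C then
    LinearMap.mkContinuous
      { toFun := fun v => (h.choose_spec.memLp v).toLp _
        map_add' := fun u v => by
          apply Lp.ext
          filter_upwards [MemLp.coeFn_toLp (h.choose_spec.memLp (u + v)), Lp.coeFn_add u v,
            Lp.coeFn_add ((h.choose_spec.memLp u).toLp _) ((h.choose_spec.memLp v).toLp _),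
            MemLp.coeFn_toLp (h.choose_spec.memLp u), MemLp.coeFn_toLp (h.choose_spec.memLp v)]
            with ξ h1 h2 h3 h4 h5
          rw [h1, h3, Pi.add_apply, h4, h5, h2, Pi.add_apply, mul_add]
        map_smul' := fun c v => by
          apply Lp.ext
          filter_upwards [MemLp.coeFn_toLp (h.choose_spec.memLp (c • v)), Lp.coeFn_smul c v,
            Lp.coeFn_smul c ((h.choose_spec.memLp v).toLp _),
            MemLp.coeFn_toLp (h.choose_spec.memLp v)] with ξ h1 h2 h3 h4
          rw [h1, RingHom.id_apply, h3, Pi.smul_apply, h4, h2, Pi.smul_apply, smul_eq_mul,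
            smul_eq_mul, mul_left_comm] }
      h.choose
      (fun v => by
        apply Lp.norm_le_mul_norm_of_ae_le_mul
        filter_upwards [MemLp.coeFn_toLp (h.choose_spec.memLp v)] with ξ h1
        simp only [LinearMap.coe_mk, AddHom.coe_mk]
        rw [h1, norm_mul]
        exact mul_le_mul_of_nonneg_right (h.choose_spec.le ξ) (norm_nonneg _))
  else 0

section mulOp

variable {m m' : Plane → ℂ} {C C' : ℝ}

theorem coeFn_mulOp (h : IsMultiplier m C) (v : L2) :
    mulOp m v =ᵐ[volume] fun ξ => m ξ * v ξ := by
  have h' : ∃ C, IsMultiplier m C := ⟨C, h⟩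
  unfold mulOp
  rw [dif_pos h']
  exact MemLp.coeFn_toLp (h'.choose_spec.memLp v)

theorem norm_mulOp_le (h : IsMultiplier m C) (v : L2) : ‖mulOp m v‖ ≤ C * ‖v‖ := by
  apply Lp.norm_le_mul_norm_of_ae_le_mul
  filter_upwards [coeFn_mulOp h v] with ξ h1
  rw [h1, norm_mul]
  exact mul_le_mul_of_nonneg_right (h.le ξ) (norm_nonneg _)

theorem mulOp_mulOp (h : IsMultiplier m C) (h' : IsMultiplier m' C') (v : L2) :
    mulOp m (mulOp m' v) = mulOp (fun ξ => m ξ * m' ξ) v := by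
  apply Lp.ext
  filter_upwards [coeFn_mulOp h (mulOp m' v), coeFn_mulOp h' v, coeFn_mulOp (h.mul h') v]
    with ξ h1 h2 h3
  rw [h1, h2, h3, mul_assoc]

theorem mulOp_add (h : IsMultiplier m C) (h' : IsMultiplier m' C') (v : L2) :
    mulOp (fun ξ => m ξ + m' ξ) v = mulOp m v + mulOp m' v := by
  apply Lp.ext
  filter_upwards [coeFn_mulOp h v, coeFn_mulOp h' v, coeFn_mulOp (h.add h') v,
    Lp.coeFn_add (mulOp m v) (mulOp m' v)] with ξ h1 h2 h3 h4
  rw [h4, Pi.add_apply, h1, h2, h3, add_mul]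

theorem mulOp_sub (h : IsMultiplier m C) (h' : IsMultiplier m' C') (v : L2) :
    mulOp (fun ξ => m ξ - m' ξ) v = mulOp m v - mulOp m' v := by
  apply Lp.ext
  filter_upwards [coeFn_mulOp h v, coeFn_mulOp h' v, coeFn_mulOp (h.sub h') v,
    Lp.coeFn_sub (mulOp m v) (mulOp m' v)] with ξ h1 h2 h3 h4
  rw [h4, Pi.sub_apply, h1, h2, h3, sub_mul]

theorem mulOp_const (c : ℂ) (v : L2) : mulOp (fun _ => c) v = c • v := by
  apply Lp.ext
  filter_upwards [coeFn_mulOp (IsMultiplier.const c) v, Lp.coeFn_smul c v] with ξ h1 h2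
  rw [h1, h2, Pi.smul_apply, smul_eq_mul]

theorem mulOp_const_mul (c : ℂ) (h : IsMultiplier m C) (v : L2) :
    mulOp (fun ξ => c * m ξ) v = c • mulOp m v := by
  rw [← mulOp_const, mulOp_mulOp (IsMultiplier.const c) h]

theorem mulOp_comm (h : IsMultiplier m C) (h' : IsMultiplier m' C') (v : L2) :
    mulOp m (mulOp m' v) = mulOp m' (mulOp m v) := by
  rw [mulOp_mulOp h h', mulOp_mulOp h' h]
  simp_rw [mul_comm]

theorem inner_mulOp_left (h : IsMultiplier m C) (u v : L2) :
    inner ℂ (mulOp m u) v = inner ℂ u (mulOp (fun ξ => (starRingEnd ℂ) (m ξ)) v) := by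
  rw [L2.inner_def, L2.inner_def]
  apply integral_congr_ae
  filter_upwards [coeFn_mulOp h u, coeFn_mulOp h.conj v] with ξ h1 h2
  simp only [h1, h2, RCLike.inner_apply, map_mul]
  ring

end mulOp

/-! ### Translations on `L²` -/

/-- Translation by `q` on `L²`: `v ↦ v(· + q)`. -/
def transOp (q : Plane) : L2 →ₗᵢ[ℂ] L2 :=
  Lp.compMeasurePreservingₗᵢ ℂ (fun ξ => ξ + q) (measurePreserving_add_right volume q)

theorem coeFn_transOp (q : Plane) (v : L2) : transOp q v =ᵐ[volume] fun ξ => v (ξ + q) :=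
  Lp.coeFn_compMeasurePreserving v (measurePreserving_add_right volume q)

theorem transOp_mulOp {m : Plane → ℂ} {C : ℝ} (h : IsMultiplier m C) (q : Plane) (v : L2) :
    transOp q (mulOp m v) = mulOp (fun ξ => m (ξ + q)) (transOp q v) := by
  apply Lp.ext
  have h0 := (measurePreserving_add_right (volume : Measure Plane) q).quasiMeasurePreserving.ae
    (coeFn_mulOp h v)
  filter_upwards [coeFn_transOp q (mulOp m v), coeFn_transOp q v,
    coeFn_mulOp (h.comp_add q) (transOp q v), h0] with ξ h1 h2 h3 h4
  rw [h1, h3, h2, h4]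

theorem inner_transOp_left (q : Plane) (u v : L2) :
    inner ℂ (transOp q u) v = inner ℂ u (transOp (-q) v) := by
  rw [L2.inner_def, L2.inner_def]
  rw [← integral_add_right_eq_self (fun ξ => inner ℂ ((u : Plane → ℂ) ξ) (transOp (-q) v ξ)) q]
  apply integral_congr_ae
  have h0 := (measurePreserving_add_right (volume : Measure Plane) q).quasiMeasurePreserving.ae
    (coeFn_transOp (-q) v)
  filter_upwards [coeFn_transOp q u, h0] with ξ h1 h2
  rw [h1, h2]
  simp

/-! ### The weight -/

/-- The Japanese bracket `√(1 + |ξ|²)`. -/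
def jap (ξ : Plane) : ℝ := Real.sqrt (1 + ‖ξ‖ ^ 2)

theorem jap_sq (ξ : Plane) : jap ξ ^ 2 = 1 + ‖ξ‖ ^ 2 := Real.sq_sqrt (by positivity)

theorem one_le_jap (ξ : Plane) : 1 ≤ jap ξ := Real.one_le_sqrt.2 (by nlinarith [sq_nonneg ‖ξ‖])

theorem jap_pos (ξ : Plane) : 0 < jap ξ := zero_lt_one.trans_le (one_le_jap ξ)

theorem norm_le_jap (ξ : Plane) : ‖ξ‖ ≤ jap ξ := Real.le_sqrt_of_sq_le (by linarith)

theorem jap_le_one_add (ξ : Plane) : jap ξ ≤ 1 + ‖ξ‖ :=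
  (Real.sqrt_le_left (by positivity)).2 (by nlinarith [norm_nonneg ξ])

/-- Peetre's inequality. It keeps translations in momentum space, and hence the coupling, bounded on
every Sobolev level. -/
theorem jap_add_le (ξ q : Plane) : jap (ξ + q) ≤ jap ξ * (1 + ‖q‖) := by
  rw [jap, Real.sqrt_le_left (mul_nonneg (jap_pos _).le (by positivity)), mul_pow, jap_sq]
  have h := norm_add_le ξ q
  have h2 : ‖ξ + q‖ ^ 2 ≤ (‖ξ‖ + ‖q‖) ^ 2 := pow_le_pow_left₀ (norm_nonneg _) h 2
  nlinarith [norm_nonneg ξ, norm_nonneg q, mul_nonneg (norm_nonneg q) (sq_nonneg (‖ξ‖ - 1)),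
    mul_nonneg (sq_nonneg ‖q‖) (sq_nonneg ‖ξ‖)]

theorem continuous_jap : Continuous jap := by unfold jap; fun_prop

/-- The multiplier `(1 + |ξ|²)^{-1/2}`. -/
def jw (ξ : Plane) : ℂ := ((jap ξ)⁻¹ : ℝ)

theorem isMultiplier_jw : IsMultiplier jw 1 :=
  ⟨(Complex.measurable_ofReal.comp continuous_jap.measurable.inv), fun ξ => by
    rw [jw, Complex.norm_real, Real.norm_of_nonneg (inv_nonneg.2 (jap_pos ξ).le)]
    exact inv_le_one_of_one_le₀ (one_le_jap ξ)⟩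

theorem norm_jw (ξ : Plane) : ‖jw ξ‖ = (jap ξ)⁻¹ := by
  rw [jw, Complex.norm_real, Real.norm_of_nonneg (inv_nonneg.2 (jap_pos ξ).le)]

theorem jw_ne_zero (ξ : Plane) : jw ξ ≠ 0 :=
  Complex.ofReal_ne_zero.2 (inv_ne_zero (jap_pos ξ).ne')

theorem isMultiplier_jw_pow (n : ℕ) : IsMultiplier (fun ξ => jw ξ ^ n) 1 :=
  (isMultiplier_jw.pow n).mono (by simp)

theorem conj_jw (ξ : Plane) : (starRingEnd ℂ) (jw ξ) = jw ξ := Complex.conj_ofReal _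

/-! ### Linear evolution equations with strongly continuous bounded generators -/

theorem _root_.ContinuousLinearMap.comp_hasDerivWithinAt_real {E F : Type*} [NormedAddCommGroup E]
    [NormedSpace ℂ E] [NormedAddCommGroup F] [NormedSpace ℂ F] (L : E →L[ℂ] F) {u : ℝ → E} {u' : E}
    {s : Set ℝ} {t : ℝ} (h : HasDerivWithinAt u u' s t) :
    HasDerivWithinAt (fun t => L (u t)) (L u') s t :=
  (L.restrictScalars ℝ).hasFDerivAt.comp_hasDerivWithinAt t h

section Dyson

variable {E : Type*} [NormedAddCommGroup E] [NormedSpace ℂ E]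

/-- The increment of u is handled by the uniform bound K, the fixed vector `u t` by strong
continuity. Norm continuity is not needed; the Dirac propagators entering A below are only strongly
continuous. -/
theorem continuous_clm_apply {A : ℝ → E →L[ℂ] E} {K : ℝ} (hA : ∀ x, Continuous fun t => A t x)
    (hK : ∀ t x, ‖A t x‖ ≤ K * ‖x‖) {u : ℝ → E} (hu : Continuous u) :
    Continuous fun t => A t (u t) := by
  rw [continuous_iff_continuousAt]
  intro t
  have h1 : Tendsto (fun s => K * ‖u s - u t‖) (𝓝 t) (𝓝 0) := by
    have : Continuous fun s => K * ‖u s - u t‖ := by fun_prop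
    simpa using this.tendsto t
  have h2 : Tendsto (fun s => A s (u s - u t)) (𝓝 t) (𝓝 0) :=
    squeeze_zero_norm (fun s => hK s _) h1
  have h3 := h2.add ((hA (u t)).tendsto t)
  simpa [ContinuousAt] using h3

/-- The terms of the Dyson series. -/
def dysonTerm (A : ℝ → E →L[ℂ] E) (x₀ : E) : ℕ → ℝ → E
  | 0 => fun _ => x₀
  | n + 1 => fun t => ∫ s in (0 : ℝ)..t, A s (dysonTerm A x₀ n s)

variable {A : ℝ → E →L[ℂ] E} {K : ℝ}

theorem norm_dysonTerm_le (hK0 : 0 ≤ K) (hK : ∀ t x, ‖A t x‖ ≤ K * ‖x‖) (x₀ : E) (n : ℕ) (t : ℝ) :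
    ‖dysonTerm A x₀ n t‖ ≤ (K * |t|) ^ n / n.factorial * ‖x₀‖ := by
  induction n generalizing t with
  | zero => simp [dysonTerm]
  | succ n ih =>
    rw [dysonTerm, intervalIntegral.norm_intervalIntegral_eq]
    have h1 : ∀ s, ‖A s (dysonTerm A x₀ n s)‖ ≤
        K ^ (n + 1) / n.factorial * ‖x₀‖ * |s - 0| ^ n := fun s => by
      refine (hK s _).trans ((mul_le_mul_of_nonneg_left (ih s) hK0).trans (le_of_eq ?_))
      rw [sub_zero, mul_pow, pow_succ]
      ring
    refine (norm_integral_le_of_norm_le (Continuous.integrableOn_uIoc (by fun_prop))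
      (Eventually.of_forall h1)).trans (le_of_eq ?_)
    rw [integral_const_mul, integral_pow_abs_sub_uIoc, sub_zero, Nat.factorial_succ, mul_pow]
    have : (n.factorial : ℝ) ≠ 0 := by positivity
    push_cast
    field_simp

theorem continuous_dysonTerm (hA : ∀ x, Continuous fun t => A t x)
    (hK : ∀ t x, ‖A t x‖ ≤ K * ‖x‖) (x₀ : E) (n : ℕ) : Continuous (dysonTerm A x₀ n) := by
  induction n with
  | zero => exact continuous_const
  | succ n ih =>
    exact intervalIntegral.continuous_primitive
      (fun a b => (continuous_clm_apply hA hK ih).intervalIntegrable a b) 0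

variable [CompleteSpace E]

theorem hasDerivAt_dysonTerm (hA : ∀ x, Continuous fun t => A t x)
    (hK : ∀ t x, ‖A t x‖ ≤ K * ‖x‖) (x₀ : E) (n : ℕ) (t : ℝ) :
    HasDerivAt (dysonTerm A x₀ (n + 1)) (A t (dysonTerm A x₀ n t)) t := by
  have hc := continuous_clm_apply hA hK (continuous_dysonTerm hA hK x₀ n)
  exact intervalIntegral.integral_hasDerivAt_right (hc.intervalIntegrable _ _)
    hc.aestronglyMeasurable.stronglyMeasurableAtFilter hc.continuousAt

/-- The equation `u' = A(t) u` has global solutions. -/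
theorem exists_hasDerivAt_of_strongly_continuous (hA : ∀ x, Continuous fun t => A t x)
    (hK : ∀ t x, ‖A t x‖ ≤ K * ‖x‖) (hK0 : 0 ≤ K) (x₀ : E) :
    ∃ u : ℝ → E, u 0 = x₀ ∧ ∀ t, HasDerivAt u (A t (u t)) t := by
  have hs (N : ℝ) : Summable fun n : ℕ => (K * N) ^ n / n.factorial * ‖x₀‖ :=
    (Real.summable_pow_div_factorial _).mul_right _
  have hsum (t : ℝ) : Summable fun n => dysonTerm A x₀ n t :=
    Summable.of_norm_bounded (hs |t|) (norm_dysonTerm_le hK0 hK x₀ · t)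
  refine ⟨fun t => ∑' n, dysonTerm A x₀ n t, ?_, fun t => ?_⟩
  · simp only
    rw [(hsum 0).tsum_eq_zero_add]
    simp [dysonTerm]
  · set N := |t| + 1 with hN
    -- Term n + 1 has derivative A applied to term n, so the differentiated series is A applied to
    -- the series; term 0 is constant. The bounds `b` are uniform on (−N, N).
    let g' : ℕ → ℝ → E := fun n s => n.casesOn 0 (fun n => A s (dysonTerm A x₀ n s))
    let b : ℕ → ℝ := fun n => n.casesOn 0 (fun n => K * ((K * N) ^ n / n.factorial * ‖x₀‖))
    have hb : Summable b := (summable_nat_add_iff 1).1 ((hs N).mul_left K)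
    have hder := hasDerivAt_tsum_of_isPreconnected (g := dysonTerm A x₀) (g' := g') (u := b) hb
      (isOpen_Ioo (a := -N) (b := N)) isPreconnected_Ioo
      (fun n y _ => by
        cases n with
        | zero => exact hasDerivAt_const _ _
        | succ n => exact hasDerivAt_dysonTerm hA hK x₀ n y)
      (fun n y hy => by
        cases n with
        | zero => simp [g', b]
        | succ n =>
          refine (hK y _).trans (mul_le_mul_of_nonneg_left
            ((norm_dysonTerm_le hK0 hK x₀ n y).trans ?_) hK0)
          have : |y| ≤ N := abs_le.2 ⟨hy.1.le, hy.2.le⟩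
          gcongr)
      (y₀ := t) (y := t) (abs_lt.1 (by linarith)) (hsum t) (abs_lt.1 (by linarith))
    convert! hder using 1
    have hg : Summable fun n => g' n t := by
      refine (summable_nat_add_iff 1).1 ?_
      exact (hsum t).mapL (A t)
    rw [hg.tsum_eq_zero_add]
    refine ((A t).map_tsum (hsum t)).trans ?_
    simp [g']

end Dyson

/-! ### Uniform bounds in a scale of spaces -/

section Scale

variable {E : Type*} [NormedAddCommGroup E] [NormedSpace ℂ E]

/-- `J x` evolves by the generator `A_s`, at the level `s` of the scale generated by `J`. -/
def IsScaleSolution (J : E →L[ℂ] E) (A : ℕ → E →L[ℂ] E) (s : ℕ) (x : ℝ → E) : Prop :=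
  ∀ T, 0 ≤ T → HasDerivWithinAt (fun T => J (x T)) (-Complex.I • A s (x T)) (Ici 0) T

variable {J : E →L[ℂ] E} {A : ℕ → E →L[ℂ] E}

/-- The generator does not depend on time, so it commutes with the evolution, at the price of one
level. -/
theorem IsScaleSolution.generator (hJA : ∀ s x, J (A (s + 1) x) = A s (J x)) {s : ℕ} {x : ℝ → E}
    (h : IsScaleSolution J A (s + 1) x) : IsScaleSolution J A s (fun T => A (s + 1) (x T)) := by
  intro T hT
  simp_rw [hJA]
  have := (A s).comp_hasDerivWithinAt_real (h T hT)
  simpa using this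

theorem IsScaleSolution.lower (hJA : ∀ s x, J (A (s + 1) x) = A s (J x)) {s : ℕ} {x : ℝ → E}
    (h : IsScaleSolution J A (s + 1) x) : IsScaleSolution J A s (fun T => J (x T)) := by
  intro T hT
  have := J.comp_hasDerivWithinAt_real (h T hT)
  simpa [hJA] using this

/-- The constants of the uniform bounds. -/
def scaleConst (C₀ : ℝ) (a K : ℕ → ℝ) : ℕ → ℝ
  | 0 => C₀
  | s + 1 => K s * (scaleConst C₀ a K s * a (s + 1) + scaleConst C₀ a K s)

theorem scaleConst_nonneg {C₀ : ℝ} {a K : ℕ → ℝ} (h₀ : 0 ≤ C₀) (ha : ∀ s, 0 ≤ a s)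
    (hK : ∀ s, 0 ≤ K s) (s : ℕ) : 0 ≤ scaleConst C₀ a K s := by
  induction s with
  | zero => exact h₀
  | succ s ih => exact mul_nonneg (hK s) (add_nonneg (mul_nonneg ih (ha _)) ih)

/-- If the generator commutes with the scale, controls one step of it, and conserves the lowest
norm, then all norms of the scale stay bounded. -/
theorem IsScaleSolution.norm_le {C₀ : ℝ} {a K : ℕ → ℝ} (h₀ : 0 ≤ C₀) (ha0 : ∀ s, 0 ≤ a s)
    (hK0 : ∀ s, 0 ≤ K s) (hJ : ∀ x, ‖J x‖ ≤ ‖x‖)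
    (hJA : ∀ s x, J (A (s + 1) x) = A s (J x)) (ha : ∀ s x, ‖A s x‖ ≤ a s * ‖x‖)
    (hK : ∀ s x, ‖x‖ ≤ K s * (‖A (s + 1) x‖ + ‖J x‖))
    (hcons : ∀ x, IsScaleSolution J A 1 x → ∀ T, 0 ≤ T → ‖J (x T)‖ ≤ C₀ * ‖J (x 0)‖)
    (s : ℕ) {x : ℝ → E} (h : IsScaleSolution J A (s + 1) x) {T : ℝ} (hT : 0 ≤ T) :
    ‖J (x T)‖ ≤ scaleConst C₀ a K s * ‖J (x 0)‖ := by
  induction s generalizing x with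
  | zero => exact hcons x h T hT
  | succ s ih =>
    have hc := scaleConst_nonneg h₀ ha0 hK0 s
    -- Both the generator applied to x and `J x` solve the equation one level lower, so the
    -- induction hypothesis bounds them; the ellipticity estimate `hK` then recovers `J x`.
    have h1 := ih (h.generator hJA)
    have h2 := ih (h.lower hJA)
    rw [hJA, hJA] at h1
    have h3 : ‖A (s + 1) (J (x 0))‖ ≤ a (s + 1) * ‖J (x 0)‖ := ha _ _
    have h4 : ‖J (J (x 0))‖ ≤ ‖J (x 0)‖ := hJ _
    calc ‖J (x T)‖ ≤ K s * (‖A (s + 1) (J (x T))‖ + ‖J (J (x T))‖) := hK s _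
      _ ≤ K s * (scaleConst C₀ a K s * (a (s + 1) * ‖J (x 0)‖) +
          scaleConst C₀ a K s * ‖J (x 0)‖) := by
        refine mul_le_mul_of_nonneg_left (add_le_add (h1.trans ?_) (h2.trans ?_)) (hK0 s) <;>
        gcongr
      _ = scaleConst C₀ a K (s + 1) * ‖J (x 0)‖ := by rw [scaleConst]; ring

end Scale

/-! ### Families of multipliers -/

theorem norm_sq_eq_integral (v : L2) : ‖v‖ ^ 2 = ∫ ξ, ‖v ξ‖ ^ 2 := by
  rw [← inner_self_eq_norm_sq (𝕜 := ℂ) v, L2.inner_def, ← integral_re (L2.integrable_inner v v)]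
  simp only [inner_self_eq_norm_sq]

theorem integrable_norm_sq (v : L2) : Integrable (fun ξ => ‖v ξ‖ ^ 2) :=
  (Lp.memLp v).integrable_norm_pow two_ne_zero

/-- Dominated convergence with majorant (2C)²|v|². The multipliers need not be uniformly close, so
the continuity is only strong. -/
theorem continuous_mulOp {m : ℝ → Plane → ℂ} {C : ℝ} (h : ∀ T, IsMultiplier (m T) C)
    (hm : ∀ ξ, Continuous fun T => m T ξ) (v : L2) : Continuous fun T => mulOp (m T) v := by
  rw [continuous_iff_continuousAt]
  intro t
  rw [ContinuousAt, tendsto_iff_norm_sub_tendsto_zero]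
  have key : Tendsto (fun T => ‖mulOp (m T) v - mulOp (m t) v‖ ^ 2) (𝓝 t) (𝓝 0) := by
    have h1 : ∀ T, ‖mulOp (m T) v - mulOp (m t) v‖ ^ 2 = ∫ ξ, ‖(m T ξ - m t ξ) * v ξ‖ ^ 2 := by
      intro T
      rw [← mulOp_sub (h T) (h t), norm_sq_eq_integral]
      apply integral_congr_ae
      filter_upwards [coeFn_mulOp ((h T).sub (h t)) v] with ξ h1
      rw [h1]
    simp_rw [h1]
    rw [← integral_zero Plane ℝ (μ := volume)]
    apply tendsto_integral_filter_of_dominated_convergence (fun ξ => (C + C) ^ 2 * ‖v ξ‖ ^ 2)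
    · exact Eventually.of_forall fun T =>
        (((h T).sub (h t)).meas.aestronglyMeasurable.mul (Lp.aestronglyMeasurable v)).norm.pow 2
    · refine Eventually.of_forall fun T => Eventually.of_forall fun ξ => ?_
      rw [Real.norm_of_nonneg (by positivity), norm_mul, mul_pow]
      gcongr
      exact ((h T).sub (h t)).le ξ
    · exact (integrable_norm_sq v).const_mul _
    · refine Eventually.of_forall fun ξ => ?_
      have : Continuous fun T => ‖(m T ξ - m t ξ) * v ξ‖ ^ 2 := by
        have := hm ξ
        fun_prop
      simpa using this.tendsto t
  have := (Real.continuous_sqrt.tendsto 0).comp key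
  simpa [Function.comp_def] using this

/-- The remainder is quadratic uniformly in ξ, so the multiplication operators are differentiable in
operator norm at t and the product rule applies. -/
theorem hasDerivAt_mulOp {m : ℝ → Plane → ℂ} {m' : Plane → ℂ} {C C' D : ℝ} {t : ℝ}
    (h : ∀ T, IsMultiplier (m T) C) (h' : IsMultiplier m' C')
    (hm : ∀ x ξ, ‖m (t + x) ξ - m t ξ - x * m' ξ‖ ≤ D * x ^ 2) {u : ℝ → L2} {u' : L2}
    (hu : HasDerivAt u u' t) :
    HasDerivAt (fun T => mulOp (m T) (u T)) (mulOp m' (u t) + mulOp (m t) u') t := by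
  have hD : 0 ≤ D := by simpa using (norm_nonneg _).trans (hm 1 0)
  have hc : HasDerivAt (fun T => (mulOp (m T)).restrictScalars ℝ) ((mulOp m').restrictScalars ℝ)
      t := by
    rw [hasDerivAt_iff_isLittleO_nhds_zero]
    refine Asymptotics.IsBigO.trans_isLittleO (g := fun x : ℝ => x ^ 2) ?_ ?_
    · refine Asymptotics.IsBigO.of_bound D (Eventually.of_forall fun x => ?_)
      refine ContinuousLinearMap.opNorm_le_bound _ (by positivity) fun v => ?_
      have : ((mulOp (m (t + x))).restrictScalars ℝ - (mulOp (m t)).restrictScalars ℝ -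
          x • (mulOp m').restrictScalars ℝ) v =
          mulOp (fun ξ => m (t + x) ξ - m t ξ - (x : ℂ) * m' ξ) v := by
        rw [mulOp_sub ((h _).sub (h t)) (h'.const_mul _), mulOp_sub (h _) (h t),
          mulOp_const_mul _ h']
        simp
        rfl
      rw [this, Real.norm_of_nonneg (sq_nonneg x)]
      exact norm_mulOp_le ⟨(((h _).meas.sub (h t).meas).sub (h'.meas.const_mul _)), hm x⟩ v
    · simpa using Asymptotics.isLittleO_pow_id (𝕜 := ℝ) (one_lt_two)
  exact hc.clm_apply hu

/-- First order Taylor expansion of a function whose derivative is `1`-Lipschitz. -/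
theorem norm_taylor_le {F : Type*} [NormedAddCommGroup F] [NormedSpace ℝ F] {f f' : ℝ → F}
    (hf : ∀ x, HasDerivAt f (f' x) x) (hf' : ∀ x y, ‖f' x - f' y‖ ≤ |x - y|) (a x : ℝ) :
    ‖f (a + x) - f a - x • f' a‖ ≤ x ^ 2 := by
  have h := (convex_uIcc a (a + x)).norm_image_sub_le_of_norm_hasDerivWithin_le
    (f := fun y => f y - y • f' a) (f' := fun y => f' y - f' a) (C := |x|) (x := a) (y := a + x)
    (fun y _ => ((hf y).sub (by simpa using (hasDerivAt_id y).smul_const (f' a))).hasDerivWithinAt)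
    (fun y hy => (hf' y a).trans (by
      have := abs_sub_left_of_mem_uIcc hy
      simpa using this)) left_mem_uIcc right_mem_uIcc
  have e : f (a + x) - f a - x • f' a = f (a + x) - (a + x) • f' a - (f a - a • f' a) := by
    rw [add_smul]; abel
  rw [e]
  refine h.trans (le_of_eq ?_)
  rw [add_sub_cancel_left, Real.norm_eq_abs, ← sq, sq_abs]

/-! ### Operators on envelopes, in momentum space -/

/-- The symbol `p₁ + i p₂` of the Dirac operator, where `p = 2πξ`. -/
def diracSymbol (ξ : Plane) : ℂ := 2 * Real.pi * (ξ 0 + Complex.I * ξ 1)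

theorem norm_diracSymbol (ξ : Plane) : ‖diracSymbol ξ‖ = 2 * Real.pi * ‖ξ‖ := by
  have h : ‖(ξ 0 + Complex.I * ξ 1 : ℂ)‖ = ‖ξ‖ := by
    rw [EuclideanSpace.norm_eq, Fin.sum_univ_two, mul_comm, Complex.norm_add_mul_I]
    simp
  rw [diracSymbol, norm_mul, h]
  simp [abs_of_pos Real.pi_pos]

theorem continuous_diracSymbol : Continuous diracSymbol := by
  unfold diracSymbol
  fun_prop

theorem conj_mul_diracSymbol (ξ : Plane) :
    (starRingEnd ℂ) (diracSymbol ξ) * diracSymbol ξ = ((2 * Real.pi * ‖ξ‖ : ℝ) : ℂ) ^ 2 := by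
  rw [mul_comm, Complex.mul_conj, Complex.normSq_eq_norm_sq, norm_diracSymbol]
  push_cast; ring

/-- The matrix symbol `σ·p (1 + |ξ|²)^{-1/2}`. -/
def diracMatrix (σ σ' : Fin 2) (ξ : Plane) : ℂ :=
  ![![0, (starRingEnd ℂ) (diracSymbol ξ)], ![diracSymbol ξ, 0]] σ σ' * jw ξ

theorem isMultiplier_diracSymbol_jw : IsMultiplier (fun ξ => diracSymbol ξ * jw ξ) (2 * Real.pi) :=
  ⟨continuous_diracSymbol.measurable.mul isMultiplier_jw.meas, fun ξ => by
    rw [norm_mul, norm_diracSymbol, norm_jw, mul_assoc]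
    refine mul_le_of_le_one_right (by positivity) ?_
    rw [← div_eq_mul_inv]
    exact (div_le_one (jap_pos ξ)).2 (norm_le_jap ξ)⟩

theorem isMultiplier_conj_diracSymbol_jw :
    IsMultiplier (fun ξ => (starRingEnd ℂ) (diracSymbol ξ) * jw ξ) (2 * Real.pi) := by
  have := isMultiplier_diracSymbol_jw.conj
  simpa only [map_mul, conj_jw] using this

theorem isMultiplier_diracMatrix (σ σ' : Fin 2) :
    IsMultiplier (diracMatrix σ σ') (2 * Real.pi) := by
  have h0 : IsMultiplier (fun _ => 0) (2 * Real.pi) := ⟨measurable_const, fun _ => by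
    simp [Real.pi_pos.le]⟩
  have hz : ∀ τ, diracMatrix τ τ = fun _ => 0 := by
    intro τ; funext ξ; fin_cases τ <;> simp [diracMatrix]
  fin_cases σ <;> fin_cases σ'
  · exact hz 0 ▸ h0
  · exact isMultiplier_conj_diracSymbol_jw
  · exact isMultiplier_diracSymbol_jw
  · exact hz 1 ▸ h0

/-- The matrix-valued multiplier with entries `M σ σ'`, acting within each layer. -/
def matOp (M : Fin 2 → Fin 2 → Plane → ℂ) : Envelope →L[ℂ] Envelope :=
  ContinuousLinearMap.pi fun i => ContinuousLinearMap.pi fun σ =>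
    ∑ σ' : Fin 2, (mulOp (M σ σ')) ∘L (ContinuousLinearMap.proj σ') ∘L
      (ContinuousLinearMap.proj (R := ℂ) (φ := fun _ : Fin 2 => Fin 2 → L2) i)

theorem matOp_apply (M : Fin 2 → Fin 2 → Plane → ℂ) (v : Envelope) (i σ : Fin 2) :
    matOp M v i σ = mulOp (M σ 0) (v i 0) + mulOp (M σ 1) (v i 1) := by
  simp [matOp, Fin.sum_univ_two]

theorem norm_component_le (v : Envelope) (i σ : Fin 2) : ‖v i σ‖ ≤ ‖v‖ :=
  (norm_le_pi_norm (v i) σ).trans (norm_le_pi_norm v i)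

theorem norm_envelope_le {v : Envelope} {r : ℝ} (hr : 0 ≤ r) (h : ∀ i σ, ‖v i σ‖ ≤ r) : ‖v‖ ≤ r :=
  (pi_norm_le_iff_of_nonneg hr).2 fun i => (pi_norm_le_iff_of_nonneg hr).2 fun σ => h i σ

theorem norm_matOp_le {M : Fin 2 → Fin 2 → Plane → ℂ} {C : ℝ}
    (h : ∀ σ σ', IsMultiplier (M σ σ') C) (v : Envelope) : ‖matOp M v‖ ≤ 2 * C * ‖v‖ := by
  have hC := (h 0 0).nonneg
  refine norm_envelope_le (by positivity) fun i σ => ?_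
  rw [matOp_apply]
  have h0 := (norm_mulOp_le (h σ 0) (v i 0)).trans
    (mul_le_mul_of_nonneg_left (norm_component_le v i 0) hC)
  have h1 := (norm_mulOp_le (h σ 1) (v i 1)).trans
    (mul_le_mul_of_nonneg_left (norm_component_le v i 1) hC)
  linarith [norm_add_le (mulOp (M σ 0) (v i 0)) (mulOp (M σ 1) (v i 1))]

/-- Multiplication of all components by `(1 + |ξ|²)^{-1/2}`. -/
def scaleOp : Envelope →L[ℂ] Envelope :=
  ContinuousLinearMap.pi fun i => ContinuousLinearMap.pi fun σ =>
    (mulOp jw) ∘L (ContinuousLinearMap.proj σ) ∘L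
      (ContinuousLinearMap.proj (R := ℂ) (φ := fun _ : Fin 2 => Fin 2 → L2) i)

theorem scaleOp_apply (v : Envelope) (i σ : Fin 2) : scaleOp v i σ = mulOp jw (v i σ) := rfl

theorem norm_scaleOp_le (v : Envelope) : ‖scaleOp v‖ ≤ ‖v‖ :=
  norm_envelope_le (norm_nonneg _) fun i σ => by
    rw [scaleOp_apply]
    have := norm_mulOp_le isMultiplier_jw (v i σ)
    linarith [norm_component_le v i σ]

theorem scaleOp_matOp {M : Fin 2 → Fin 2 → Plane → ℂ} {C : ℝ}
    (h : ∀ σ σ', IsMultiplier (M σ σ') C) (v : Envelope) :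
    scaleOp (matOp M v) = matOp M (scaleOp v) := by
  funext i σ
  simp only [scaleOp_apply, matOp_apply, map_add]
  rw [mulOp_comm isMultiplier_jw (h σ 0), mulOp_comm isMultiplier_jw (h σ 1)]

/-- The multiplier `((1 + |ξ|²) / (1 + |ξ + q|²))^{s/2}`. -/
def shiftRatio (s : ℕ) (q ξ : Plane) : ℂ := (jw (ξ + q) / jw ξ) ^ s

/-- Peetre's inequality at ξ + q, translated by −q. -/
theorem isMultiplier_shiftRatio (s : ℕ) (q : Plane) :
    IsMultiplier (shiftRatio s q) ((1 + ‖q‖) ^ s) := by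
  refine ⟨(((isMultiplier_jw.comp_add q).meas.div isMultiplier_jw.meas).pow_const s), fun ξ => ?_⟩
  rw [shiftRatio, norm_pow, norm_div, norm_jw, norm_jw]
  refine pow_le_pow_left₀ (by positivity [jap_pos ξ, jap_pos (ξ + q)]) ?_ s
  have h := jap_add_le (ξ + q) (-q)
  rw [add_neg_cancel_right, norm_neg] at h
  rw [inv_div_inv, div_le_iff₀ (jap_pos _), mul_comm]
  exact h

/-- Translation by `q` in momentum space, conjugated to the level `s` of the Sobolev scale. -/
def shiftOp (s : ℕ) (q : Plane) : L2 →L[ℂ] L2 :=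
  (mulOp (shiftRatio s q)) ∘L (transOp q).toContinuousLinearMap

theorem shiftOp_apply (s : ℕ) (q : Plane) (v : L2) :
    shiftOp s q v = mulOp (shiftRatio s q) (transOp q v) := rfl

theorem norm_shiftOp_le (s : ℕ) (q : Plane) (v : L2) : ‖shiftOp s q v‖ ≤ (1 + ‖q‖) ^ s * ‖v‖ := by
  rw [shiftOp_apply]
  have := norm_mulOp_le (isMultiplier_shiftRatio s q) (transOp q v)
  rwa [LinearIsometry.norm_map] at this

theorem shiftOp_zero (q : Plane) (v : L2) : shiftOp 0 q v = transOp q v := by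
  rw [shiftOp_apply]
  have : shiftRatio 0 q = fun _ => 1 := by funext ξ; simp [shiftRatio]
  rw [this, mulOp_const, one_smul]

/-- The ratio in `shiftRatio` is chosen for this intertwining: one and the same translation is
represented at all levels of the scale. -/
theorem mulOp_shiftOp (s : ℕ) (q : Plane) (v : L2) :
    mulOp jw (shiftOp (s + 1) q v) = shiftOp s q (mulOp jw v) := by
  rw [shiftOp_apply, shiftOp_apply, transOp_mulOp isMultiplier_jw,
    mulOp_mulOp isMultiplier_jw (isMultiplier_shiftRatio _ _),
    mulOp_mulOp (isMultiplier_shiftRatio _ _) (isMultiplier_jw.comp_add q)]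
  congr 2
  funext ξ
  rw [shiftRatio, shiftRatio, pow_succ]
  field_simp [jw_ne_zero ξ]

/-- The kinetic part of the generator. -/
def kineticOp : Envelope →L[ℂ] Envelope := matOp diracMatrix

/-- The coefficients of the coupling, and their conjugate transposes. -/
def couplingCoeff (c : Fin 3 → Fin 2 → Fin 2 → ℂ) (i : Fin 2) (n : Fin 3) (σ σ' : Fin 2) : ℂ :=
  if i = 0 then c n σ σ' else (starRingEnd ℂ) (c n σ' σ)

/-- The momentum shifts of the coupling, in the two directions. -/
def couplingShift (q : Fin 3 → Plane) (i : Fin 2) (n : Fin 3) : Plane := if i = 0 then q n else -q n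

/-- The coupling of the layers, conjugated to the level `s` of the Sobolev scale. -/
def couplingOp (c : Fin 3 → Fin 2 → Fin 2 → ℂ) (q : Fin 3 → Plane) (s : ℕ) :
    Envelope →L[ℂ] Envelope :=
  ContinuousLinearMap.pi fun i => ContinuousLinearMap.pi fun σ =>
    ∑ σ' : Fin 2, ∑ n : Fin 3, couplingCoeff c i n σ σ' • (shiftOp s (couplingShift q i n)) ∘L
      (ContinuousLinearMap.proj σ') ∘L
      (ContinuousLinearMap.proj (R := ℂ) (φ := fun _ : Fin 2 => Fin 2 → L2) i.rev)

section coupling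

variable (c : Fin 3 → Fin 2 → Fin 2 → ℂ) (q : Fin 3 → Plane)

theorem couplingOp_apply (s : ℕ) (v : Envelope) (i σ : Fin 2) :
    couplingOp c q s v i σ = ∑ σ' : Fin 2, ∑ n : Fin 3,
      couplingCoeff c i n σ σ' • shiftOp s (couplingShift q i n) (v i.rev σ') := by
  simp [couplingOp]

theorem scaleOp_couplingOp (s : ℕ) (v : Envelope) :
    scaleOp (couplingOp c q (s + 1) v) = couplingOp c q s (scaleOp v) := by
  funext i σ
  simp only [scaleOp_apply, couplingOp_apply, map_sum, map_smul, mulOp_shiftOp]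

theorem norm_couplingOp_le {a b : ℝ} (hc : ∀ n σ σ', ‖c n σ σ'‖ ≤ a) (hq : ∀ n, ‖q n‖ ≤ b) (s : ℕ)
    (v : Envelope) : ‖couplingOp c q s v‖ ≤ 6 * a * (1 + b) ^ s * ‖v‖ := by
  have ha : 0 ≤ a := (norm_nonneg _).trans (hc 0 0 0)
  have hb : 0 ≤ b := (norm_nonneg _).trans (hq 0)
  refine norm_envelope_le (by positivity) fun i σ => ?_
  rw [couplingOp_apply]
  have h1 : ∀ σ' n, ‖couplingCoeff c i n σ σ' • shiftOp s (couplingShift q i n) (v i.rev σ')‖ ≤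
      a * ((1 + b) ^ s * ‖v‖) := by
    intro σ' n
    have e1 : ‖couplingCoeff c i n σ σ'‖ ≤ a := by
      unfold couplingCoeff
      split_ifs
      · exact hc _ _ _
      · rw [RCLike.norm_conj]; exact hc _ _ _
    have e2 : ‖couplingShift q i n‖ ≤ b := by
      unfold couplingShift
      split_ifs
      · exact hq n
      · rw [norm_neg]; exact hq n
    rw [norm_smul]
    refine mul_le_mul e1 ((norm_shiftOp_le _ _ _).trans ?_) (norm_nonneg _) ha
    gcongr
    exact norm_component_le v _ _
  refine (norm_sum_le_of_le _ fun σ' _ => norm_sum_le_of_le _ fun n _ => h1 σ' n).trans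
    (le_of_eq ?_)
  simp
  ring

/-- The generator of the scaled Bistritzer-MacDonald dynamics in momentum space, as a bounded
operator from the level `s` to the level `s - 1` of the Sobolev scale. -/
def generator (s : ℕ) : Envelope →L[ℂ] Envelope := kineticOp + scaleOp ∘L couplingOp c q s

theorem generator_apply (s : ℕ) (v : Envelope) :
    generator c q s v = kineticOp v + scaleOp (couplingOp c q s v) := rfl

theorem scaleOp_generator (s : ℕ) (v : Envelope) :
    scaleOp (generator c q (s + 1) v) = generator c q s (scaleOp v) := by
  rw [generator_apply, generator_apply, map_add, scaleOp_couplingOp, kineticOp,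
    scaleOp_matOp isMultiplier_diracMatrix]

/-- The constant in the bound on the generator. -/
def generatorBound (a b : ℝ) (s : ℕ) : ℝ := 4 * Real.pi + 6 * a * (1 + b) ^ s

theorem norm_generator_le {a b : ℝ} (hc : ∀ n σ σ', ‖c n σ σ'‖ ≤ a) (hq : ∀ n, ‖q n‖ ≤ b) (s : ℕ)
    (v : Envelope) : ‖generator c q s v‖ ≤ generatorBound a b s * ‖v‖ := by
  rw [generator_apply, generatorBound]
  have h1 := norm_matOp_le isMultiplier_diracMatrix v
  have h2 := (norm_scaleOp_le _).trans (norm_couplingOp_le c q hc hq s v)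
  refine (norm_add_le _ _).trans ((add_le_add h1 h2).trans (le_of_eq ?_))
  ring

/-- Ellipticity of the Dirac operator: (σ·p)² = |p|² with p = 2πξ, so the squared kinetic symbol
divided by (2π)² is |ξ|²/(1 + |ξ|²), and adding `jw` squared gives 1. -/
theorem eq_mulOp_kinetic_add (v : Envelope) (i σ : Fin 2) :
    v i σ = mulOp (fun ξ => ((2 * Real.pi) ^ 2 : ℂ)⁻¹ *
      diracMatrix σ σ.rev ξ) (kineticOp v i σ.rev) + mulOp jw (scaleOp v i σ) := by
  have h0 : ∀ σ, kineticOp v i σ = mulOp (diracMatrix σ σ.rev) (v i σ.rev) := by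
    intro σ
    have hz : ∀ τ, mulOp (diracMatrix τ τ) = 0 := by
      intro τ
      ext1 w
      have : diracMatrix τ τ = fun _ => 0 := by
        funext ξ; fin_cases τ <;> simp [diracMatrix]
      rw [this, mulOp_const]; simp
    rw [kineticOp, matOp_apply]
    fin_cases σ
    · change mulOp (diracMatrix 0 0) _ + _ = mulOp (diracMatrix 0 1) (v i 1)
      rw [hz]; simp
    · change _ + mulOp (diracMatrix 1 1) _ = mulOp (diracMatrix 1 0) (v i 0)
      rw [hz]; simp
  have hm := (isMultiplier_diracMatrix σ σ.rev).const_mul (((2 * Real.pi) ^ 2 : ℂ)⁻¹)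
  rw [h0, Fin.rev_rev, scaleOp_apply, mulOp_mulOp hm (isMultiplier_diracMatrix _ _),
    mulOp_mulOp isMultiplier_jw isMultiplier_jw,
    ← mulOp_add (hm.mul (isMultiplier_diracMatrix _ _)) (isMultiplier_jw.mul isMultiplier_jw)]
  have : (fun ξ => (((2 * Real.pi) ^ 2 : ℂ)⁻¹ * diracMatrix σ σ.rev ξ) * diracMatrix σ.rev σ ξ +
      jw ξ * jw ξ) = fun _ => 1 := by
    funext ξ
    have h1 : diracMatrix σ σ.rev ξ * diracMatrix σ.rev σ ξ =
        ((2 * Real.pi * ‖ξ‖ : ℝ) : ℂ) ^ 2 * (jw ξ * jw ξ) := by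
      rw [← conj_mul_diracSymbol]
      fin_cases σ <;> simp [diracMatrix, Fin.rev] <;> ring
    have h2 : jw ξ * jw ξ = ((1 + ‖ξ‖ ^ 2 : ℝ) : ℂ)⁻¹ := by
      rw [← jap_sq, jw]; push_cast; ring
    have h3 : ((1 + ‖ξ‖ ^ 2 : ℝ) : ℂ) ≠ 0 := Complex.ofReal_ne_zero.2 (by positivity)
    have h4 : (Real.pi : ℂ) ≠ 0 := Complex.ofReal_ne_zero.2 Real.pi_ne_zero
    rw [mul_assoc, h1, h2]
    push_cast at h3 ⊢
    field_simp
    ring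
  rw [this, mulOp_const, one_smul]

/-- The generator and the scale operator together control the norm. -/
theorem norm_le_generator {a b : ℝ} (hc : ∀ n σ σ', ‖c n σ σ'‖ ≤ a) (hq : ∀ n, ‖q n‖ ≤ b) (s : ℕ)
    (v : Envelope) : ‖v‖ ≤ (1 + 6 * a * (1 + b) ^ s) *
      (‖generator c q (s + 1) v‖ + ‖scaleOp v‖) := by
  have ha : 0 ≤ a := (norm_nonneg _).trans (hc 0 0 0)
  have hb : 0 ≤ b := (norm_nonneg _).trans (hq 0)
  have h1 : ‖v‖ ≤ ‖kineticOp v‖ + ‖scaleOp v‖ := by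
    refine norm_envelope_le (by positivity) fun i σ => ?_
    have hm : IsMultiplier (fun ξ => ((2 * Real.pi) ^ 2 : ℂ)⁻¹ * diracMatrix σ σ.rev ξ) 1 := by
      refine ((isMultiplier_diracMatrix σ σ.rev).const_mul (((2 * Real.pi) ^ 2 : ℂ)⁻¹)).mono ?_
      have hp := Real.pi_gt_three
      rw [norm_inv, norm_pow, norm_mul, Complex.norm_real, Real.norm_of_nonneg Real.pi_pos.le,
        Complex.norm_ofNat, inv_mul_le_iff₀ (by positivity)]
      nlinarith
    rw [eq_mulOp_kinetic_add v i σ]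
    refine (norm_add_le _ _).trans (add_le_add ?_ ?_)
    · exact (norm_mulOp_le hm _).trans (by rw [one_mul]; exact norm_component_le _ _ _)
    · exact (norm_mulOp_le isMultiplier_jw _).trans (by rw [one_mul]; exact norm_component_le _ _ _)
  -- The coupling has order zero, so inside the generator it is one weight better than the kinetic
  -- part and is controlled by `scaleOp v`.
  have h2 : kineticOp v = generator c q (s + 1) v - couplingOp c q s (scaleOp v) := by
    rw [generator_apply, scaleOp_couplingOp, add_sub_cancel_right]
  have h3 := norm_couplingOp_le c q hc hq s (scaleOp v)
  have h4 : ‖kineticOp v‖ ≤ ‖generator c q (s + 1) v‖ + 6 * a * (1 + b) ^ s * ‖scaleOp v‖ := by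
    rw [h2]; exact (norm_sub_le _ _).trans (by gcongr)
  have h5 : 0 ≤ 6 * a * (1 + b) ^ s * ‖generator c q (s + 1) v‖ := by positivity
  nlinarith [norm_nonneg (scaleOp v)]

end coupling

/-! ### The free evolution -/

section matOp

variable {M N : Fin 2 → Fin 2 → Plane → ℂ} {C C' : ℝ}

theorem IsMultiplier.matMul (h : ∀ σ σ', IsMultiplier (M σ σ') C)
    (h' : ∀ σ σ', IsMultiplier (N σ σ') C') (σ σ' : Fin 2) :
    IsMultiplier (fun ξ => M σ 0 ξ * N 0 σ' ξ + M σ 1 ξ * N 1 σ' ξ) (C * C' + C * C') :=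
  ((h σ 0).mul (h' 0 σ')).add ((h σ 1).mul (h' 1 σ'))

theorem matOp_matOp (h : ∀ σ σ', IsMultiplier (M σ σ') C) (h' : ∀ σ σ', IsMultiplier (N σ σ') C')
    (v : Envelope) : matOp M (matOp N v) =
      matOp (fun σ σ' ξ => M σ 0 ξ * N 0 σ' ξ + M σ 1 ξ * N 1 σ' ξ) v := by
  funext i σ
  simp only [matOp_apply, map_add]
  rw [mulOp_add ((h σ 0).mul (h' 0 0)) ((h σ 1).mul (h' 1 0)),
    mulOp_add ((h σ 0).mul (h' 0 1)) ((h σ 1).mul (h' 1 1)),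
    ← mulOp_mulOp (h σ 0) (h' 0 0), ← mulOp_mulOp (h σ 1) (h' 1 0),
    ← mulOp_mulOp (h σ 0) (h' 0 1), ← mulOp_mulOp (h σ 1) (h' 1 1)]
  abel

theorem scaleOp_matOp' (h : ∀ σ σ', IsMultiplier (M σ σ') C) (v : Envelope) :
    scaleOp (matOp M v) = matOp (fun σ σ' ξ => jw ξ * M σ σ' ξ) v := by
  funext i σ
  simp only [matOp_apply, scaleOp_apply, map_add]
  rw [mulOp_mulOp isMultiplier_jw (h σ 0), mulOp_mulOp isMultiplier_jw (h σ 1)]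

theorem matOp_one (v : Envelope) :
    matOp (fun σ σ' _ => if σ = σ' then 1 else 0) v = v := by
  funext i σ
  rw [matOp_apply]
  simp only [mulOp_const]
  fin_cases σ <;> simp

theorem matOp_const_mul (h : ∀ σ σ', IsMultiplier (M σ σ') C) (c : ℂ) (v : Envelope) :
    matOp (fun σ σ' ξ => c * M σ σ' ξ) v = c • matOp M v := by
  funext i σ
  simp only [matOp_apply, Pi.smul_apply, smul_add]
  rw [mulOp_const_mul _ (h σ 0), mulOp_const_mul _ (h σ 1)]

theorem hasDerivAt_matOp {M : ℝ → Fin 2 → Fin 2 → Plane → ℂ} {D t : ℝ}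
    (h : ∀ T σ σ', IsMultiplier (M T σ σ') C) (h' : ∀ σ σ', IsMultiplier (N σ σ') C')
    (hM : ∀ σ σ' x ξ, ‖M (t + x) σ σ' ξ - M t σ σ' ξ - x * N σ σ' ξ‖ ≤ D * x ^ 2)
    {u : ℝ → Envelope} {u' : Envelope} (hu : HasDerivAt u u' t) :
    HasDerivAt (fun T => matOp (M T) (u T)) (matOp N (u t) + matOp (M t) u') t := by
  refine hasDerivAt_pi.2 fun i => hasDerivAt_pi.2 fun σ => ?_
  have hu' : ∀ σ, HasDerivAt (fun T => u T i σ) (u' i σ) t := fun σ =>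
    hasDerivAt_pi.1 (hasDerivAt_pi.1 hu i) σ
  have h0 := hasDerivAt_mulOp (fun T => h T σ 0) (h' σ 0) (hM σ 0) (hu' 0)
  have h1 := hasDerivAt_mulOp (fun T => h T σ 1) (h' σ 1) (hM σ 1) (hu' 1)
  simp only [matOp_apply, Pi.add_apply]
  convert! h0.add h1 using 1
  abel

theorem continuous_matOp {M : ℝ → Fin 2 → Fin 2 → Plane → ℂ}
    (h : ∀ T σ σ', IsMultiplier (M T σ σ') C) (hM : ∀ σ σ' ξ, Continuous fun T => M T σ σ' ξ)
    (v : Envelope) : Continuous fun T => matOp (M T) v := by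
  refine continuous_pi fun i => continuous_pi fun σ => ?_
  simp only [matOp_apply]
  exact (continuous_mulOp (fun T => h T σ 0) (hM σ 0) _).add
    (continuous_mulOp (fun T => h T σ 1) (hM σ 1) _)

end matOp

/-- The phase of the Dirac symbol. -/
def diracPhase (ξ : Plane) : ℂ := diracSymbol ξ / ((2 * Real.pi * ‖ξ‖ : ℝ) : ℂ)

theorem norm_diracPhase_le (ξ : Plane) : ‖diracPhase ξ‖ ≤ 1 := by
  rw [diracPhase, norm_div, norm_diracSymbol, Complex.norm_real, Real.norm_of_nonneg (by positivity)]
  exact div_self_le_one _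

theorem measurable_diracPhase : Measurable diracPhase :=
  continuous_diracSymbol.measurable.div
    (Complex.measurable_ofReal.comp (measurable_norm.const_mul _))

/-- At ξ = 0 the quotient defining the phase is 0 by convention, which is harmless because the
symbol vanishes there too. -/
theorem diracPhase_mul (ξ : Plane) :
    diracPhase ξ * ((2 * Real.pi * ‖ξ‖ : ℝ) : ℂ) = diracSymbol ξ := by
  by_cases h : ξ = 0
  · subst h; simp [diracSymbol]
  · refine div_mul_cancel₀ _ (Complex.ofReal_ne_zero.2 ?_)
    have := norm_pos_iff.2 h
    positivity

theorem conj_diracPhase_mul (ξ : Plane) :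
    (starRingEnd ℂ) (diracPhase ξ) * ((2 * Real.pi * ‖ξ‖ : ℝ) : ℂ) =
      (starRingEnd ℂ) (diracSymbol ξ) := by
  rw [← diracPhase_mul, map_mul, Complex.conj_ofReal]

theorem conj_symbol_mul_phase (ξ : Plane) :
    (starRingEnd ℂ) (diracSymbol ξ) * diracPhase ξ = ((2 * Real.pi * ‖ξ‖ : ℝ) : ℂ) := by
  by_cases h : ξ = 0
  · subst h; simp [diracSymbol]
  · have hr : ((2 * Real.pi * ‖ξ‖ : ℝ) : ℂ) ≠ 0 := by
      have := norm_pos_iff.2 h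
      exact Complex.ofReal_ne_zero.2 (by positivity)
    rw [diracPhase, mul_div_assoc', conj_mul_diracSymbol, sq, mul_div_assoc, div_self hr, mul_one]

theorem symbol_mul_conj_phase (ξ : Plane) :
    diracSymbol ξ * (starRingEnd ℂ) (diracPhase ξ) = ((2 * Real.pi * ‖ξ‖ : ℝ) : ℂ) := by
  have := congrArg (starRingEnd ℂ) (conj_symbol_mul_phase ξ)
  rwa [map_mul, Complex.conj_conj, Complex.conj_ofReal] at this

/-- The entries of the free propagator `e^{-iT σ·p}`. -/
def propMatrix (T : ℝ) (σ σ' : Fin 2) (ξ : Plane) : ℂ :=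
  if σ = σ' then (Real.cos (T * (2 * Real.pi * ‖ξ‖)) : ℂ)
  else (if σ = 0 then (starRingEnd ℂ) (diracPhase ξ) else diracPhase ξ) *
    (-Complex.I * (Real.sin (T * (2 * Real.pi * ‖ξ‖)) : ℂ))

theorem isMultiplier_propMatrix (T : ℝ) (σ σ' : Fin 2) : IsMultiplier (propMatrix T σ σ') 1 := by
  unfold propMatrix
  split_ifs with h1 h2
  · refine ⟨Complex.measurable_ofReal.comp (Continuous.measurable (by fun_prop)), fun ξ => ?_⟩
    rw [Complex.norm_real]
    exact Real.abs_cos_le_one _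
  all_goals
    refine ⟨Measurable.mul ?_ (measurable_const.mul (Complex.measurable_ofReal.comp
      (Continuous.measurable (by fun_prop)))), fun ξ => ?_⟩
    · first
        | exact Complex.continuous_conj.measurable.comp measurable_diracPhase
        | exact measurable_diracPhase
    · rw [norm_mul, norm_mul, norm_neg, Complex.norm_I, one_mul, Complex.norm_real]
      exact mul_le_one₀ (by simpa using norm_diracPhase_le ξ) (norm_nonneg _)
        (Real.abs_sin_le_one _)

theorem continuous_propMatrix (σ σ' : Fin 2) (ξ : Plane) :
    Continuous fun T => propMatrix T σ σ' ξ := by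
  unfold propMatrix
  split_ifs <;> fun_prop

/-- The free propagator. -/
def propOp (T : ℝ) : Envelope →L[ℂ] Envelope := matOp (propMatrix T)

/-- This is cos² + sin² = 1, together with the phase having modulus one off the origin; at the
origin the phase is 0, but so is the sine. -/
theorem propOp_propOp_neg (T : ℝ) (v : Envelope) : propOp T (propOp (-T) v) = v := by
  rw [propOp, propOp, matOp_matOp (isMultiplier_propMatrix T) (isMultiplier_propMatrix (-T))]
  conv_rhs => rw [← matOp_one v]
  congr 2
  funext σ σ' ξ
  have hcs : (Real.cos (T * (2 * Real.pi * ‖ξ‖)) : ℂ) ^ 2 +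
      (Real.sin (T * (2 * Real.pi * ‖ξ‖)) : ℂ) ^ 2 = 1 := by
    rw [← Complex.ofReal_pow, ← Complex.ofReal_pow, ← Complex.ofReal_add, Real.cos_sq_add_sin_sq,
      Complex.ofReal_one]
  have hph : (starRingEnd ℂ) (diracPhase ξ) * diracPhase ξ *
      (Real.sin (T * (2 * Real.pi * ‖ξ‖)) : ℂ) = (Real.sin (T * (2 * Real.pi * ‖ξ‖)) : ℂ) := by
    by_cases h : ξ = 0
    · subst h; simp
    · have hr : ((2 * Real.pi * ‖ξ‖ : ℝ) : ℂ) ≠ 0 := by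
        have := norm_pos_iff.2 h
        exact Complex.ofReal_ne_zero.2 (by positivity)
      have : (starRingEnd ℂ) (diracPhase ξ) * diracPhase ξ = 1 := by
        apply mul_right_cancel₀ hr
        rw [mul_right_comm, conj_diracPhase_mul, conj_symbol_mul_phase, one_mul]
      rw [this, one_mul]
  have hI := Complex.I_mul_I
  unfold propMatrix
  simp only [neg_mul, Real.cos_neg, Real.sin_neg, Complex.ofReal_neg]
  generalize (Real.cos (T * (2 * Real.pi * ‖ξ‖)) : ℂ) = c at *
  generalize (Real.sin (T * (2 * Real.pi * ‖ξ‖)) : ℂ) = s at *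
  fin_cases σ <;> fin_cases σ' <;> simp <;> first
    | linear_combination hcs + s * hph - (starRingEnd ℂ) (diracPhase ξ) * diracPhase ξ * s ^ 2 * hI
    | ring


/-- The time derivative of the propagator, in the Sobolev scale. -/
def propDeriv (T : ℝ) (σ σ' : Fin 2) (ξ : Plane) : ℂ :=
  -Complex.I * (jw ξ * (diracMatrix σ 0 ξ * propMatrix T 0 σ' ξ +
    diracMatrix σ 1 ξ * propMatrix T 1 σ' ξ))

theorem isMultiplier_propDeriv (T : ℝ) (σ σ' : Fin 2) :
    IsMultiplier (propDeriv T σ σ') (4 * Real.pi) := by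
  have := (isMultiplier_jw.mul (IsMultiplier.matMul isMultiplier_diracMatrix
    (isMultiplier_propMatrix T) σ σ')).const_mul (-Complex.I)
  refine this.mono (le_of_eq ?_)
  rw [norm_neg, Complex.norm_I]
  ring

theorem norm_cos_taylor_le (a x : ℝ) :
    |Real.cos (a + x) - Real.cos a + x * Real.sin a| ≤ x ^ 2 := by
  have h := norm_taylor_le Real.hasDerivAt_cos
    (fun x y => by
      rw [Real.norm_eq_abs, neg_sub_neg, abs_sub_comm]
      exact Real.abs_sin_sub_sin_le x y) a x
  simpa [sub_neg_eq_add] using h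

theorem norm_sin_taylor_le (a x : ℝ) :
    |Real.sin (a + x) - Real.sin a - x * Real.cos a| ≤ x ^ 2 := by
  have h := norm_taylor_le Real.hasDerivAt_sin (fun x y => Real.abs_cos_sub_cos_le x y) a x
  simpa using h

/-- Each time derivative of the propagator costs a factor |p|, so the second-order remainder is at
most x²|p|², which the two weights `jw` absorb. Two Sobolev levels are spent here. -/
theorem norm_propMatrix_taylor_le (t x : ℝ) (σ σ' : Fin 2) (ξ : Plane) :
    ‖jw ξ * (jw ξ * propMatrix (t + x) σ σ' ξ) - jw ξ * (jw ξ * propMatrix t σ σ' ξ) -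
      x * propDeriv t σ σ' ξ‖ ≤ (2 * Real.pi) ^ 2 * x ^ 2 := by
  set r := 2 * Real.pi * ‖ξ‖ with hr
  have hjr : ‖jw ξ‖ ^ 2 * (x * r) ^ 2 ≤ (2 * Real.pi) ^ 2 * x ^ 2 := by
    have : (jap ξ)⁻¹ * ‖ξ‖ ≤ 1 := by
      rw [inv_mul_le_iff₀ (jap_pos ξ), mul_one]; exact norm_le_jap ξ
    have h2 : ((jap ξ)⁻¹ * ‖ξ‖) ^ 2 ≤ 1 :=
      pow_le_one₀ (mul_nonneg (inv_nonneg.2 (jap_pos ξ).le) (norm_nonneg _)) this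
    calc ‖jw ξ‖ ^ 2 * (x * r) ^ 2 = (2 * Real.pi) ^ 2 * x ^ 2 * ((jap ξ)⁻¹ * ‖ξ‖) ^ 2 := by
          rw [norm_jw, hr]; ring
      _ ≤ (2 * Real.pi) ^ 2 * x ^ 2 * 1 := by gcongr
      _ = _ := mul_one _
  have hcos : ‖(Real.cos ((t + x) * r) - Real.cos (t * r) + x * r * Real.sin (t * r) : ℂ)‖ ≤
      (x * r) ^ 2 := by
    have := norm_cos_taylor_le (t * r) (x * r)
    rw [← add_mul] at this
    exact_mod_cast this
  have hsin : ‖(Real.sin ((t + x) * r) - Real.sin (t * r) - x * r * Real.cos (t * r) : ℂ)‖ ≤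
      (x * r) ^ 2 := by
    have := norm_sin_taylor_le (t * r) (x * r)
    rw [← add_mul] at this
    exact_mod_cast this
  have hI := Complex.I_mul_I
  have h1 := conj_symbol_mul_phase ξ
  have h2 := symbol_mul_conj_phase ξ
  have h3 := diracPhase_mul ξ
  have h4 := conj_diracPhase_mul ξ
  rw [← hr] at h1 h2 h3 h4
  have hph := norm_diracPhase_le ξ
  have hbound : ∀ z w : ℂ, ‖z‖ ≤ 1 → ‖w‖ ≤ (x * r) ^ 2 →
      ‖jw ξ ^ 2 * (z * w)‖ ≤ (2 * Real.pi) ^ 2 * x ^ 2 := by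
    intro z w hz hw
    rw [norm_mul, norm_pow, norm_mul]
    refine (mul_le_mul_of_nonneg_left ?_ (by positivity)).trans hjr
    exact (mul_le_of_le_one_left (norm_nonneg _) hz).trans hw
  have hz : ‖-Complex.I * diracPhase ξ‖ ≤ 1 := by simpa using hph
  have hz' : ‖-Complex.I * (starRingEnd ℂ) (diracPhase ξ)‖ ≤ 1 := by simpa using hph
  unfold propDeriv propMatrix diracMatrix
  simp only [← hr]
  fin_cases σ <;> fin_cases σ'
  · convert hbound 1 _ (by simp) hcos using 2
    simp
    linear_combination ((jw ξ) ^ 2 * x * Complex.sin (t * r)) * (h1 -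
      (starRingEnd ℂ) (diracSymbol ξ) * diracPhase ξ * hI)
  · convert hbound _ _ hz' hsin using 2
    simp
    linear_combination (-(jw ξ) ^ 2 * x * Complex.cos (t * r) * Complex.I) * h4
  · convert hbound _ _ hz hsin using 2
    simp
    linear_combination (-(jw ξ) ^ 2 * x * Complex.cos (t * r) * Complex.I) * h3
  · convert hbound 1 _ (by simp) hcos using 2
    simp
    linear_combination ((jw ξ) ^ 2 * x * Complex.sin (t * r)) * (h2 -
      diracSymbol ξ * (starRingEnd ℂ) (diracPhase ξ) * hI)

theorem hasDerivAt_propOp {t : ℝ} {u : ℝ → Envelope} {u' : Envelope} (hu : HasDerivAt u u' t) :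
    HasDerivAt (fun T => scaleOp (scaleOp (propOp T (u T))))
      (-Complex.I • scaleOp (kineticOp (propOp t (u t))) + scaleOp (scaleOp (propOp t u'))) t := by
  have h1 : ∀ T σ σ', IsMultiplier (fun ξ => jw ξ * propMatrix T σ σ' ξ) (1 * 1) :=
    fun T σ σ' => isMultiplier_jw.mul (isMultiplier_propMatrix T σ σ')
  have h2 : ∀ T σ σ', IsMultiplier (fun ξ => jw ξ * (jw ξ * propMatrix T σ σ' ξ)) (1 * (1 * 1)) :=
    fun T σ σ' => isMultiplier_jw.mul (h1 T σ σ')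
  have e : ∀ T v, scaleOp (scaleOp (propOp T v)) =
      matOp (fun σ σ' ξ => jw ξ * (jw ξ * propMatrix T σ σ' ξ)) v := fun T v => by
    rw [propOp, scaleOp_matOp' (isMultiplier_propMatrix T), scaleOp_matOp' (h1 T)]
  have e' : -Complex.I • scaleOp (kineticOp (propOp t (u t))) = matOp (propDeriv t) (u t) := by
    have hm := IsMultiplier.matMul isMultiplier_diracMatrix (isMultiplier_propMatrix t)
    rw [kineticOp, propOp, matOp_matOp isMultiplier_diracMatrix (isMultiplier_propMatrix t),
      scaleOp_matOp' hm, ← matOp_const_mul (fun σ σ' => isMultiplier_jw.mul (hm σ σ'))]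
    rfl
  simp_rw [e]
  rw [e']
  exact hasDerivAt_matOp h2 (isMultiplier_propDeriv t)
    (fun σ σ' x ξ => norm_propMatrix_taylor_le t x σ σ' ξ) hu

/-! ### The Bistritzer-MacDonald evolution in momentum space -/

section evolution

variable (c : Fin 3 → Fin 2 → Fin 2 → ℂ) (q : Fin 3 → Plane)

theorem norm_propOp_le (T : ℝ) (v : Envelope) : ‖propOp T v‖ ≤ 2 * ‖v‖ := by
  simpa [propOp] using norm_matOp_le (isMultiplier_propMatrix T) v

theorem propOp_zero (v : Envelope) : propOp 0 v = v := by
  have : propMatrix 0 = fun σ σ' _ => if σ = σ' then 1 else 0 := by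
    funext σ σ' ξ
    simp [propMatrix]
  rw [propOp, this, matOp_one]

/-- Existence of the evolution, for initial values at the level `8` of the Sobolev scale. -/
theorem exists_isScaleSolution (v₀ : Envelope) : ∃ v : ℝ → Envelope, v 0 = v₀ ∧
    IsScaleSolution scaleOp (generator c q) 7 (fun T => scaleOp (v T)) := by
  have hcont : ∀ x, Continuous fun T => propOp T x := fun x =>
    continuous_matOp isMultiplier_propMatrix continuous_propMatrix x
  have hcont' : ∀ x, Continuous fun T => propOp (-T) x := fun x => (hcont x).comp continuous_neg
  -- Interaction picture: writing v = P(T) u with the free propagator P, the unbounded Dirac term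
  -- drops out and u' = −i P(−T) C P(T) u, where C is the coupling at level 8, a bounded operator.
  let A : ℝ → Envelope →L[ℂ] Envelope := fun T =>
    -Complex.I • (propOp (-T) ∘L couplingOp c q 8 ∘L propOp T)
  have hA : ∀ x, Continuous fun T => A T x := fun x =>
    (continuous_clm_apply hcont' (fun T => norm_propOp_le (-T))
      ((couplingOp c q 8).continuous.comp (hcont x))).const_smul (-Complex.I)
  have hK : ∀ T x, ‖A T x‖ ≤ 4 * ‖couplingOp c q 8‖ * ‖x‖ := fun T x => by
    have h1 := norm_propOp_le (-T) (couplingOp c q 8 (propOp T x))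
    have h2 := (couplingOp c q 8).le_opNorm (propOp T x)
    have h3 := mul_le_mul_of_nonneg_left (norm_propOp_le T x) (norm_nonneg (couplingOp c q 8))
    have h4 : ‖A T x‖ = ‖propOp (-T) (couplingOp c q 8 (propOp T x))‖ := by
      simp [A, norm_smul]
    rw [h4]
    linarith
  obtain ⟨u, hu0, hu⟩ := exists_hasDerivAt_of_strongly_continuous hA hK (by positivity) v₀
  refine ⟨fun T => propOp T (u T), by simp only [hu0, propOp_zero], fun T _ => ?_⟩
  have h := hasDerivAt_propOp (hu T)
  have e : -Complex.I • generator c q 7 (scaleOp (propOp T (u T))) =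
      -Complex.I • scaleOp (kineticOp (propOp T (u T))) +
        scaleOp (scaleOp (propOp T (A T (u T)))) := by
    have : propOp T (A T (u T)) = -Complex.I • couplingOp c q 8 (propOp T (u T)) := by
      simp only [A, smul_apply, ContinuousLinearMap.comp_apply, map_smul,
        propOp_propOp_neg]
    rw [← scaleOp_generator, generator_apply, this, map_add, smul_add, map_smul, map_smul]
  rw [e]
  exact h.hasDerivWithinAt

/-- The total `L²` norm, squared. -/
def energy (v : Envelope) : ℝ := ∑ i : Fin 2, ∑ σ : Fin 2, ‖v i σ‖ ^ 2

/-- Envelopes carry the maximum norm over components, whereas the flow conserves the Hilbert sum.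
This and `energy_le` compare the two. -/
theorem sq_norm_le_energy (v : Envelope) : ‖v‖ ^ 2 ≤ energy v := by
  have h : ‖v‖ ≤ Real.sqrt (energy v) := by
    refine norm_envelope_le (Real.sqrt_nonneg _) fun i σ => Real.le_sqrt_of_sq_le ?_
    exact (Finset.single_le_sum (f := fun σ => ‖v i σ‖ ^ 2) (fun _ _ => by positivity)
      (Finset.mem_univ σ)).trans (Finset.single_le_sum (f := fun i => ∑ σ, ‖v i σ‖ ^ 2)
      (fun _ _ => by positivity) (Finset.mem_univ i))
  have h0 : 0 ≤ energy v := by unfold energy; positivity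
  calc ‖v‖ ^ 2 ≤ Real.sqrt (energy v) ^ 2 := by gcongr
    _ = energy v := Real.sq_sqrt h0

theorem energy_le (v : Envelope) : energy v ≤ 4 * ‖v‖ ^ 2 := by
  have : ∀ i σ, ‖v i σ‖ ^ 2 ≤ ‖v‖ ^ 2 := fun i σ =>
    pow_le_pow_left₀ (norm_nonneg _) (norm_component_le v i σ) 2
  simp only [energy, Fin.sum_univ_two]
  linarith [this 0 0, this 0 1, this 1 0, this 1 1]

/-- The generator is symmetric. -/
theorem generator_symm (x : Envelope) :
    ∑ i : Fin 2, ∑ σ : Fin 2, (inner ℂ (scaleOp x i σ) (generator c q 1 x i σ)).im = 0 := by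
  -- Kinetic part: the symbol matrix is Hermitian and commutes with the weight, so the two
  -- sublattices contribute opposite imaginary parts.
  have hP : ∀ i, (inner ℂ (scaleOp x i 0) (kineticOp x i 0)).im +
      (inner ℂ (scaleOp x i 1) (kineticOp x i 1)).im = 0 := by
    intro i
    have hz : ∀ τ, mulOp (diracMatrix τ τ) = 0 := by
      intro τ
      ext1 w
      have : diracMatrix τ τ = fun _ => 0 := by
        funext ξ; fin_cases τ <;> simp [diracMatrix]
      rw [this, mulOp_const]; simp
    have e0 : kineticOp x i 0 = mulOp (diracMatrix 0 1) (x i 1) := by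
      rw [kineticOp, matOp_apply, hz]; simp
    have e1 : kineticOp x i 1 = mulOp (diracMatrix 1 0) (x i 0) := by
      rw [kineticOp, matOp_apply, hz]; simp
    have hd : (fun ξ => (starRingEnd ℂ) (diracMatrix 0 1 ξ)) = diracMatrix 1 0 := by
      funext ξ; simp [diracMatrix, conj_jw]
    rw [e0, e1, scaleOp_apply, scaleOp_apply, ← inner_conj_symm, Complex.conj_im,
      inner_mulOp_left (isMultiplier_diracMatrix 0 1), hd, inner_mulOp_left isMultiplier_jw,
      mulOp_comm (isMultiplier_diracMatrix 1 0) isMultiplier_jw]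
    simp only [conj_jw]
    exact neg_add_cancel _
  -- Coupling part: the two off-diagonal blocks have conjugate coefficients and opposite
  -- translations, so they are adjoint to each other and the imaginary parts cancel in pairs.
  have hB : ∀ n σ σ', (inner ℂ (scaleOp x 0 σ) (couplingCoeff c 0 n σ σ' •
        shiftOp 0 (couplingShift q 0 n) (scaleOp x 1 σ'))).im +
      (inner ℂ (scaleOp x 1 σ') (couplingCoeff c 1 n σ' σ •
        shiftOp 0 (couplingShift q 1 n) (scaleOp x 0 σ))).im = 0 := by
    intro n σ σ'
    have e1 : couplingCoeff c 1 n σ' σ = (starRingEnd ℂ) (couplingCoeff c 0 n σ σ') := by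
      simp [couplingCoeff]
    have e2 : couplingShift q 1 n = -couplingShift q 0 n := by simp [couplingShift]
    rw [shiftOp_zero, shiftOp_zero, e1, e2, ← inner_conj_symm, Complex.conj_im, inner_smul_left,
      inner_smul_right, inner_transOp_left]
    exact neg_add_cancel _
  simp only [generator_apply, scaleOp_couplingOp, Pi.add_apply, inner_add_right, Complex.add_im,
    couplingOp_apply, inner_sum, Complex.im_sum]
  simp only [Fin.sum_univ_two, Fin.sum_univ_three]
  have r0 : Fin.rev (0 : Fin 2) = 1 := rfl
  have r1 : Fin.rev (1 : Fin 2) = 0 := rfl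
  simp only [r0, r1]
  linarith [hP 0, hP 1, hB 0 0 0, hB 0 0 1, hB 0 1 0, hB 0 1 1, hB 1 0 0, hB 1 0 1, hB 1 1 0,
    hB 1 1 1, hB 2 0 0, hB 2 0 1, hB 2 1 0, hB 2 1 1]

/-- The derivative of the energy is twice the imaginary part that vanishes in `generator_symm`. -/
theorem energy_conserved {x : ℝ → Envelope} (h : IsScaleSolution scaleOp (generator c q) 1 x)
    {T : ℝ} (hT : 0 ≤ T) : energy (scaleOp (x T)) = energy (scaleOp (x 0)) := by
  have hder : ∀ t, 0 ≤ t → HasDerivWithinAt (fun t => energy (scaleOp (x t))) 0 (Ici 0) t := by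
    intro t ht
    have h1 : ∀ i σ, HasDerivWithinAt (fun t => ‖scaleOp (x t) i σ‖ ^ 2)
        (2 * (inner ℂ (scaleOp (x t) i σ) (generator c q 1 (x t) i σ)).im) (Ici 0) t := by
      intro i σ
      have h2 := hasDerivWithinAt_pi.1 (hasDerivWithinAt_pi.1 (h t ht) i) σ
      have h3 := (h2.inner ℂ h2)
      have h4 := Complex.reCLM.hasFDerivAt.comp_hasDerivWithinAt t h3
      have h5 : (fun t => ‖scaleOp (x t) i σ‖ ^ 2) =
          Complex.reCLM ∘ fun t => inner ℂ (scaleOp (x t) i σ) (scaleOp (x t) i σ) :=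
        funext fun t => (inner_self_eq_norm_sq (𝕜 := ℂ) _).symm
      rw [h5]
      refine h4.congr_deriv ?_
      simp only [Complex.reCLM_apply, Complex.add_re, Pi.smul_apply]
      rw [inner_smul_left, inner_smul_right, ← inner_conj_symm (generator c q 1 (x t) i σ)]
      generalize inner ℂ (scaleOp (x t) i σ) (generator c q 1 (x t) i σ) = z
      simp
      ring
    have h5 := HasDerivWithinAt.fun_sum (u := Finset.univ) fun i _ =>
      HasDerivWithinAt.fun_sum (u := Finset.univ) fun σ _ => h1 i σ
    refine h5.congr_deriv ?_
    simp_rw [← Finset.mul_sum]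
    rw [generator_symm, mul_zero]
  refine constant_of_has_deriv_right_zero (a := 0) (b := T)
    (f := fun t => energy (scaleOp (x t))) (fun t ht => ?_) (fun t ht => ?_) T ⟨hT, le_rfl⟩
  · exact ((hder t ht.1).mono Icc_subset_Ici_self).continuousWithinAt
  · exact (hder t ht.1).mono (Ici_subset_Ici.2 ht.1)

theorem norm_conserved {x : ℝ → Envelope} (h : IsScaleSolution scaleOp (generator c q) 1 x)
    {T : ℝ} (hT : 0 ≤ T) : ‖scaleOp (x T)‖ ≤ 2 * ‖scaleOp (x 0)‖ := by
  have h1 := sq_norm_le_energy (scaleOp (x T))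
  rw [energy_conserved c q h hT] at h1
  have h2 := energy_le (scaleOp (x 0))
  refine le_of_sq_le_sq ?_ (by positivity)
  linarith

/-- The constant in the uniform Sobolev bounds. -/
def evolutionConst (a b : ℝ) (s : ℕ) : ℝ :=
  scaleConst 2 (generatorBound a b) (fun s => 1 + 6 * a * (1 + b) ^ s) s

/-- Sobolev norms stay bounded, uniformly in time. -/
theorem norm_evolution_le {a b : ℝ} (hc : ∀ n σ σ', ‖c n σ σ'‖ ≤ a) (hq : ∀ n, ‖q n‖ ≤ b) (s : ℕ)
    {x : ℝ → Envelope} (h : IsScaleSolution scaleOp (generator c q) (s + 1) x) {T : ℝ}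
    (hT : 0 ≤ T) : ‖scaleOp (x T)‖ ≤ evolutionConst a b s * ‖scaleOp (x 0)‖ := by
  have ha : 0 ≤ a := (norm_nonneg _).trans (hc 0 0 0)
  have hb : 0 ≤ b := (norm_nonneg _).trans (hq 0)
  exact h.norm_le (by norm_num) (fun s => by unfold generatorBound; positivity)
    (fun s => by positivity) norm_scaleOp_le (scaleOp_generator c q) (norm_generator_le c q hc hq)
    (norm_le_generator c q hc hq) (fun x hx T hT => norm_conserved c q hx hT) s hT

end evolution

open scoped FourierTransform

/-! ### Position space and momentum space -/

theorem toTemperedDistribution_injective :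
    Function.Injective fun u : L2 => (u : 𝓢'(Plane, ℂ)) := by
  have h := Lp.ker_toTemperedDistributionCLM_eq_bot (F := ℂ) (μ := (volume : Measure Plane)) (p := 2)
  exact LinearMap.ker_eq_bot.1 h

theorem smulLeftCLM_coe {g : Plane → ℂ} (hg : g.HasTemperateGrowth) {u v : L2}
    (h : v =ᵐ[volume] fun ξ => g ξ * u ξ) :
    smulLeftCLM ℂ g (u : 𝓢'(Plane, ℂ)) = (v : 𝓢'(Plane, ℂ)) := by
  ext φ
  simp only [smulLeftCLM_apply_apply, Lp.toTemperedDistribution_apply]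
  apply integral_congr_ae
  filter_upwards [h] with ξ hξ
  rw [SchwartzMap.smulLeftCLM_apply_apply hg, hξ]
  simp only [smul_eq_mul]
  ring

theorem temperate_character (w : Plane) :
    (fun X : Plane => Complex.exp (-Complex.I * (inner ℝ w X : ℝ))).HasTemperateGrowth :=
  temperate_cexp.comp (g := fun t : ℝ => Complex.exp (-Complex.I * (t : ℂ)))
    (f := fun X => inner ℝ w X) (by fun_prop)

/-- Modulation in position space is translation in momentum space. -/
theorem smulLeftCLM_character (q : Plane) (z : L2) :
    smulLeftCLM ℂ (fun X : Plane => Complex.exp (-Complex.I * (inner ℝ ((2 * Real.pi) • q) X : ℝ)))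
      ((𝓕⁻ z : L2) : 𝓢'(Plane, ℂ)) = ((𝓕⁻ (transOp q z) : L2) : 𝓢'(Plane, ℂ)) := by
  rw [← Lp.fourierInv_toTemperedDistribution_eq, ← Lp.fourierInv_toTemperedDistribution_eq]
  ext φ
  simp only [smulLeftCLM_apply_apply, TemperedDistribution.fourierInv_apply,
    Lp.toTemperedDistribution_apply, smul_eq_mul]
  -- By duality: a character on the test function shifts its inverse Fourier transform, and
  -- translation invariance of the integral moves the shift onto z.
  have h1 : ∀ ξ, 𝓕⁻ (SchwartzMap.smulLeftCLM ℂ (fun X : Plane =>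
      Complex.exp (-Complex.I * (inner ℝ ((2 * Real.pi) • q) X : ℝ))) φ) (ξ + q) = 𝓕⁻ φ ξ := by
    intro ξ
    rw [SchwartzMap.fourierInv_coe, SchwartzMap.fourierInv_coe, Real.fourierInv_eq',
      Real.fourierInv_eq']
    congr 1
    funext X
    rw [SchwartzMap.smulLeftCLM_apply_apply (temperate_character _), smul_eq_mul, smul_eq_mul,
      smul_eq_mul, ← mul_assoc, ← Complex.exp_add]
    congr 2
    rw [inner_add_right, real_inner_smul_left, real_inner_comm X q]
    push_cast
    ring
  rw [← integral_add_right_eq_self _ q]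
  apply integral_congr_ae
  filter_upwards [coeFn_transOp q z] with ξ hξ
  rw [h1, hξ]

theorem coe_const_smul (c : ℂ) (u : L2) :
    ((c • u : L2) : 𝓢'(Plane, ℂ)) = c • (u : 𝓢'(Plane, ℂ)) :=
  (Lp.toTemperedDistributionCLM ℂ (volume : Measure Plane) 2).map_smul c u

theorem coe_add (u v : L2) :
    ((u + v : L2) : 𝓢'(Plane, ℂ)) = (u : 𝓢'(Plane, ℂ)) + (v : 𝓢'(Plane, ℂ)) :=
  (Lp.toTemperedDistributionCLM ℂ (volume : Measure Plane) 2).map_add u v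

theorem coe_sum {ι : Type*} (s : Finset ι) (u : ι → L2) :
    ((∑ i ∈ s, u i : L2) : 𝓢'(Plane, ℂ)) = ∑ i ∈ s, (u i : 𝓢'(Plane, ℂ)) :=
  map_sum (Lp.toTemperedDistributionCLM ℂ (volume : Measure Plane) 2) u s

theorem isMultiplier_coord (j : Fin 2) :
    IsMultiplier (fun ξ => (2 * Real.pi * Complex.I) * (ξ j : ℂ) * jw ξ) (2 * Real.pi) := by
  refine ⟨Measurable.mul (Continuous.measurable (by fun_prop)) isMultiplier_jw.meas, fun ξ => ?_⟩
  have h : |ξ j| ≤ jap ξ := (PiLp.norm_apply_le ξ j).trans (norm_le_jap ξ)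
  rw [norm_mul, norm_mul, norm_jw]
  simp only [norm_mul, Complex.norm_I, Complex.norm_real, Complex.norm_ofNat, Real.norm_eq_abs,
    abs_of_pos Real.pi_pos, mul_one]
  rw [mul_assoc]
  refine mul_le_of_le_one_right (by positivity) ?_
  rw [← div_eq_mul_inv]
  exact (div_le_one (jap_pos ξ)).2 h

/-- Differentiation multiplies the Fourier transform by the unbounded function 2πi ξ_j; the weight
`jw` makes it a bounded multiplier, so the derivative is again in L². -/
theorem lineDeriv_fourierInv (j : Fin 2) (y : L2) :
    ∂_{(EuclideanSpace.single j (1 : ℝ) : Plane)} ((𝓕⁻ (mulOp jw y) : L2) : 𝓢'(Plane, ℂ)) =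
      ((𝓕⁻ (mulOp (fun ξ => (2 * Real.pi * Complex.I) * (ξ j : ℂ) * jw ξ) y) : L2) :
        𝓢'(Plane, ℂ)) := by
  rw [← Lp.fourierInv_toTemperedDistribution_eq, ← Lp.fourierInv_toTemperedDistribution_eq,
    TemperedDistribution.lineDerivOp_fourierInv_eq]
  congr 1
  have hg : (fun ξ : Plane => ((inner ℝ ξ (EuclideanSpace.single j (1 : ℝ)) : ℝ) : ℂ)).HasTemperateGrowth := by
    fun_prop
  have hm : IsMultiplier (fun ξ => ((inner ℝ ξ (EuclideanSpace.single j (1 : ℝ)) : ℝ) : ℂ) * jw ξ) 1 := by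
    refine ⟨Measurable.mul (Continuous.measurable (by fun_prop)) isMultiplier_jw.meas, fun ξ => ?_⟩
    rw [norm_mul, norm_jw, Complex.norm_real, ← div_eq_mul_inv]
    refine (div_le_one (jap_pos ξ)).2 ((abs_real_inner_le_norm _ _).trans ?_)
    simpa using norm_le_jap ξ
  rw [smulLeftCLM_coe (v := mulOp (fun ξ => ((inner ℝ ξ (EuclideanSpace.single j (1 : ℝ)) : ℝ) : ℂ)
    * jw ξ) y) hg, ← coe_const_smul, ← mulOp_const_mul _ hm]
  · congr 3
    funext ξ
    rw [EuclideanSpace.inner_single_right]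
    simp
    ring
  · filter_upwards [coeFn_mulOp hm y, coeFn_mulOp isMultiplier_jw y] with ξ h1 h2
    rw [h1, h2, mul_assoc]

/-- The coefficients of the coupling of the scaled Bistritzer-MacDonald Hamiltonian. -/
def bmCoeff (lam₀ : ℝ) (d : Plane) (θ : ℝ) (n : Fin 3) (σ σ' : Fin 2) : ℂ :=
  lam₀ * hoppingMatrix d θ n σ σ'

/-- The momentum shifts of the coupling of the scaled Bistritzer-MacDonald Hamiltonian. -/
def bmShift (θ γ : ℝ) (n : Fin 3) : Plane := (2 * Real.pi)⁻¹ • γ⁻¹ • momentumShift θ n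

theorem scaledMoireBlock_eq (lam₀ : ℝ) (d : Plane) (θ γ : ℝ) (i σ σ' : Fin 2) (X : Plane) :
    scaledMoireBlock lam₀ d θ γ i σ σ' X = ∑ n : Fin 3, couplingCoeff (bmCoeff lam₀ d θ) i n σ σ' *
      Complex.exp (-Complex.I *
        (inner ℝ ((2 * Real.pi) • couplingShift (bmShift θ γ) i n) X : ℝ)) := by
  have h : ∀ n, (2 * Real.pi) • bmShift θ γ n = γ⁻¹ • momentumShift θ n := fun n => by
    rw [bmShift, smul_smul, mul_inv_cancel₀ (by positivity), one_smul]
  unfold scaledMoireBlock couplingCoeff couplingShift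
  split_ifs
  · simp only [h, scaledMoire, moire, bmCoeff, Finset.mul_sum, real_inner_smul_left,
      inner_smul_right, mul_assoc]
  · simp only [smul_neg, h, scaledMoire, moire, bmCoeff, Finset.mul_sum, real_inner_smul_left,
      inner_smul_right, mul_assoc, inner_neg_left, map_sum, map_mul, Complex.conj_ofReal,
      ← Complex.exp_conj, map_neg, Complex.conj_I, Complex.ofReal_neg]
    simp

theorem smulLeftCLM_scaledMoireBlock (lam₀ : ℝ) (d : Plane) (θ γ : ℝ) (i σ σ' : Fin 2) (z : L2) :
    smulLeftCLM ℂ (scaledMoireBlock lam₀ d θ γ i σ σ') ((𝓕⁻ z : L2) : 𝓢'(Plane, ℂ)) =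
      ((𝓕⁻ (∑ n : Fin 3, couplingCoeff (bmCoeff lam₀ d θ) i n σ σ' •
        shiftOp 0 (couplingShift (bmShift θ γ) i n) z) : L2) : 𝓢'(Plane, ℂ)) := by
  have e : scaledMoireBlock lam₀ d θ γ i σ σ' = fun X => ∑ n : Fin 3,
      (couplingCoeff (bmCoeff lam₀ d θ) i n σ σ' • fun X : Plane => Complex.exp (-Complex.I *
        (inner ℝ ((2 * Real.pi) • couplingShift (bmShift θ γ) i n) X : ℝ))) X :=
    funext fun X => scaledMoireBlock_eq lam₀ d θ γ i σ σ' X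
  rw [e, TemperedDistribution.smulLeftCLM_sum]
  · have hs : (𝓕⁻ (∑ n : Fin 3, couplingCoeff (bmCoeff lam₀ d θ) i n σ σ' •
        shiftOp 0 (couplingShift (bmShift θ γ) i n) z) : L2) =
        ∑ n : Fin 3, couplingCoeff (bmCoeff lam₀ d θ) i n σ σ' •
        𝓕⁻ (transOp (couplingShift (bmShift θ γ) i n) z) := by
      change (Lp.fourierTransformₗᵢ Plane ℂ).symm _ = _
      rw [map_sum]
      simp only [map_smul, shiftOp_zero]
      rfl
    rw [hs, coe_sum, sum_apply]
    refine Finset.sum_congr rfl fun n _ => ?_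
    rw [TemperedDistribution.smulLeftCLM_smul (temperate_character _), smul_apply,
      smulLeftCLM_character, coe_const_smul]
  · intro n _
    exact (Function.HasTemperateGrowth.const _).mul (temperate_character _)

/-- The Fourier transform of envelopes. -/
def envFourier : Envelope →L[ℂ] Envelope :=
  ContinuousLinearMap.pi fun i => ContinuousLinearMap.pi fun σ =>
    (Lp.fourierTransformₗᵢ Plane ℂ).toContinuousLinearEquiv.toContinuousLinearMap ∘L
      (ContinuousLinearMap.proj σ) ∘L
      (ContinuousLinearMap.proj (R := ℂ) (φ := fun _ : Fin 2 => Fin 2 → L2) i)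

/-- The inverse Fourier transform of envelopes. -/
def envFourierInv : Envelope →L[ℂ] Envelope :=
  ContinuousLinearMap.pi fun i => ContinuousLinearMap.pi fun σ =>
    (Lp.fourierTransformₗᵢ Plane ℂ).symm.toContinuousLinearEquiv.toContinuousLinearMap ∘L
      (ContinuousLinearMap.proj σ) ∘L
      (ContinuousLinearMap.proj (R := ℂ) (φ := fun _ : Fin 2 => Fin 2 → L2) i)

theorem envFourier_apply (v : Envelope) (i σ : Fin 2) : envFourier v i σ = 𝓕 (v i σ) := rfl

theorem envFourierInv_apply (v : Envelope) (i σ : Fin 2) : envFourierInv v i σ = 𝓕⁻ (v i σ) := rfl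

theorem envFourier_envFourierInv (v : Envelope) : envFourier (envFourierInv v) = v := by
  funext i σ
  exact (Lp.fourierTransformₗᵢ Plane ℂ).apply_symm_apply (v i σ)

theorem envFourierInv_envFourier (v : Envelope) : envFourierInv (envFourier v) = v := by
  funext i σ
  exact (Lp.fourierTransformₗᵢ Plane ℂ).symm_apply_apply (v i σ)

theorem fourierInv_add' (u v : L2) : (𝓕⁻ (u + v) : L2) = 𝓕⁻ u + 𝓕⁻ v :=
  (Lp.fourierTransformₗᵢ Plane ℂ).symm.map_add u v

theorem fourierInv_smul' (c : ℂ) (u : L2) : (𝓕⁻ (c • u) : L2) = c • 𝓕⁻ u :=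
  (Lp.fourierTransformₗᵢ Plane ℂ).symm.map_smul c u

theorem kineticOp_apply (y : Envelope) (i σ : Fin 2) :
    kineticOp y i σ = ∑ σ' : Fin 2, ∑ j : Fin 2, pauli j σ σ' • (-Complex.I •
      mulOp (fun ξ => (2 * Real.pi * Complex.I) * (ξ j : ℂ) * jw ξ) (y i σ')) := by
  have h : ∀ σ', mulOp (diracMatrix σ σ') (y i σ') = ∑ j : Fin 2, pauli j σ σ' • (-Complex.I •
      mulOp (fun ξ => (2 * Real.pi * Complex.I) * (ξ j : ℂ) * jw ξ) (y i σ')) := by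
    intro σ'
    simp only [smul_smul, Fin.sum_univ_two]
    rw [← mulOp_const_mul _ (isMultiplier_coord 0), ← mulOp_const_mul _ (isMultiplier_coord 1),
      ← mulOp_add ((isMultiplier_coord 0).const_mul _) ((isMultiplier_coord 1).const_mul _)]
    congr 2
    funext ξ
    have hI := Complex.I_mul_I
    fin_cases σ <;> fin_cases σ' <;> simp [diracMatrix, pauli, diracSymbol, Complex.conj_ofNat]
    · linear_combination (2 * Real.pi * jw ξ * ξ 0) * hI
    · linear_combination (2 * Real.pi * jw ξ * ξ 0) * hI
  rw [kineticOp, matOp_apply, h, h]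
  exact (Fin.sum_univ_two (fun σ' => ∑ j : Fin 2, pauli j σ σ' • (-Complex.I •
    mulOp (fun ξ => (2 * Real.pi * Complex.I) * (ξ j : ℂ) * jw ξ) (y i σ')))).symm

/-- The scaled Bistritzer-MacDonald Hamiltonian in momentum space. -/
theorem bmHamiltonian_eq (lam₀ : ℝ) (d : Plane) (θ γ : ℝ) (y : Envelope) (i σ : Fin 2) :
    bmHamiltonian lam₀ d θ γ (envFourierInv (scaleOp y)) i σ =
      ((envFourierInv (generator (bmCoeff lam₀ d θ) (bmShift θ γ) 1 y) i σ : L2) :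
        𝓢'(Plane, ℂ)) := by
  have e1 : envFourierInv (generator (bmCoeff lam₀ d θ) (bmShift θ γ) 1 y) i σ =
      𝓕⁻ (kineticOp y i σ) +
        𝓕⁻ (couplingOp (bmCoeff lam₀ d θ) (bmShift θ γ) 0 (scaleOp y) i σ) := by
    rw [generator_apply, scaleOp_couplingOp, envFourierInv_apply, ← fourierInv_add']
    rfl
  have e2 : ∀ u : Fin 2 → L2, (𝓕⁻ (∑ σ', u σ') : L2) = ∑ σ', 𝓕⁻ (u σ') := fun u =>
    map_sum (Lp.fourierTransformₗᵢ Plane ℂ).symm u Finset.univ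
  rw [e1, coe_add, bmHamiltonian]
  congr 1
  · rw [kineticOp_apply, e2, coe_sum]
    refine Finset.sum_congr rfl fun σ' _ => ?_
    rw [e2, coe_sum]
    refine Finset.sum_congr rfl fun j _ => ?_
    rw [fourierInv_smul', fourierInv_smul', coe_const_smul, coe_const_smul, ← lineDeriv_fourierInv]
    rfl
  · rw [couplingOp_apply, e2, coe_sum]
    refine Finset.sum_congr rfl fun σ' _ => ?_
    rw [envFourierInv_apply, smulLeftCLM_scaledMoireBlock]

/-! ### Sobolev spaces in momentum space -/

theorem jw_pow_eq (s : ℕ) (ξ : Plane) :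
    (((1 + ‖ξ‖ ^ 2) ^ (-(s : ℝ) / 2) : ℝ) : ℂ) = jw ξ ^ s := by
  rw [jw, ← Complex.ofReal_pow]
  congr 1
  have ha : 0 ≤ 1 + ‖ξ‖ ^ 2 := by positivity
  rw [jap]
  generalize 1 + ‖ξ‖ ^ 2 = a at ha ⊢
  rw [neg_div, Real.rpow_neg (by positivity), inv_pow, Real.sqrt_eq_rpow, ← Real.rpow_natCast,
    ← Real.rpow_mul (by positivity)]
  congr 2
  ring

/-- The Bessel potential is first moved to the other side, because the one of negative order has the
bounded symbol `jw ^ s` and keeps v in L². -/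
theorem bessel_eq_iff (s : ℕ) (u v : L2) :
    besselPotential Plane ℂ s (u : 𝓢'(Plane, ℂ)) = (v : 𝓢'(Plane, ℂ)) ↔
      𝓕 u = mulOp (fun ξ => jw ξ ^ s) (𝓕 v) := by
  rw [← besselPotential_neg_apply_eq_iff]
  have h : 𝓕 (besselPotential Plane ℂ (-(s : ℝ)) (v : 𝓢'(Plane, ℂ))) =
      ((mulOp (fun ξ => jw ξ ^ s) (𝓕 v) : L2) : 𝓢'(Plane, ℂ)) := by
    rw [fourier_besselPotential_eq_smulLeftCLM_fourier_apply, Lp.fourier_toTemperedDistribution_eq]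
    refine smulLeftCLM_coe (by fun_prop) ?_
    filter_upwards [coeFn_mulOp (isMultiplier_jw_pow s) (𝓕 v)] with ξ hξ
    rw [hξ, jw_pow_eq]
  constructor
  · intro hu
    rw [hu, Lp.fourier_toTemperedDistribution_eq] at h
    exact toTemperedDistribution_injective h
  · intro hu
    rw [← hu, ← Lp.fourier_toTemperedDistribution_eq] at h
    have := congrArg FourierTransformInv.fourierInv h
    rwa [FourierTransform.fourierInv_fourier_eq, FourierTransform.fourierInv_fourier_eq] at this

theorem scaleOp_pow_apply (s : ℕ) (v : Envelope) (i σ : Fin 2) :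
    (scaleOp ^ s) v i σ = mulOp (fun ξ => jw ξ ^ s) (v i σ) := by
  induction s generalizing v with
  | zero => simp [mulOp_const]
  | succ s ih =>
    rw [pow_succ']
    change scaleOp ((scaleOp ^ s) v) i σ = _
    rw [scaleOp_apply, ih,
      mulOp_mulOp isMultiplier_jw (isMultiplier_jw_pow s)]
    simp_rw [pow_succ']

/-- The infimum in `eSobolevNorm` runs over at most one function, as L² embeds injectively in the
tempered distributions; Plancherel carries its norm to momentum space. -/
theorem exists_of_eSobolevNorm_le {s : ℕ} {f : Envelope} {M : ℝ} (hM : 0 ≤ M)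
    (h : ∀ i σ, eSobolevNorm s (f i σ : 𝓢'(Plane, ℂ)) ≤ ENNReal.ofReal M) :
    ∃ v : Envelope, ‖v‖ ≤ M ∧ envFourier f = (scaleOp ^ s) v := by
  have h1 : ∀ i σ, ∃ v : L2, ‖v‖ ≤ M ∧ 𝓕 (f i σ) = mulOp (fun ξ => jw ξ ^ s) v := by
    intro i σ
    have hlt := (h i σ).trans_lt ENNReal.ofReal_lt_top
    obtain ⟨v, hv⟩ := (eSobolevNorm_lt_top_iff _ _).1 hlt
    refine ⟨𝓕 v, ?_, (bessel_eq_iff s _ _).1 hv⟩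
    rw [Lp.norm_fourier_eq]
    have hle : ‖v‖ₑ ≤ ENNReal.ofReal M := by
      refine le_trans ?_ (h i σ)
      refine le_iInf fun w => le_iInf fun hw => ?_
      rw [hv] at hw
      rw [toTemperedDistribution_injective hw]
    rwa [← ofReal_norm, ENNReal.ofReal_le_ofReal_iff hM] at hle
  choose v hv hv' using h1
  refine ⟨v, norm_envelope_le hM hv, ?_⟩
  funext i σ
  rw [envFourier_apply, hv', scaleOp_pow_apply]

theorem memSobolev_envFourierInv (s : ℕ) (v : Envelope) (i σ : Fin 2) :
    MemSobolev s 2 (envFourierInv ((scaleOp ^ s) v) i σ : 𝓢'(Plane, ℂ)) := by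
  refine ⟨𝓕⁻ (v i σ), (bessel_eq_iff s _ _).2 ?_⟩
  rw [envFourierInv_apply, scaleOp_pow_apply, FourierTransform.fourier_fourierInv_eq,
    FourierTransform.fourier_fourierInv_eq]

/-! ### Evaluation at points -/

/-- The value at `X` of the function with Fourier transform `(1 + |ξ|²)⁻¹ y`. -/
def pointEval (X : Plane) (y : L2) : ℂ :=
  ∫ ξ : Plane, Complex.exp (2 * Real.pi * Complex.I * (inner ℝ ξ X : ℝ)) * (jw ξ ^ 2 * y ξ)

/-- The square is (1 + |ξ|²)⁻², integrable because 4 exceeds the dimension 2. This is what embeds H²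
in the continuous functions. -/
theorem memLp_jw_sq : MemLp (fun ξ => jw ξ ^ 2) 2 (volume : Measure Plane) := by
  have h := (isMultiplier_jw_pow 2).meas.aestronglyMeasurable (μ := volume)
  rw [← memLp_norm_iff h, memLp_two_iff_integrable_sq h.norm]
  have h4 : (Module.finrank ℝ Plane : ℝ) < 4 := by
    rw [finrank_euclideanSpace_fin]; norm_num
  refine (integrable_rpow_neg_one_add_norm_sq (μ := volume) h4).congr
    (Eventually.of_forall fun ξ => ?_)
  have : ((1 + ‖ξ‖ ^ 2) ^ (-4 / 2 : ℝ) : ℝ) = (jap ξ ^ 2 * jap ξ ^ 2)⁻¹ := by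
    rw [jap_sq, show (-4 / 2 : ℝ) = -(2 : ℕ) by norm_num, Real.rpow_neg (by positivity),
      Real.rpow_natCast]
    ring
  change ((1 + ‖ξ‖ ^ 2) ^ (-4 / 2 : ℝ) : ℝ) = ‖jw ξ ^ 2‖ ^ 2
  rw [norm_pow, norm_jw, this]
  ring

theorem integrable_jw_sq_mul (y : L2) : Integrable (fun ξ => jw ξ ^ 2 * y ξ) :=
  memLp_jw_sq.integrable_mul (Lp.memLp y)

theorem pointEval_eq (X : Plane) (y : L2) :
    pointEval X y = 𝓕⁻ (fun ξ => jw ξ ^ 2 * y ξ) X := by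
  rw [Real.fourierInv_eq', pointEval]
  congr 1
  funext ξ
  rw [smul_eq_mul]
  congr 2
  push_cast
  ring

theorem continuous_pointEval (y : L2) : Continuous fun X => pointEval X y := by
  refine continuous_of_dominated (bound := fun ξ => ‖jw ξ ^ 2 * y ξ‖) (fun X => ?_) (fun X => ?_)
    (integrable_jw_sq_mul y).norm ?_
  · exact (Continuous.aestronglyMeasurable (by fun_prop)).mul
      (integrable_jw_sq_mul y).aestronglyMeasurable
  · refine Eventually.of_forall fun ξ => ?_
    rw [norm_mul, show (2 * Real.pi * Complex.I * (inner ℝ ξ X : ℝ) : ℂ) =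
      ((2 * Real.pi * inner ℝ ξ X : ℝ) : ℂ) * Complex.I by push_cast; ring,
      Complex.norm_exp_ofReal_mul_I, one_mul]
  · exact Eventually.of_forall fun ξ => by fun_prop

/-- Both sides are tested against smooth compactly supported functions. On the left the
integrability of jw² y allows the transform to be moved onto the test function; on the right this is
the definition of the distributional transform. -/
theorem pointEval_ae_eq (y : L2) :
    (fun X => pointEval X y) =ᵐ[volume] (𝓕⁻ (mulOp (fun ξ => jw ξ ^ 2) y) : L2) := by
  refine ae_eq_of_integral_contDiff_smul_eq (continuous_pointEval y).locallyIntegrable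
    ((Lp.memLp _).locallyIntegrable (by norm_num)) fun g hg hc => ?_
  have hg1 : HasCompactSupport (Complex.ofRealCLM ∘ g) := hc.comp_left rfl
  have hg2 : ContDiff ℝ ((⊤ : ℕ∞) : WithTop ℕ∞) (Complex.ofRealCLM ∘ g) :=
    Complex.ofRealCLM.contDiff.comp hg
  let φ : 𝓢(Plane, ℂ) := hg1.toSchwartzMap hg2
  have h1 : (((𝓕⁻ (mulOp (fun ξ => jw ξ ^ 2) y) : L2) : 𝓢'(Plane, ℂ))) φ =
      ∫ X, g X • (𝓕⁻ (mulOp (fun ξ => jw ξ ^ 2) y) : L2) X := by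
    rw [Lp.toTemperedDistribution_apply]
    rfl
  rw [← h1, ← Lp.fourierInv_toTemperedDistribution_eq, TemperedDistribution.fourierInv_apply,
    Lp.toTemperedDistribution_apply]
  have h2 := VectorFourier.integral_fourierIntegral_smul_eq_flip (L := -innerₗ Plane)
    (μ := volume) (ν := volume) (f := fun ξ => jw ξ ^ 2 * y ξ) (g := φ)
    Real.continuous_fourierChar (by
      simp only [LinearMap.neg_apply, innerₗ_apply_apply]
      fun_prop) (integrable_jw_sq_mul y) φ.integrable
  have h3 : ∀ f : Plane → ℂ, VectorFourier.fourierIntegral Real.fourierChar volume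
      (-innerₗ Plane) f = 𝓕⁻ f := fun f => rfl
  have h4 : (-innerₗ Plane).flip = -innerₗ Plane := by
    ext u v; simp [real_inner_comm]
  rw [h4, h3, h3] at h2
  calc ∫ X, g X • pointEval X y
      = ∫ X, 𝓕⁻ (fun ξ => jw ξ ^ 2 * y ξ) X • φ X := by
        congr 1; funext X
        rw [pointEval_eq, smul_eq_mul, mul_comm]
        rfl
    _ = ∫ ξ, (jw ξ ^ 2 * y ξ) • 𝓕⁻ (φ : Plane → ℂ) ξ := h2
    _ = _ := by
        apply integral_congr_ae
        filter_upwards [coeFn_mulOp (isMultiplier_jw_pow 2) y] with ξ hξ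
        rw [hξ, SchwartzMap.fourierInv_coe, smul_eq_mul, smul_eq_mul, mul_comm]

theorem hasContRep_fourierInv (y : L2) : HasContRep (𝓕⁻ (mulOp (fun ξ => jw ξ ^ 2) y)) :=
  ⟨_, continuous_pointEval y, pointEval_ae_eq y⟩

theorem contRep_fourierInv (y : L2) (X : Plane) :
    contRep (𝓕⁻ (mulOp (fun ξ => jw ξ ^ 2) y)) X = pointEval X y := by
  rw [contRep_eq (continuous_pointEval y) (pointEval_ae_eq y)]

/-! ### Fourier series on the unit square -/

/-- The unit square `(0, 1]²`. -/
def unitSquare : Set (Fin 2 → ℝ) := {x | ∀ i, x i ∈ Ioc (0 : ℝ) (0 + 1)}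

/-- The character `e^{2πi n·t}`. -/
def latticeChar (n : Fin 2 → ℤ) (t : Fin 2 → ℝ) : ℂ :=
  Complex.exp (2 * Real.pi * Complex.I * (n 0 * t 0 + n 1 * t 1 : ℝ))

theorem measurableSet_unitSquare : MeasurableSet unitSquare :=
  MeasurableSet.univ_pi' fun _ => measurableSet_Ioc

theorem norm_latticeChar (n : Fin 2 → ℤ) (t : Fin 2 → ℝ) : ‖latticeChar n t‖ = 1 := by
  rw [latticeChar, show (2 * Real.pi * Complex.I * (n 0 * t 0 + n 1 * t 1 : ℝ) : ℂ) =
    ((2 * Real.pi * (n 0 * t 0 + n 1 * t 1) : ℝ) : ℂ) * Complex.I by push_cast; ring,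
    Complex.norm_exp_ofReal_mul_I]

theorem continuous_latticeChar (n : Fin 2 → ℤ) : Continuous (latticeChar n) := by
  unfold latticeChar; fun_prop

theorem latticeChar_add (n k : Fin 2 → ℤ) (t : Fin 2 → ℝ) :
    latticeChar n (t + fun i => (k i : ℝ)) = latticeChar n t := by
  rw [latticeChar, latticeChar, Complex.exp_eq_exp_iff_exists_int]
  refine ⟨n 0 * k 0 + n 1 * k 1, ?_⟩
  simp only [Pi.add_apply]
  push_cast
  ring

theorem mFourier_coe (n : Fin 2 → ℤ) (t : Fin 2 → ℝ) :
    UnitAddTorus.mFourier n (fun i => (t i : UnitAddCircle)) = latticeChar n t := by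
  simp only [UnitAddTorus.mFourier, ContinuousMap.coe_mk, fourier_coe_apply, Fin.prod_univ_two,
    ← Complex.exp_add, latticeChar]
  congr 1
  push_cast
  ring

section Torus

/-- The Haar probability measure on the circle. -/
local instance circleMeasureSpace : MeasureSpace UnitAddCircle := ⟨AddCircle.haarAddCircle⟩

/-- The function on the torus given by the values of `F` on the unit square. -/
def toTorus (F : (Fin 2 → ℝ) → ℂ) (x : UnitAddTorus (Fin 2)) : ℂ :=
  F (UnitAddTorus.measurableEquivPiIoc (fun _ : Fin 2 => (0 : ℝ)) x).1

theorem toTorus_coe (F : (Fin 2 → ℝ) → ℂ) {t : Fin 2 → ℝ} (ht : t ∈ unitSquare) :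
    toTorus F (fun i => (t i : UnitAddCircle)) = F t := by
  have h := (UnitAddTorus.measurableEquivPiIoc (fun _ : Fin 2 => (0 : ℝ))).apply_symm_apply ⟨t, ht⟩
  rw [UnitAddTorus.coe_symm_measurableEquivPiIoc_apply] at h
  rw [toTorus, h]

theorem memLp_toTorus {F : (Fin 2 → ℝ) → ℂ} (hF : MemLp F 2 (volume.restrict unitSquare)) :
    MemLp (toTorus F) 2 (volume : Measure (UnitAddTorus (Fin 2))) :=
  (hF.comp_measurePreserving (measurePreserving_subtype_coe measurableSet_unitSquare)).comp_measurePreserving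
    (UnitAddTorus.measurePreserving_equivPiIoc fun _ : Fin 2 => (0 : ℝ))

theorem mFourierCoeff_toTorus {F : (Fin 2 → ℝ) → ℂ} (hF : MemLp F 2 (volume.restrict unitSquare))
    (n : Fin 2 → ℤ) : UnitAddTorus.mFourierCoeff ((memLp_toTorus hF).toLp) n =
      ∫ t in unitSquare, latticeChar (-n) t * F t := by
  have h : UnitAddTorus.mFourierCoeff ((memLp_toTorus hF).toLp) n =
      UnitAddTorus.mFourierCoeff (toTorus F) n := by
    apply integral_congr_ae
    filter_upwards [MemLp.coeFn_toLp (memLp_toTorus hF)] with x hx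
    rw [hx]
  rw [h, UnitAddTorus.mFourierCoeff_eq_integral _ n fun _ => 0]
  refine setIntegral_congr_fun measurableSet_unitSquare fun t ht => ?_
  simp only [smul_eq_mul]
  rw [toTorus_coe F ht, mFourier_coe]

/-- **Parseval's identity** on the unit square. -/
theorem hasSum_parseval {F G : (Fin 2 → ℝ) → ℂ} (hF : MemLp F 2 (volume.restrict unitSquare))
    (hG : MemLp G 2 (volume.restrict unitSquare)) :
    HasSum (fun n : Fin 2 → ℤ => (starRingEnd ℂ) (∫ t in unitSquare, latticeChar n t * F t) *
      ∫ t in unitSquare, latticeChar n t * G t) (∫ t in unitSquare, (starRingEnd ℂ) (F t) * G t) := by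
  have h := UnitAddTorus.hasSum_prod_mFourierCoeff ((memLp_toTorus hF).toLp)
    ((memLp_toTorus hG).toLp)
  have e : ∫ x, (starRingEnd ℂ) ((memLp_toTorus hF).toLp _ x) * (memLp_toTorus hG).toLp _ x =
      ∫ t in unitSquare, (starRingEnd ℂ) (F t) * G t := by
    have e1 : ∫ x, (starRingEnd ℂ) ((memLp_toTorus hF).toLp _ x) * (memLp_toTorus hG).toLp _ x =
        ∫ x, (starRingEnd ℂ) (toTorus F x) * toTorus G x := by
      apply integral_congr_ae
      filter_upwards [MemLp.coeFn_toLp (memLp_toTorus hF), MemLp.coeFn_toLp (memLp_toTorus hG)]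
        with x h1 h2
      rw [h1, h2]
    rw [e1, UnitAddTorus.integral_preimage _ fun _ => 0]
    refine setIntegral_congr_fun measurableSet_unitSquare fun t ht => ?_
    rw [toTorus_coe F ht, toTorus_coe G ht]
  rw [e] at h
  -- Fourier coefficients pair with the conjugate character, so the index −n gives the integral
  -- against `latticeChar n`.
  refine ((Equiv.neg (Fin 2 → ℤ)).hasSum_iff.2 h).congr_fun fun n => ?_
  rw [Function.comp_apply, Equiv.neg_apply, mFourierCoeff_toTorus hF, mFourierCoeff_toTorus hG,
    neg_neg]

end Torus

/-! ### Periodization -/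

/-- The integer vector `k`, as a real vector. -/
def intVec (k : Fin 2 → ℤ) : Fin 2 → ℝ := fun i => k i

theorem latticeChar_intVec (n k : Fin 2 → ℤ) (t : Fin 2 → ℝ) :
    latticeChar n (t + intVec k) = latticeChar n t := latticeChar_add n k t

/-- The translates of the unit square. -/
def squareAt (k : Fin 2 → ℤ) : Set (Fin 2 → ℝ) := (fun t => t + intVec (-k)) ⁻¹' unitSquare

theorem measurableSet_squareAt (k : Fin 2 → ℤ) : MeasurableSet (squareAt k) :=
  (measurable_add_const _) measurableSet_unitSquare

theorem iUnion_squareAt : ⋃ k, squareAt k = univ := by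
  refine eq_univ_of_forall fun t => mem_iUnion.2 ⟨fun i => ⌈t i⌉ - 1, fun i => ?_⟩
  have h1 := Int.ceil_lt_add_one (t i)
  have h2 := Int.le_ceil (t i)
  simp only [intVec, Pi.add_apply, Pi.neg_apply]
  push_cast
  constructor <;> linarith

theorem pairwise_disjoint_squareAt : Pairwise (Function.onFun Disjoint squareAt) := by
  intro k l hkl
  refine Set.disjoint_left.2 fun t hk hl => hkl (funext fun i => ?_)
  have h1 := hk i
  have h2 := hl i
  simp only [intVec, Pi.add_apply, Pi.neg_apply, Int.cast_neg, zero_add, mem_Ioc] at h1 h2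
  have h3 : (k i : ℝ) < l i + 1 := by linarith
  have h4 : (l i : ℝ) < k i + 1 := by linarith
  have h5 : k i < l i + 1 := by exact_mod_cast h3
  have h6 : l i < k i + 1 := by exact_mod_cast h4
  omega

theorem add_intVec_mem_squareAt (k : Fin 2 → ℤ) (t : Fin 2 → ℝ) :
    t + intVec k ∈ squareAt k ↔ t ∈ unitSquare := by
  have h : t + intVec k + intVec (-k) = t := by
    funext i; simp [intVec]
  rw [squareAt, mem_preimage, h]

theorem measurePreserving_squareAt (k : Fin 2 → ℤ) :
    MeasurePreserving (fun t => t + intVec k) (volume.restrict unitSquare)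
      (volume.restrict (squareAt k)) := by
  have h := (measurePreserving_add_right (volume : Measure (Fin 2 → ℝ)) (intVec k)).restrict_preimage
    (measurableSet_squareAt k)
  have e : (fun t => t + intVec k) ⁻¹' squareAt k = unitSquare :=
    Set.ext fun t => add_intVec_mem_squareAt k t
  rwa [e] at h

theorem aemeasurable_comp_intVec {f : (Fin 2 → ℝ) → ℝ≥0∞} (hf : AEMeasurable f) (k : Fin 2 → ℤ) :
    AEMeasurable (fun t => f (t + intVec k)) :=
  hf.comp_quasiMeasurePreserving (measurePreserving_add_right volume _).quasiMeasurePreserving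

theorem lintegral_unfold {f : (Fin 2 → ℝ) → ℝ≥0∞} (hf : AEMeasurable f) :
    ∫⁻ t, f t = ∫⁻ t in unitSquare, ∑' k, f (t + intVec k) := by
  rw [lintegral_tsum fun k => (aemeasurable_comp_intVec hf k).restrict, ← setLIntegral_univ,
    ← iUnion_squareAt, lintegral_iUnion measurableSet_squareAt pairwise_disjoint_squareAt]
  refine tsum_congr fun k => ?_
  exact ((measurePreserving_squareAt k).lintegral_comp_emb
    (MeasurableEquiv.addRight (intVec k)).measurableEmbedding f).symm

theorem integral_unfold {f : (Fin 2 → ℝ) → ℂ} (hf : Integrable f) :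
    ∫ t, f t = ∫ t in unitSquare, ∑' k, f (t + intVec k) := by
  have hm : ∀ k, Integrable (fun t => f (t + intVec k)) := fun k => hf.comp_add_right _
  have hfin : ∑' k : Fin 2 → ℤ, ∫⁻ t in unitSquare, ‖f (t + intVec k)‖ₑ ≠ ∞ := by
    rw [← lintegral_tsum fun k => (hm k).aestronglyMeasurable.enorm.restrict,
      ← lintegral_unfold hf.aestronglyMeasurable.enorm]
    exact hf.2.ne
  rw [integral_tsum (fun k => (hm k).aestronglyMeasurable.restrict) hfin, ← setIntegral_univ,
    ← iUnion_squareAt, integral_iUnion measurableSet_squareAt pairwise_disjoint_squareAt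
      hf.integrableOn]
  refine tsum_congr fun k => ?_
  exact ((measurePreserving_squareAt k).integral_comp
    (MeasurableEquiv.addRight (intVec k)).measurableEmbedding f).symm

/-- Hölder's inequality with exponents 2 and 2 for the counting measure. -/
theorem ENNReal.sq_tsum_mul_le {ι : Type*} [Countable ι] (a b : ι → ℝ≥0∞) :
    (∑' i, a i * b i) ^ 2 ≤ (∑' i, a i ^ 2) * ∑' i, b i ^ 2 := by
  let _ : MeasurableSpace ι := ⊤
  have h := ENNReal.lintegral_mul_le_Lp_mul_Lq (Measure.count : Measure ι)
    Real.HolderConjugate.two_two (f := a) (g := b)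
    (measurable_of_countable _).aemeasurable (measurable_of_countable _).aemeasurable
  simp only [lintegral_count, Pi.mul_apply] at h
  calc (∑' i, a i * b i) ^ 2 ≤ ((∑' i, a i ^ (2 : ℝ)) ^ (1 / 2 : ℝ) *
        (∑' i, b i ^ (2 : ℝ)) ^ (1 / 2 : ℝ)) ^ 2 := by gcongr
    _ = _ := by
      rw [mul_pow, ← ENNReal.rpow_natCast, ← ENNReal.rpow_natCast, ← ENNReal.rpow_mul,
        ← ENNReal.rpow_mul]
      simp [ENNReal.rpow_ofNat]

/-- A weight whose square has bounded sums over the integer lattice. -/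
structure IsSquareWeight (w : (Fin 2 → ℝ) → ℂ) (C : ℝ) : Prop where
  nonneg : 0 ≤ C
  meas : Measurable w
  le : ∀ t, ∑' k, ‖w (t + intVec k)‖ₑ ^ 2 ≤ ENNReal.ofReal C

/-- The sum of `u` over a coset of the integer lattice. -/
def periodize (u : (Fin 2 → ℝ) → ℂ) (t : Fin 2 → ℝ) : ℂ := ∑' k, u (t + intVec k)

/-- The sum of `|u|` over a coset of the integer lattice. -/
def absPeriodize (u : (Fin 2 → ℝ) → ℂ) (t : Fin 2 → ℝ) : ℝ≥0∞ := ∑' k, ‖u (t + intVec k)‖ₑ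

theorem periodize_add (u : (Fin 2 → ℝ) → ℂ) (t : Fin 2 → ℝ) (k : Fin 2 → ℤ) :
    periodize u (t + intVec k) = periodize u t := by
  unfold periodize
  rw [← (Equiv.addLeft k).tsum_eq fun l => u (t + intVec l)]
  refine tsum_congr fun l => ?_
  congr 1
  funext i
  simp [intVec, add_assoc]

theorem absPeriodize_add (u : (Fin 2 → ℝ) → ℂ) (t : Fin 2 → ℝ) (k : Fin 2 → ℤ) :
    absPeriodize u (t + intVec k) = absPeriodize u t := by
  unfold absPeriodize
  rw [← (Equiv.addLeft k).tsum_eq fun l => ‖u (t + intVec l)‖ₑ]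
  refine tsum_congr fun l => ?_
  congr 2
  funext i
  simp [intVec, add_assoc]

theorem enorm_periodize_le (u : (Fin 2 → ℝ) → ℂ) (t : Fin 2 → ℝ) :
    ‖periodize u t‖ₑ ≤ absPeriodize u t := enorm_tsum_le_tsum_enorm

namespace IsSquareWeight

variable {w : (Fin 2 → ℝ) → ℂ} {C : ℝ} (hw : IsSquareWeight w C)
variable {y y' : (Fin 2 → ℝ) → ℂ} (hy : MemLp y 2) (hy' : MemLp y' 2)
include hw

/-- Cauchy–Schwarz over a coset. An L² function alone need not have a convergent periodization; the
square-summable weight supplies it. -/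
theorem sq_absPeriodize_le (y : (Fin 2 → ℝ) → ℂ) (t : Fin 2 → ℝ) :
    absPeriodize (fun t => w t * y t) t ^ 2 ≤
      ENNReal.ofReal C * ∑' k, ‖y (t + intVec k)‖ₑ ^ 2 := by
  unfold absPeriodize
  simp_rw [enorm_mul]
  exact (ENNReal.sq_tsum_mul_le _ _).trans (mul_le_mul_left (hw.le t) _)

include hy

theorem lintegral_sq_absPeriodize_le :
    ∫⁻ t in unitSquare, absPeriodize (fun t => w t * y t) t ^ 2 ≤
      ENNReal.ofReal C * ∫⁻ t, ‖y t‖ₑ ^ 2 := by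
  rw [lintegral_unfold (hy.aestronglyMeasurable.enorm.pow_const 2),
    ← lintegral_const_mul' _ _ ENNReal.ofReal_ne_top]
  exact lintegral_mono fun t => hw.sq_absPeriodize_le y t

omit hw in
theorem lintegral_sq_lt_top : ∫⁻ t, ‖y t‖ₑ ^ 2 < ∞ := by
  have := hy.2
  rw [eLpNorm_lt_top_iff_lintegral_rpow_enorm_lt_top (by norm_num) (by norm_num)] at this
  simpa using this

theorem ae_absPeriodize_lt_top :
    ∀ᵐ t ∂volume.restrict unitSquare, absPeriodize (fun t => w t * y t) t < ∞ := by
  have hm : AEMeasurable (fun t => absPeriodize (fun t => w t * y t) t ^ 2)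
      (volume.restrict unitSquare) := by
    refine (AEMeasurable.tsum fun k => ?_).pow_const 2
    exact (aemeasurable_comp_intVec
      (hw.meas.aestronglyMeasurable.mul hy.aestronglyMeasurable).enorm k).restrict
  filter_upwards [ae_lt_top' hm ((hw.lintegral_sq_absPeriodize_le hy).trans_lt
    (ENNReal.mul_lt_top ENNReal.ofReal_lt_top (lintegral_sq_lt_top hy))).ne] with t ht
  by_contra h
  rw [not_lt_top_iff.1 h] at ht
  simp at ht

theorem aestronglyMeasurable_periodize :
    AEStronglyMeasurable (periodize fun t => w t * y t) (volume.restrict unitSquare) := by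
  refine aestronglyMeasurable_of_tendsto_ae (atTop : Filter (Finset (Fin 2 → ℤ)))
    (f := fun s t => ∑ k ∈ s, w (t + intVec k) * y (t + intVec k)) (fun s => ?_) ?_
  · refine Finset.aestronglyMeasurable_fun_sum s fun k _ => ?_
    exact (AEStronglyMeasurable.comp_quasiMeasurePreserving
      (hw.meas.aestronglyMeasurable.mul hy.aestronglyMeasurable)
      (measurePreserving_add_right volume (intVec k)).quasiMeasurePreserving).restrict
  · filter_upwards [hw.ae_absPeriodize_lt_top hy] with t ht
    have : Summable fun k => w (t + intVec k) * y (t + intVec k) := by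
      refine Summable.of_enorm (by simpa [absPeriodize] using ht.ne)
    exact this.hasSum

theorem memLp_periodize :
    MemLp (periodize fun t => w t * y t) 2 (volume.restrict unitSquare) := by
  refine ⟨hw.aestronglyMeasurable_periodize hy, ?_⟩
  rw [eLpNorm_lt_top_iff_lintegral_rpow_enorm_lt_top (by norm_num) (by norm_num)]
  refine lt_of_le_of_lt ?_ (ENNReal.mul_lt_top (ENNReal.ofReal_lt_top (r := C))
    (lintegral_sq_lt_top hy))
  refine le_trans (lintegral_mono fun t => ?_) (hw.lintegral_sq_absPeriodize_le hy)
  simp only [ENNReal.toReal_ofNat, ENNReal.rpow_ofNat]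
  gcongr
  exact enorm_periodize_le _ t

omit hy in
theorem memLp : MemLp w 2 := by
  refine ⟨hw.meas.aestronglyMeasurable, ?_⟩
  rw [eLpNorm_lt_top_iff_lintegral_rpow_enorm_lt_top (by norm_num) (by norm_num)]
  simp only [ENNReal.toReal_ofNat, ENNReal.rpow_ofNat]
  rw [lintegral_unfold (hw.meas.enorm.pow_const 2).aemeasurable]
  refine (lintegral_mono fun t => hw.le t).trans_lt ?_
  rw [lintegral_const]
  refine ENNReal.mul_lt_top ENNReal.ofReal_lt_top ?_
  rw [Measure.restrict_apply_univ]
  have : unitSquare = Set.pi univ fun _ : Fin 2 => Ioc (0 : ℝ) (0 + 1) := by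
    ext; simp [unitSquare]
  rw [this, Real.volume_pi_Ioc]
  simp

theorem integrable : Integrable fun t => w t * y t := hw.memLp.integrable_mul hy

/-- Unfolding: the character is invariant under integer translations, so the integral over the plane
folds onto the square. -/
theorem coeff_periodize (n : Fin 2 → ℤ) :
    ∫ t in unitSquare, latticeChar n t * periodize (fun t => w t * y t) t =
      ∫ t, latticeChar n t * (w t * y t) := by
  have hi : Integrable fun t => latticeChar n t * (w t * y t) :=
    (hw.integrable hy).bdd_mul (c := 1) (continuous_latticeChar n).aestronglyMeasurable
      (Eventually.of_forall fun t => (norm_latticeChar n t).le)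
  rw [integral_unfold hi]
  simp only [latticeChar_intVec, tsum_mul_left]
  rfl

/-- Parseval for the periodization, whose Fourier coefficients are the samples. This is the
boundedness of sampling on a lattice. -/
theorem hasSum_sq_coeff :
    ∃ S, HasSum (fun n => ‖∫ t, latticeChar n t * (w t * y t)‖ ^ 2) S ∧ S ≤ C * ∫ t, ‖y t‖ ^ 2 := by
  have hm := hw.memLp_periodize hy
  have h := hasSum_parseval hm hm
  simp only [hw.coeff_periodize hy, ← Complex.normSq_eq_conj_mul_self] at h
  have h2 : ∫ t in unitSquare, ((Complex.normSq (periodize (fun t => w t * y t) t) : ℝ) : ℂ) =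
      ((∫ t in unitSquare, ‖periodize (fun t => w t * y t) t‖ ^ 2 : ℝ) : ℂ) := by
    simp_rw [Complex.normSq_eq_norm_sq]
    exact integral_ofReal
  rw [h2] at h
  have h3 := Complex.hasSum_ofReal.1 h
  simp only [Complex.normSq_eq_norm_sq] at h3
  refine ⟨_, h3, ?_⟩
  have e : ∀ (μ : Measure (Fin 2 → ℝ)) (f : (Fin 2 → ℝ) → ℂ), AEStronglyMeasurable f μ →
      ∫ t, ‖f t‖ ^ 2 ∂μ = (∫⁻ t, ‖f t‖ₑ ^ 2 ∂μ).toReal := by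
    intro μ f hf
    rw [integral_eq_lintegral_of_nonneg_ae (Eventually.of_forall fun t => sq_nonneg _)
      (hf.norm.fun_pow 2)]
    congr 2
    funext t
    rw [ENNReal.ofReal_pow (norm_nonneg _), ofReal_norm]
  rw [e _ _ hm.aestronglyMeasurable, e _ _ hy.aestronglyMeasurable,
    ← ENNReal.toReal_ofReal hw.nonneg, ← ENNReal.toReal_mul]
  refine ENNReal.toReal_mono (ENNReal.mul_lt_top ENNReal.ofReal_lt_top
    (lintegral_sq_lt_top hy)).ne ?_
  refine le_trans (lintegral_mono fun t => ?_) (hw.lintegral_sq_absPeriodize_le hy)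
  gcongr
  exact enorm_periodize_le _ t

include hy'

/-- Justifies exchanging sum and integral in Poisson summation: after unfolding, the integrand is a
product of two periodizations, each square integrable on the square. -/
theorem lintegral_mul_absPeriodize_lt_top :
    ∫⁻ t, ‖w t * y t‖ₑ * absPeriodize (fun t => w t * y' t) t < ∞ := by
  have hm : ∀ {y : (Fin 2 → ℝ) → ℂ}, MemLp y 2 → AEMeasurable fun t => ‖w t * y t‖ₑ := fun h =>
    (hw.meas.aestronglyMeasurable.mul h.aestronglyMeasurable).enorm
  have hP : AEMeasurable (absPeriodize fun t => w t * y' t) :=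
    AEMeasurable.tsum fun k => aemeasurable_comp_intVec (hm hy') k
  rw [lintegral_unfold ((hm hy).fun_mul hP)]
  simp only [absPeriodize_add, ENNReal.tsum_mul_right]
  have h1 : ∀ a b : ℝ≥0∞, a * b ≤ a ^ 2 + b ^ 2 := by
    intro a b
    rcases le_total a b with h | h
    · calc a * b ≤ b * b := by gcongr
        _ = b ^ 2 := (sq b).symm
        _ ≤ _ := le_add_self
    · calc a * b ≤ a * a := by gcongr
        _ = a ^ 2 := (sq a).symm
        _ ≤ _ := le_self_add
  refine (lintegral_mono fun t => h1 (absPeriodize (fun t => w t * y t) t) _).trans_lt ?_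
  rw [lintegral_add_left']
  · exact ENNReal.add_lt_top.2 ⟨(hw.lintegral_sq_absPeriodize_le hy).trans_lt
      (ENNReal.mul_lt_top ENNReal.ofReal_lt_top (lintegral_sq_lt_top hy)),
      (hw.lintegral_sq_absPeriodize_le hy').trans_lt
      (ENNReal.mul_lt_top ENNReal.ofReal_lt_top (lintegral_sq_lt_top hy'))⟩
  · exact ((AEMeasurable.tsum fun k => aemeasurable_comp_intVec (hm hy) k).pow_const
      2).restrict

/-- **Poisson summation**, in the form of an identity for inner products of samples. -/
theorem hasSum_poisson :
    HasSum (fun n => (starRingEnd ℂ) (∫ t, latticeChar n t * (w t * y t)) *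
      ∫ t, latticeChar n t * (w t * y' t))
      (∑' k, ∫ t, (starRingEnd ℂ) (w t * y t) * (w (t + intVec k) * y' (t + intVec k))) := by
  have h := hasSum_parseval (hw.memLp_periodize hy) (hw.memLp_periodize hy')
  simp only [hw.coeff_periodize hy, hw.coeff_periodize hy'] at h
  -- Parseval yields the integral over the square of the product of two periodizations; it remains
  -- to unfold the first of them.
  convert h using 1
  have hmeas : ∀ {y : (Fin 2 → ℝ) → ℂ}, MemLp y 2 → AEStronglyMeasurable fun t => w t * y t :=
    fun h => hw.meas.aestronglyMeasurable.mul h.aestronglyMeasurable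
  have hm : ∀ k, AEStronglyMeasurable fun t =>
      (starRingEnd ℂ) (w t * y t) * (w (t + intVec k) * y' (t + intVec k)) := fun k =>
    (Complex.continuous_conj.comp_aestronglyMeasurable (hmeas hy)).mul
      ((hmeas hy').comp_quasiMeasurePreserving
        (measurePreserving_add_right volume (intVec k)).quasiMeasurePreserving)
  have hfin : ∑' k, ∫⁻ t, ‖(starRingEnd ℂ) (w t * y t) *
      (w (t + intVec k) * y' (t + intVec k))‖ₑ ≠ ∞ := by
    rw [← lintegral_tsum fun k => (hm k).enorm]
    refine ne_of_lt (lt_of_eq_of_lt ?_ (hw.lintegral_mul_absPeriodize_lt_top hy hy'))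
    refine lintegral_congr fun t => ?_
    rw [absPeriodize, ← ENNReal.tsum_mul_left]
    refine tsum_congr fun k => ?_
    rw [enorm_mul]
    congr 1
    rw [← ofReal_norm, RCLike.norm_conj, ofReal_norm]
  have hint : Integrable fun t => (starRingEnd ℂ) (w t * y t) * periodize (fun t => w t * y' t) t := by
    refine ⟨?_, ?_⟩
    · refine aestronglyMeasurable_of_tendsto_ae (atTop : Filter (Finset (Fin 2 → ℤ)))
        (f := fun s t => ∑ k ∈ s, (starRingEnd ℂ) (w t * y t) *
          (w (t + intVec k) * y' (t + intVec k)))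
        (fun s => Finset.aestronglyMeasurable_fun_sum s fun k _ => hm k) ?_
      rw [← lintegral_tsum fun k => (hm k).enorm] at hfin
      filter_upwards [ae_lt_top' (AEMeasurable.tsum fun k => (hm k).enorm) hfin] with t ht
      have := (Summable.of_enorm ht.ne).hasSum
      rwa [tsum_mul_left] at this
    · refine (lintegral_mono fun t => ?_).trans_lt (hw.lintegral_mul_absPeriodize_lt_top hy hy')
      rw [enorm_mul]
      refine mul_le_mul' (le_of_eq ?_) (enorm_periodize_le _ t)
      rw [← ofReal_norm, RCLike.norm_conj, ofReal_norm]
  rw [← integral_tsum hm hfin]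
  simp only [tsum_mul_left]
  change ∫ t, (starRingEnd ℂ) (w t * y t) * periodize (fun t => w t * y' t) t = _
  rw [integral_unfold hint]
  refine setIntegral_congr_fun measurableSet_unitSquare fun t _ => ?_
  simp only [periodize_add, tsum_mul_right]
  congr 1
  exact (Complex.conjCLE.map_tsum).symm

end IsSquareWeight

/-! ### Rotations -/

theorem rot_apply_zero (ζ : ℝ) (v : Plane) : rot ζ v 0 = Real.cos ζ * v 0 - Real.sin ζ * v 1 := rfl

theorem rot_apply_one (ζ : ℝ) (v : Plane) : rot ζ v 1 = Real.sin ζ * v 0 + Real.cos ζ * v 1 := rfl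

theorem Plane.ext {u v : Plane} (h0 : u 0 = v 0) (h1 : u 1 = v 1) : u = v := by
  ext i
  fin_cases i
  · exact h0
  · exact h1

theorem inner_plane (u v : Plane) : inner ℝ u v = u 0 * v 0 + u 1 * v 1 := by
  rw [PiLp.inner_apply, Fin.sum_univ_two]
  simp only [RCLike.inner_apply, conj_trivial]
  ring

theorem norm_sq_plane (u : Plane) : ‖u‖ ^ 2 = u 0 ^ 2 + u 1 ^ 2 := by
  rw [← real_inner_self_eq_norm_sq, inner_plane]
  ring

theorem rot_add (ζ : ℝ) (u v : Plane) : rot ζ (u + v) = rot ζ u + rot ζ v := by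
  apply Plane.ext
  · simp only [rot_apply_zero, PiLp.add_apply]; ring
  · simp only [rot_apply_one, PiLp.add_apply]; ring

theorem rot_smul (ζ a : ℝ) (u : Plane) : rot ζ (a • u) = a • rot ζ u := by
  apply Plane.ext
  · simp only [rot_apply_zero, PiLp.smul_apply, smul_eq_mul]; ring
  · simp only [rot_apply_one, PiLp.smul_apply, smul_eq_mul]; ring

theorem rot_neg (ζ : ℝ) (u : Plane) : rot ζ (-u) = -rot ζ u := by
  simpa using rot_smul ζ (-1) u

theorem inner_rot (ζ : ℝ) (u v : Plane) : inner ℝ (rot ζ u) (rot ζ v) = inner ℝ u v := by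
  simp only [inner_plane, rot_apply_zero, rot_apply_one]
  linear_combination (u 0 * v 0 + u 1 * v 1) * Real.cos_sq_add_sin_sq ζ

theorem norm_rot (ζ : ℝ) (u : Plane) : ‖rot ζ u‖ = ‖u‖ := by
  have h : ‖rot ζ u‖ ^ 2 = ‖u‖ ^ 2 := by
    rw [← real_inner_self_eq_norm_sq, ← real_inner_self_eq_norm_sq, inner_rot]
  exact (pow_left_inj₀ (norm_nonneg _) (norm_nonneg _) two_ne_zero).1 h

/-! ### The reciprocal lattices -/

/-- The reciprocal lattice vector, divided by `2π`, with coordinates `t`. -/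
def recipPt (t : Fin 2 → ℝ) : Plane := !₂[t 0 - t 1, (t 0 + t 1) / Real.sqrt 3]

/-- The reciprocal lattice vector of layer `i`, divided by `2π`, with coordinates `t`. -/
def dualPt (θ : ℝ) (i : Fin 2) (t : Fin 2 → ℝ) : Plane := rot (layerAngle θ i) (recipPt t)

theorem recipPt_zero (t : Fin 2 → ℝ) : recipPt t 0 = t 0 - t 1 := rfl

theorem recipPt_one (t : Fin 2 → ℝ) : recipPt t 1 = (t 0 + t 1) / Real.sqrt 3 := rfl

theorem recipPt_add (s t : Fin 2 → ℝ) : recipPt (s + t) = recipPt s + recipPt t := by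
  apply Plane.ext
  · simp only [recipPt_zero, PiLp.add_apply, Pi.add_apply]; ring
  · simp only [recipPt_one, PiLp.add_apply, Pi.add_apply]; ring

theorem dualPt_add (θ : ℝ) (i : Fin 2) (s t : Fin 2 → ℝ) :
    dualPt θ i (s + t) = dualPt θ i s + dualPt θ i t := by
  rw [dualPt, recipPt_add, rot_add]; rfl

theorem norm_sq_recipPt (t : Fin 2 → ℝ) :
    ‖recipPt t‖ ^ 2 = 4 / 3 * (t 0 ^ 2 - t 0 * t 1 + t 1 ^ 2) := by
  rw [norm_sq_plane, recipPt_zero, recipPt_one, div_pow, Real.sq_sqrt (by norm_num)]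
  ring

theorem norm_dualPt (θ : ℝ) (i : Fin 2) (t : Fin 2 → ℝ) : ‖dualPt θ i t‖ = ‖recipPt t‖ :=
  norm_rot _ _

/-- The reciprocal basis divided by 2π is dual to the lattice basis, and the rotation preserves the
pairing. -/
theorem inner_dualPt (θ : ℝ) (i : Fin 2) (t : Fin 2 → ℝ) (a b : ℝ) :
    inner ℝ (dualPt θ i t) (a • layerLatticeVec θ i 0 + b • layerLatticeVec θ i 1) =
      a * t 0 + b * t 1 := by
  rw [layerLatticeVec, layerLatticeVec, ← rot_smul, ← rot_smul, ← rot_add, dualPt, inner_rot,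
    inner_plane, recipPt_zero, recipPt_one]
  simp only [latticeVec, PiLp.add_apply, PiLp.smul_apply, smul_eq_mul, Matrix.cons_val_zero,
    Matrix.cons_val_one]
  have h : Real.sqrt 3 ≠ 0 := by positivity
  field_simp
  ring

/-- The matrix of `dualPt`. -/
def dualMatrix (ζ : ℝ) : Matrix (Fin 2) (Fin 2) ℝ :=
  !![Real.cos ζ - Real.sin ζ / Real.sqrt 3, -Real.cos ζ - Real.sin ζ / Real.sqrt 3;
    Real.sin ζ + Real.cos ζ / Real.sqrt 3, -Real.sin ζ + Real.cos ζ / Real.sqrt 3]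

theorem det_dualMatrix (ζ : ℝ) : (dualMatrix ζ).det = 2 / Real.sqrt 3 := by
  rw [dualMatrix, Matrix.det_fin_two_of]
  have h : Real.sqrt 3 ≠ 0 := by positivity
  field_simp
  have h3 := Real.sq_sqrt (show (0 : ℝ) ≤ 3 by norm_num)
  linear_combination (2 * Real.sqrt 3) * Real.cos_sq_add_sin_sq ζ

theorem dualPt_eq (θ : ℝ) (i : Fin 2) : dualPt θ i =
    (WithLp.toLp 2 : (Fin 2 → ℝ) → Plane) ∘ Matrix.toLin' (dualMatrix (layerAngle θ i)) := by
  funext t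
  apply Plane.ext
  · simp [dualPt, rot_apply_zero, recipPt_zero, recipPt_one, dualMatrix,
      dotProduct, Fin.sum_univ_two]
    ring
  · simp [dualPt, rot_apply_one, recipPt_zero, recipPt_one, dualMatrix,
      dotProduct, Fin.sum_univ_two]
    ring

theorem measurableEmbedding_dualPt (θ : ℝ) (i : Fin 2) : MeasurableEmbedding (dualPt θ i) := by
  have hdet : (dualMatrix (layerAngle θ i)).det ≠ 0 := by rw [det_dualMatrix]; positivity
  have hinj : Function.Injective (Matrix.toLin' (dualMatrix (layerAngle θ i))) := by
    have : Invertible (dualMatrix (layerAngle θ i)) :=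
      Matrix.invertibleOfIsUnitDet _ hdet.isUnit
    exact Matrix.mulVec_injective_of_invertible _
  rw [dualPt_eq]
  refine (MeasurableEquiv.toLp 2 (Fin 2 → ℝ)).measurableEmbedding.comp ?_
  exact ((LinearMap.continuous_of_finiteDimensional _).measurableEmbedding hinj)

/-- The determinant 2/√3 is the area of the reciprocal cell in frequency units; its inverse √3/2 is
the area of the lattice cell. -/
theorem map_dualPt (θ : ℝ) (i : Fin 2) :
    Measure.map (dualPt θ i) volume = ENNReal.ofReal (Real.sqrt 3 / 2) • volume := by
  have hdet : (dualMatrix (layerAngle θ i)).det ≠ 0 := by rw [det_dualMatrix]; positivity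
  have hm : Measurable (WithLp.toLp 2 : (Fin 2 → ℝ) → Plane) :=
    (MeasurableEquiv.toLp 2 (Fin 2 → ℝ)).measurable
  rw [dualPt_eq, ← Measure.map_map hm
    (LinearMap.continuous_of_finiteDimensional _).measurable,
    Real.map_matrix_volume_pi_eq_smul_volume_pi hdet, Measure.map_smul,
    (PiLp.volume_preserving_toLp (Fin 2)).map_eq, det_dualMatrix, inv_div, abs_of_nonneg (by positivity)]

theorem integral_comp_dualPt {F : Type*} [NormedAddCommGroup F] [NormedSpace ℝ F] (θ : ℝ)
    (i : Fin 2) (f : Plane → F) :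
    ∫ t, f (dualPt θ i t) = (Real.sqrt 3 / 2) • ∫ ξ, f ξ := by
  rw [← (measurableEmbedding_dualPt θ i).integral_map, map_dualPt, integral_smul_measure,
    ENNReal.toReal_ofReal (by positivity)]

theorem memLp_comp_dualPt (θ : ℝ) (i : Fin 2) (y : L2) : MemLp (fun t => y (dualPt θ i t)) 2 := by
  have h : MemLp (y : Plane → ℂ) 2 (Measure.map (dualPt θ i) volume) := by
    rw [map_dualPt]
    exact (Lp.memLp y).smul_measure ENNReal.ofReal_ne_top
  exact (memLp_map_measure_iff h.1 (measurableEmbedding_dualPt θ i).measurable.aemeasurable).1 h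

/-! ### Sums of the weight over reciprocal lattices -/

theorem summable_inv_one_add_sq : Summable fun k : ℤ => (1 + (k : ℝ) ^ 2)⁻¹ := by
  have h := Real.summable_one_div_int_pow (p := 2) |>.2 (by norm_num)
  refine Summable.of_nonneg_of_le (fun k => by positivity) (fun k => ?_)
    (h.add (summable_of_hasFiniteSupport (f := fun k : ℤ => if k = 0 then (1 : ℝ) else 0)
      ((Set.finite_singleton (0 : ℤ)).subset fun k hk => by
        by_contra h; simp [Set.mem_singleton_iff.not.1 h] at hk)))
  by_cases hk : k = 0
  · simp [hk]
  · simp only [hk, if_false, add_zero, one_div]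
    have : (0 : ℝ) < (k : ℝ) ^ 2 := by positivity
    gcongr
    linarith

/-- Once t is reduced to [0, 1) by its floor, 1 + k² ≤ 4(1 + (t + k)²) bounds every term. -/
theorem exists_sum_inv_le : ∃ S : ℝ, 0 ≤ S ∧
    ∀ t : ℝ, ∑' k : ℤ, ENNReal.ofReal ((1 + (t + k) ^ 2)⁻¹) ≤ ENNReal.ofReal S := by
  refine ⟨∑' k : ℤ, 4 * (1 + (k : ℝ) ^ 2)⁻¹, tsum_nonneg fun k => by positivity, fun t => ?_⟩
  rw [ENNReal.ofReal_tsum_of_nonneg (fun k => by positivity) (summable_inv_one_add_sq.mul_left 4),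
    ← (Equiv.subRight ⌊t⌋).tsum_eq]
  refine ENNReal.tsum_le_tsum fun k => ENNReal.ofReal_le_ofReal ?_
  have h0 := Int.fract_nonneg t
  have h1 := (Int.fract_lt_one t).le
  have e : t + ((Equiv.subRight ⌊t⌋ k : ℤ) : ℝ) = Int.fract t + k := by
    simp only [Equiv.subRight_apply, Int.cast_sub, Int.fract]; ring
  rw [e, ← div_eq_mul_inv, le_div_iff₀ (by positivity), inv_mul_le_iff₀ (by positivity)]
  nlinarith [sq_nonneg (2 * Int.fract t + k), sq_nonneg (Int.fract t + k)]

/-- The form (4/3)(t₀² − t₀t₁ + t₁²) exceeds t₀² by (t₀ − 2t₁)²/3, and likewise t₁², so the fourth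
power splits into one-dimensional weights. -/
theorem inv_jap_pow_le (θ : ℝ) (i : Fin 2) (t : Fin 2 → ℝ) :
    (jap (dualPt θ i t) ^ 4)⁻¹ ≤ (1 + t 0 ^ 2)⁻¹ * (1 + t 1 ^ 2)⁻¹ := by
  rw [← mul_inv]
  refine inv_anti₀ (by positivity) ?_
  have h : jap (dualPt θ i t) ^ 2 = 1 + 4 / 3 * (t 0 ^ 2 - t 0 * t 1 + t 1 ^ 2) := by
    rw [jap_sq, norm_dualPt, norm_sq_recipPt]
  have h4 : jap (dualPt θ i t) ^ 4 = (1 + 4 / 3 * (t 0 ^ 2 - t 0 * t 1 + t 1 ^ 2)) ^ 2 := by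
    rw [← h]; ring
  have h0 : 1 + t 0 ^ 2 ≤ 1 + 4 / 3 * (t 0 ^ 2 - t 0 * t 1 + t 1 ^ 2) := by
    nlinarith [sq_nonneg (t 0 - 2 * t 1)]
  have h1 : 1 + t 1 ^ 2 ≤ 1 + 4 / 3 * (t 0 ^ 2 - t 0 * t 1 + t 1 ^ 2) := by
    nlinarith [sq_nonneg (2 * t 0 - t 1)]
  rw [h4, pow_two (1 + 4 / 3 * _)]
  exact mul_le_mul h0 h1 (by positivity) ((by positivity : (0 : ℝ) ≤ 1 + t 0 ^ 2).trans h0)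

/-- The weight is summable over reciprocal lattices, uniformly in translations and rotations. -/
theorem exists_weightSum_le : ∃ W : ℝ, 0 ≤ W ∧ ∀ (θ : ℝ) (i : Fin 2) (t : Fin 2 → ℝ),
    ∑' k : Fin 2 → ℤ, ENNReal.ofReal ((jap (dualPt θ i (t + intVec k)) ^ 4)⁻¹) ≤
      ENNReal.ofReal W := by
  obtain ⟨S, hS, h⟩ := exists_sum_inv_le
  refine ⟨S * S, by positivity, fun θ i t => ?_⟩
  calc ∑' k : Fin 2 → ℤ, ENNReal.ofReal ((jap (dualPt θ i (t + intVec k)) ^ 4)⁻¹)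
      ≤ ∑' k : Fin 2 → ℤ, ENNReal.ofReal ((1 + (t 0 + k 0) ^ 2)⁻¹) *
          ENNReal.ofReal ((1 + (t 1 + k 1) ^ 2)⁻¹) := by
        refine ENNReal.tsum_le_tsum fun k => ?_
        rw [← ENNReal.ofReal_mul (by positivity)]
        exact ENNReal.ofReal_le_ofReal (inv_jap_pow_le θ i _)
    _ = ∑' p : ℤ × ℤ, ENNReal.ofReal ((1 + (t 0 + p.1) ^ 2)⁻¹) *
          ENNReal.ofReal ((1 + (t 1 + p.2) ^ 2)⁻¹) :=
        (finTwoArrowEquiv ℤ).tsum_eq fun p : ℤ × ℤ => ENNReal.ofReal ((1 + (t 0 + p.1) ^ 2)⁻¹) *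
          ENNReal.ofReal ((1 + (t 1 + p.2) ^ 2)⁻¹)
    _ = (∑' k : ℤ, ENNReal.ofReal ((1 + (t 0 + k) ^ 2)⁻¹)) *
          ∑' k : ℤ, ENNReal.ofReal ((1 + (t 1 + k) ^ 2)⁻¹) := by
        rw [ENNReal.tsum_prod']
        simp only [ENNReal.tsum_mul_left, ENNReal.tsum_mul_right]
    _ ≤ ENNReal.ofReal (S * S) := by
        rw [ENNReal.ofReal_mul hS]
        exact mul_le_mul' (h _) (h _)

/-- A bound for the sums of the weight over reciprocal lattices. -/
def weightSum : ℝ := exists_weightSum_le.choose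

theorem weightSum_nonneg : 0 ≤ weightSum := exists_weightSum_le.choose_spec.1

theorem tsum_weight_le (θ : ℝ) (i : Fin 2) (t : Fin 2 → ℝ) :
    ∑' k : Fin 2 → ℤ, ENNReal.ofReal ((jap (dualPt θ i (t + intVec k)) ^ 4)⁻¹) ≤
      ENNReal.ofReal weightSum := exists_weightSum_le.choose_spec.2 θ i t

/-! ### Sampling on the layers -/

/-- The weight in the sampling integrals of the layer `i`, shifted by `τ`. -/
def sampWeight (θ : ℝ) (i : Fin 2) (τ : Plane) (t : Fin 2 → ℝ) : ℂ :=
  Complex.exp (2 * Real.pi * Complex.I * (inner ℝ (dualPt θ i t) τ : ℝ)) * jw (dualPt θ i t) ^ 2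

theorem norm_planeChar (a : ℝ) : ‖Complex.exp (2 * Real.pi * Complex.I * (a : ℝ))‖ = 1 := by
  rw [show (2 * Real.pi * Complex.I * (a : ℝ) : ℂ) = ((2 * Real.pi * a : ℝ) : ℂ) * Complex.I by
    push_cast; ring, Complex.norm_exp_ofReal_mul_I]

theorem isSquareWeight_sampWeight (θ : ℝ) (i : Fin 2) (τ : Plane) :
    IsSquareWeight (sampWeight θ i τ) weightSum := by
  refine ⟨weightSum_nonneg, ?_, fun t => ?_⟩
  · have h := (measurableEmbedding_dualPt θ i).measurable
    refine Measurable.mul ?_ ((isMultiplier_jw_pow 2).meas.comp h)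
    have hc : Continuous fun ξ : Plane =>
      Complex.exp (2 * Real.pi * Complex.I * (inner ℝ ξ τ : ℝ)) := by fun_prop
    exact hc.measurable.comp h
  · refine le_trans (le_of_eq (tsum_congr fun k => ?_)) (tsum_weight_le θ i t)
    rw [sampWeight, ← ofReal_norm, norm_mul, norm_planeChar, one_mul, norm_pow, norm_jw,
      ← ENNReal.ofReal_pow (by positivity)]
    congr 1
    rw [← pow_mul, inv_pow]

/-- The site of layer `i` and sublattice `σ` in the cell `m`. -/
def siteAt (i σ : Fin 2) (m : Fin 2 → ℤ) : Site := (i, (m 0, m 1), σ)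

theorem siteAt_injective (i σ : Fin 2) : Function.Injective (siteAt i σ) := by
  intro m m' h
  simp only [siteAt, Prod.mk.injEq, true_and, and_true] at h
  funext j
  fin_cases j
  · exact h.1
  · exact h.2

theorem exists_siteAt {i σ : Fin 2} {n : Site} (h : n.1 = i ∧ n.2.2 = σ) :
    siteAt i σ ![n.2.1.1, n.2.1.2] = n := by
  obtain ⟨a, ⟨b, c⟩, e⟩ := n
  simp only at h
  simp [siteAt, h.1, h.2]

theorem hasSum_site_iff {F : Type*} [AddCommMonoid F] [TopologicalSpace F] {i σ : Fin 2}
    {f : Site → F} (hf : ∀ n : Site, ¬(n.1 = i ∧ n.2.2 = σ) → f n = 0) {a : F} :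
    HasSum (fun m => f (siteAt i σ m)) a ↔ HasSum f a := by
  refine (siteAt_injective i σ).hasSum_iff fun n hn => hf n fun h => hn ?_
  exact ⟨_, exists_siteAt h⟩

theorem sitePos_siteAt (d : Plane) (θ : ℝ) (i σ : Fin 2) (m : Fin 2 → ℤ) :
    sitePos d θ (siteAt i σ m) = ((m 0 : ℝ) • layerLatticeVec θ i 0 +
      (m 1 : ℝ) • layerLatticeVec θ i 1) + layerSiteShift d θ i σ := rfl

/-- In the coordinates dual to the lattice, the value at a site is an integer Fourier coefficient;
the site shift enters the weight as a phase, and 2/√3 is the Jacobian. -/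
theorem pointEval_sitePos (d : Plane) (θ : ℝ) (i σ : Fin 2) (m : Fin 2 → ℤ) (y : L2) :
    pointEval (sitePos d θ (siteAt i σ m)) y = (2 / Real.sqrt 3 : ℝ) *
      ∫ t, latticeChar m t * (sampWeight θ i (layerSiteShift d θ i σ) t * y (dualPt θ i t)) := by
  have h := integral_comp_dualPt θ i fun ξ =>
    Complex.exp (2 * Real.pi * Complex.I * (inner ℝ ξ (sitePos d θ (siteAt i σ m)) : ℝ)) *
      (jw ξ ^ 2 * y ξ)
  have e : ∀ t, Complex.exp (2 * Real.pi * Complex.I *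
      (inner ℝ (dualPt θ i t) (sitePos d θ (siteAt i σ m)) : ℝ)) *
      (jw (dualPt θ i t) ^ 2 * y (dualPt θ i t)) =
      latticeChar m t * (sampWeight θ i (layerSiteShift d θ i σ) t * y (dualPt θ i t)) := by
    intro t
    rw [sitePos_siteAt, inner_add_right, inner_dualPt, Complex.ofReal_add, mul_add,
      Complex.exp_add, latticeChar, sampWeight]
    ring
  simp only [e] at h
  rw [h, pointEval, Complex.real_smul, ← mul_assoc, ← Complex.ofReal_mul,
    div_mul_div_cancel₀' (by positivity), div_self (by positivity)]
  simp

/-- A bound for the sampling operators. -/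
def sampBound : ℝ := Real.sqrt (2 / Real.sqrt 3 * weightSum)

theorem sampBound_nonneg : 0 ≤ sampBound := Real.sqrt_nonneg _

theorem hasSum_sq_pointEval (d : Plane) (θ : ℝ) (i σ : Fin 2) (y : L2) :
    ∃ S, HasSum (fun m => ‖pointEval (sitePos d θ (siteAt i σ m)) y‖ ^ 2) S ∧
      S ≤ (sampBound * ‖y‖) ^ 2 := by
  obtain ⟨S, hS, hle⟩ := (isSquareWeight_sampWeight θ i (layerSiteShift d θ i σ)).hasSum_sq_coeff
    (memLp_comp_dualPt θ i y)
  refine ⟨(2 / Real.sqrt 3) ^ 2 * S, ?_, ?_⟩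
  · refine (hS.mul_left ((2 / Real.sqrt 3) ^ 2)).congr_fun fun m => ?_
    rw [pointEval_sitePos, norm_mul, mul_pow, Complex.norm_real, Real.norm_of_nonneg (by positivity)]
  · rw [integral_comp_dualPt θ i fun ξ => ‖y ξ‖ ^ 2, ← norm_sq_eq_integral, smul_eq_mul] at hle
    rw [mul_pow, sampBound, Real.sq_sqrt (mul_nonneg (by positivity) weightSum_nonneg)]
    calc (2 / Real.sqrt 3) ^ 2 * S ≤ (2 / Real.sqrt 3) ^ 2 *
          (weightSum * (Real.sqrt 3 / 2 * ‖y‖ ^ 2)) := by gcongr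
      _ = _ := by field_simp

/-- The representing vector of the evaluation at `X`. -/
def evalVec (X : Plane) : L2 :=
  mulOp (fun ξ => Complex.exp (2 * Real.pi * Complex.I * (-inner ℝ ξ X : ℝ))) (memLp_jw_sq.toLp _)

theorem isMultiplier_planeChar {g : Plane → ℝ} (hg : Continuous g) :
    IsMultiplier (fun ξ => Complex.exp (2 * Real.pi * Complex.I * (g ξ : ℝ))) 1 :=
  ⟨Continuous.measurable (by fun_prop), fun ξ => (norm_planeChar _).le⟩

theorem conj_planeChar (a : ℝ) : (starRingEnd ℂ) (Complex.exp (2 * Real.pi * Complex.I * (a : ℝ))) =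
    Complex.exp (2 * Real.pi * Complex.I * (-a : ℝ)) := by
  rw [← Complex.exp_conj]
  simp [Complex.conj_ofNat]

theorem coeFn_evalVec (X : Plane) : evalVec X =ᵐ[volume]
    fun ξ => Complex.exp (2 * Real.pi * Complex.I * (-inner ℝ ξ X : ℝ)) * jw ξ ^ 2 := by
  filter_upwards [coeFn_mulOp (isMultiplier_planeChar (g := fun ξ => -inner ℝ ξ X) (by fun_prop))
    (memLp_jw_sq.toLp _), memLp_jw_sq.coeFn_toLp] with ξ h1 h2
  rw [evalVec, h1, h2]

theorem pointEval_eq_inner (X : Plane) (y : L2) : pointEval X y = inner ℂ (evalVec X) y := by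
  rw [L2.inner_def, pointEval]
  apply integral_congr_ae
  filter_upwards [coeFn_evalVec X] with ξ h
  rw [RCLike.inner_apply, h, map_mul, conj_planeChar, neg_neg, map_pow, conj_jw]
  ring

/-- Sampling at the sites of layer `i` and sublattice `σ` of the function with Fourier transform
`(1 + |ξ|²)⁻¹ y`. -/
def sampFun (d : Plane) (θ : ℝ) (i σ : Fin 2) (y : L2) (n : Site) : ℂ :=
  if n.1 = i ∧ n.2.2 = σ then pointEval (sitePos d θ n) y else 0

theorem hasSum_sq_sampFun (d : Plane) (θ : ℝ) (i σ : Fin 2) (y : L2) :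
    ∃ S, HasSum (fun n => ‖sampFun d θ i σ y n‖ ^ 2) S ∧ S ≤ (sampBound * ‖y‖) ^ 2 := by
  obtain ⟨S, hS, hle⟩ := hasSum_sq_pointEval d θ i σ y
  refine ⟨S, (hasSum_site_iff (i := i) (σ := σ) fun n hn => ?_).1 ?_, hle⟩
  · simp [sampFun, hn]
  · simpa [sampFun, siteAt] using hS

theorem memlp_two_of_summable {f : Site → ℂ} (h : Summable fun n => ‖f n‖ ^ 2) : Memℓp f 2 :=
  memℓp_gen (by simpa using h)

theorem TBSpace.norm_sq_eq (ψ : TBSpace) : ‖ψ‖ ^ 2 = ∑' n, ‖ψ n‖ ^ 2 := by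
  have h := lp.norm_rpow_eq_tsum (p := 2) (by simp) ψ
  simpa using h

/-- Sampling at the sites of layer `i` and sublattice `σ`, as an operator. -/
def sampOp (d : Plane) (θ : ℝ) (i σ : Fin 2) : L2 →L[ℂ] TBSpace :=
  LinearMap.mkContinuous
    { toFun := fun y => ⟨sampFun d θ i σ y,
        memlp_two_of_summable (hasSum_sq_sampFun d θ i σ y).choose_spec.1.summable⟩
      map_add' := fun u v => by
        ext n
        simp only [lp.coeFn_add, Pi.add_apply, sampFun]
        split_ifs
        · simp only [pointEval_eq_inner, inner_add_right]
        · simp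
      map_smul' := fun c v => by
        ext n
        simp only [lp.coeFn_smul, Pi.smul_apply, sampFun, RingHom.id_apply, smul_eq_mul]
        split_ifs
        · simp only [pointEval_eq_inner, inner_smul_right]
        · simp }
    sampBound fun y => by
      obtain ⟨S, hS, hle⟩ := hasSum_sq_sampFun d θ i σ y
      refine (pow_le_pow_iff_left₀ (norm_nonneg _) (mul_nonneg sampBound_nonneg (norm_nonneg _))
        two_ne_zero).1 ?_
      rw [TBSpace.norm_sq_eq]
      exact hS.tsum_eq.trans_le hle

theorem sampOp_apply (d : Plane) (θ : ℝ) (i σ : Fin 2) (y : L2) (n : Site) :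
    sampOp d θ i σ y n = if n.1 = i ∧ n.2.2 = σ then pointEval (sitePos d θ n) y else 0 := rfl

theorem sampOp_siteAt (d : Plane) (θ : ℝ) (i σ : Fin 2) (y : L2) (m : Fin 2 → ℤ) :
    sampOp d θ i σ y (siteAt i σ m) = pointEval (sitePos d θ (siteAt i σ m)) y := by
  rw [sampOp_apply, if_pos ⟨rfl, rfl⟩]

theorem norm_sampOp_le (d : Plane) (θ : ℝ) (i σ : Fin 2) (y : L2) :
    ‖sampOp d θ i σ y‖ ≤ sampBound * ‖y‖ :=
  (sampOp d θ i σ).le_of_opNorm_le (LinearMap.mkContinuous_norm_le _ sampBound_nonneg _) y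

theorem inner_sampOp_left (d : Plane) (θ : ℝ) (i σ : Fin 2) (y : L2) (ψ : TBSpace) :
    HasSum (fun m => (starRingEnd ℂ) (pointEval (sitePos d θ (siteAt i σ m)) y) *
      ψ (siteAt i σ m)) (inner ℂ (sampOp d θ i σ y) ψ) := by
  have h := lp.hasSum_inner (𝕜 := ℂ) (sampOp d θ i σ y) ψ
  rw [← hasSum_site_iff (i := i) (σ := σ)] at h
  · simpa [sampOp_siteAt, mul_comm] using h
  · intro n hn
    rw [sampOp_apply, if_neg hn, inner_zero_left]

/-- **Poisson summation** for the sampling operators. -/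
theorem inner_sampOp_sampOp (d : Plane) (θ : ℝ) (i σ : Fin 2) (u y : L2) :
    inner ℂ (sampOp d θ i σ u) (sampOp d θ i σ y) = (2 / Real.sqrt 3 : ℝ) *
      ∑' k : Fin 2 → ℤ, Complex.exp (2 * Real.pi * Complex.I *
        (inner ℝ (dualPt θ i (intVec k)) (layerSiteShift d θ i σ) : ℝ)) *
        inner ℂ (mulOp (fun ξ => jw ξ ^ 2) u)
          (transOp (dualPt θ i (intVec k)) (mulOp (fun ξ => jw ξ ^ 2) y)) := by
  have h1 := inner_sampOp_left d θ i σ u (sampOp d θ i σ y)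
  have h2 := (isSquareWeight_sampWeight θ i (layerSiteShift d θ i σ)).hasSum_poisson
    (memLp_comp_dualPt θ i u) (memLp_comp_dualPt θ i y)
  have h3 := h2.mul_left ((2 / Real.sqrt 3 : ℝ) ^ 2 : ℂ)
  have h4 := h1.unique (h3.congr_fun fun m => by
    rw [sampOp_siteAt, pointEval_sitePos, pointEval_sitePos, map_mul, Complex.conj_ofReal]
    ring)
  rw [h4, sq, mul_assoc, ← tsum_mul_left]
  congr 1
  refine tsum_congr fun k => ?_
  have h5 := integral_comp_dualPt θ i fun ξ => (starRingEnd ℂ) (Complex.exp (2 * Real.pi *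
    Complex.I * (inner ℝ ξ (layerSiteShift d θ i σ) : ℝ)) * jw ξ ^ 2 * u ξ) *
      (Complex.exp (2 * Real.pi * Complex.I *
        (inner ℝ (ξ + dualPt θ i (intVec k)) (layerSiteShift d θ i σ) : ℝ)) *
        jw (ξ + dualPt θ i (intVec k)) ^ 2 * y (ξ + dualPt θ i (intVec k)))
  simp only [← dualPt_add] at h5
  simp only [sampWeight]
  rw [h5, Complex.real_smul, ← mul_assoc, ← Complex.ofReal_mul,
    div_mul_div_cancel₀' (by positivity), div_self (by positivity), Complex.ofReal_one, one_mul,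
    L2.inner_def, ← integral_const_mul]
  apply integral_congr_ae
  have h0 := (measurePreserving_add_right (volume : Measure Plane)
    (dualPt θ i (intVec k))).quasiMeasurePreserving.ae (coeFn_mulOp (isMultiplier_jw_pow 2) y)
  filter_upwards [coeFn_mulOp (isMultiplier_jw_pow 2) u,
    coeFn_transOp (dualPt θ i (intVec k)) (mulOp (fun ξ => jw ξ ^ 2) y), h0] with ξ e1 e2 e3
  rw [RCLike.inner_apply, e1, e2, e3, map_mul, map_mul, map_mul, map_pow, conj_jw, conj_planeChar,
    inner_add_left, Complex.ofReal_add, mul_add, Complex.exp_add, Complex.ofReal_neg, mul_neg,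
    Complex.exp_neg]
  have := Complex.exp_ne_zero (2 * Real.pi * Complex.I *
    (inner ℝ ξ (layerSiteShift d θ i σ) : ℝ))
  field_simp

open scoped InnerProductSpace

/-! ### The hopping function in momentum space -/

/-- The Fourier transform of the hopping function, as a function of the frequency. -/
def hopSymbol (hs : ℝ → ℝ) (ℓ : ℝ) (ξ : Plane) : ℂ := hopFT hs ((2 * Real.pi) • ξ) ℓ

theorem conj_hopSymbol (hs : ℝ → ℝ) (ℓ : ℝ) (ξ : Plane) :
    (starRingEnd ℂ) (hopSymbol hs ℓ ξ) = hopSymbol hs ℓ ξ :=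
  Complex.conj_eq_iff_im.2 (hopFT_im hs _ ℓ)

/-- From zⁿ/n! ≤ e^z at z = a(1 + x). -/
theorem one_add_pow_mul_exp_le {a x : ℝ} (ha : 0 < a) (hx : 0 ≤ x) (n : ℕ) :
    (1 + x) ^ n * Real.exp (-a * x) ≤ n.factorial / a ^ n * Real.exp a := by
  have h := Real.pow_div_factorial_le_exp (a * (1 + x)) (by positivity) n
  rw [mul_pow, div_le_iff₀ (by positivity), mul_add, mul_one, Real.exp_add] at h
  rw [div_mul_eq_mul_div, le_div_iff₀ (by positivity)]
  calc (1 + x) ^ n * Real.exp (-a * x) * a ^ n = a ^ n * (1 + x) ^ n * Real.exp (-a * x) := by ring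
    _ ≤ Real.exp a * Real.exp (a * x) * n.factorial * Real.exp (-a * x) := by gcongr
    _ = n.factorial * Real.exp a * (Real.exp (a * x) * Real.exp (-a * x)) := by ring
    _ = n.factorial * Real.exp a := by rw [← Real.exp_add]; simp

namespace HoppingAssumption

variable {hs : ℝ → ℝ} {C₁ C₂ C₃ D₁ D₂ ℓ₀ : ℝ} (hh : HoppingAssumption hs C₁ C₂ C₃ D₁ D₂ ℓ₀)
variable {ℓ : ℝ} (hℓ : ℓ₀ ≤ ℓ)
include hh hℓ

theorem ℓ_pos : 0 < ℓ := hh.ℓ₀_pos.trans_le hℓ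

theorem continuous_hopFT : Continuous fun ξ => hopFT hs ξ ℓ := by
  have h : LipschitzWith C₃.toNNReal fun ξ => hopFT hs ξ ℓ := by
    refine LipschitzWith.of_dist_le_mul fun ξ ξ' => ?_
    rw [dist_eq_norm, dist_eq_norm, Real.coe_toNNReal _ hh.C₃_pos.le]
    refine (hh.lipschitz ℓ hℓ ξ ξ').trans ?_
    have : Real.exp (-D₂ * ℓ * Metric.infDist 0 (segment ℝ ξ ξ')) ≤ 1 := by
      refine Real.exp_le_one_iff.2 ?_
      have := mul_nonneg (mul_nonneg hh.D₂_pos.le (hh.ℓ_pos hℓ).le)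
        (Metric.infDist_nonneg (x := (0 : Plane)) (s := segment ℝ ξ ξ'))
      linarith
    have h3 := hh.C₃_pos.le
    refine mul_le_mul_of_nonneg_right (mul_le_of_le_one_right h3 this) (norm_nonneg _)
  exact h.continuous

theorem continuous_hopSymbol : Continuous (hopSymbol hs ℓ) :=
  (hh.continuous_hopFT hℓ).comp (continuous_const_smul _)

/-- The decay rate is lowered from 2πD₂ℓ to D₂ℓ₀ to make the bound uniform in ℓ. -/
theorem norm_hopSymbol_le (ξ : Plane) :
    ‖hopSymbol hs ℓ ξ‖ ≤ C₂ * Real.exp (-(D₂ * ℓ₀) * ‖ξ‖) := by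
  refine (hh.upper ℓ hℓ _).trans (mul_le_mul_of_nonneg_left (Real.exp_le_exp.2 ?_) hh.C₂_pos.le)
  rw [norm_smul, Real.norm_of_nonneg (by positivity)]
  have h1 : 1 ≤ 2 * Real.pi := by linarith [Real.pi_gt_three]
  have h2 : D₂ * ℓ₀ * ‖ξ‖ ≤ D₂ * ℓ * ‖ξ‖ := by
    have := hh.D₂_pos
    gcongr
  have h3 : D₂ * ℓ * ‖ξ‖ * 1 ≤ D₂ * ℓ * ‖ξ‖ * (2 * Real.pi) :=
    mul_le_mul_of_nonneg_left h1
      (mul_nonneg (mul_nonneg hh.D₂_pos.le (hh.ℓ_pos hℓ).le) (norm_nonneg _))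
  nlinarith

theorem norm_hopSymbol_mul_le (ξ : Plane) (n : ℕ) :
    ‖hopSymbol hs ℓ ξ‖ * jap ξ ^ n ≤
      C₂ * (n.factorial / (D₂ * ℓ₀) ^ n * Real.exp (D₂ * ℓ₀)) := by
  have h1 := hh.norm_hopSymbol_le hℓ ξ
  have h2 : jap ξ ^ n ≤ (1 + ‖ξ‖) ^ n := pow_le_pow_left₀ (jap_pos ξ).le (jap_le_one_add ξ) n
  have h3 := one_add_pow_mul_exp_le (mul_pos hh.D₂_pos hh.ℓ₀_pos) (norm_nonneg ξ) n
  calc ‖hopSymbol hs ℓ ξ‖ * jap ξ ^ n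
      ≤ C₂ * Real.exp (-(D₂ * ℓ₀) * ‖ξ‖) * (1 + ‖ξ‖) ^ n :=
        mul_le_mul h1 h2 (pow_nonneg (jap_pos ξ).le n)
          (mul_nonneg hh.C₂_pos.le (Real.exp_pos _).le)
    _ = C₂ * ((1 + ‖ξ‖) ^ n * Real.exp (-(D₂ * ℓ₀) * ‖ξ‖)) := by ring
    _ ≤ _ := mul_le_mul_of_nonneg_left h3 hh.C₂_pos.le

theorem hop_eq_integral (r : Plane) : (hop hs r ℓ : ℂ) =
    ∫ ξ : Plane, Complex.exp (2 * Real.pi * Complex.I * (inner ℝ ξ r : ℝ)) * hopSymbol hs ℓ ξ := by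
  rw [hh.inversion ℓ hℓ r]
  have h := Measure.integral_comp_smul (volume : Measure Plane)
    (fun ξ => Complex.exp (Complex.I * (inner ℝ ξ r : ℝ)) * hopFT hs ξ ℓ) (2 * Real.pi)
  rw [finrank_euclideanSpace_fin, abs_of_pos (by positivity), Complex.real_smul] at h
  have e : ∀ ξ : Plane, Complex.exp (Complex.I * (inner ℝ ((2 * Real.pi) • ξ) r : ℝ)) *
      hopFT hs ((2 * Real.pi) • ξ) ℓ =
      Complex.exp (2 * Real.pi * Complex.I * (inner ℝ ξ r : ℝ)) * hopSymbol hs ℓ ξ := by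
    intro ξ
    rw [hopSymbol, real_inner_smul_left]
    congr 2
    push_cast
    ring
  simp only [e] at h
  rw [h]
  push_cast
  rw [one_div]

end HoppingAssumption

/-! ### The interlayer Hamiltonian -/

/-- The symbol of the interlayer Hamiltonian. -/
def interSymbol (hs : ℝ → ℝ) (ℓ : ℝ) (ξ : Plane) : ℂ :=
  (Real.sqrt 3 / 2 * jap ξ ^ 4 : ℝ) * hopSymbol hs ℓ ξ

theorem conj_interSymbol (hs : ℝ → ℝ) (ℓ : ℝ) (ξ : Plane) :
    (starRingEnd ℂ) (interSymbol hs ℓ ξ) = interSymbol hs ℓ ξ := by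
  rw [interSymbol, map_mul, Complex.conj_ofReal, conj_hopSymbol]

/-- The interlayer Hamiltonian, as an operator. -/
def interOp (hs : ℝ → ℝ) (d : Plane) (θ ℓ : ℝ) : TBSpace →L[ℂ] TBSpace :=
  ∑ i : Fin 2, ∑ σ : Fin 2, ∑ σ' : Fin 2, sampOp d θ i σ ∘L mulOp (interSymbol hs ℓ) ∘L
    ContinuousLinearMap.adjoint (sampOp d θ i.rev σ')

theorem jw_mul_jap (ξ : Plane) : jw ξ * (jap ξ : ℂ) = 1 := by
  rw [jw, ← Complex.ofReal_mul, inv_mul_cancel₀ (jap_pos ξ).ne', Complex.ofReal_one]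

theorem interOp_apply (hs : ℝ → ℝ) (d : Plane) (θ ℓ : ℝ) (ψ : TBSpace) (n : Site) :
    interOp hs d θ ℓ ψ n = ∑ σ' : Fin 2, pointEval (sitePos d θ n)
      (mulOp (interSymbol hs ℓ) (ContinuousLinearMap.adjoint (sampOp d θ n.1.rev σ') ψ)) := by
  simp only [interOp, sum_apply, ContinuousLinearMap.comp_apply, lp.coeFn_sum,
    Finset.sum_apply, sampOp_apply]
  rw [Finset.sum_eq_single n.1, Finset.sum_eq_single n.2.2]
  · simp
  · intro σ _ hσ
    simp [Ne.symm hσ]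
  · simp
  · intro i _ hi
    simp [Ne.symm hi]
  · simp

namespace HoppingAssumption

variable {hs : ℝ → ℝ} {C₁ C₂ C₃ D₁ D₂ ℓ₀ : ℝ} (hh : HoppingAssumption hs C₁ C₂ C₃ D₁ D₂ ℓ₀)
variable {ℓ : ℝ} (hℓ : ℓ₀ ≤ ℓ)
include hh hℓ

theorem isMultiplier_interSymbol : ∃ C, IsMultiplier (interSymbol hs ℓ) C := by
  refine ⟨Real.sqrt 3 / 2 * (C₂ * (Nat.factorial 4 / (D₂ * ℓ₀) ^ 4 * Real.exp (D₂ * ℓ₀))),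
    ?_, fun ξ => ?_⟩
  · have h1 := hh.continuous_hopSymbol hℓ
    have h2 := continuous_jap
    unfold interSymbol
    exact Continuous.measurable (by fun_prop)
  · rw [interSymbol, norm_mul, Complex.norm_real,
      Real.norm_of_nonneg (mul_nonneg (by positivity) (pow_nonneg (jap_pos ξ).le 4)), mul_assoc]
    refine mul_le_mul_of_nonneg_left ?_ (by positivity)
    rw [mul_comm]
    exact hh.norm_hopSymbol_mul_le hℓ ξ 4

/-- Evaluation at X and the evaluation vector at Y carry a weight jw² each, which the factor jap⁴ of
`interSymbol` cancels; what remains is Fourier inversion of h. The hopping matrix therefore factors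
as S M S* with bounded sampling operators S and a bounded real multiplier M. -/
theorem pointEval_interSymbol (X Y : Plane) : pointEval X (mulOp (interSymbol hs ℓ) (evalVec Y)) =
    (Real.sqrt 3 / 2 : ℝ) * (hop hs (X - Y) ℓ : ℂ) := by
  obtain ⟨C, hC⟩ := hh.isMultiplier_interSymbol hℓ
  rw [hh.hop_eq_integral hℓ, ← integral_const_mul, pointEval]
  apply integral_congr_ae
  filter_upwards [coeFn_mulOp hC (evalVec Y), coeFn_evalVec Y] with ξ h1 h2
  rw [h1, h2, interSymbol, inner_sub_right, sub_eq_add_neg, Complex.ofReal_add, mul_add _ _ (_ : ℂ),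
    Complex.exp_add]
  have := jw_mul_jap ξ
  push_cast
  linear_combination (Complex.exp (2 * Real.pi * Complex.I * (inner ℝ ξ X : ℝ)) *
    Complex.exp (2 * Real.pi * Complex.I * -(inner ℝ ξ Y : ℝ)) * hopSymbol hs ℓ ξ *
    (Real.sqrt 3 / 2)) * ((jw ξ * jap ξ) ^ 3 + (jw ξ * jap ξ) ^ 2 + jw ξ * jap ξ + 1) * this

/-- The adjoint of sampling expands into the sum over the sites of the other layer, with
coefficients given by `pointEval_interSymbol`. The factorization also provides the convergence of
that sum. -/
theorem interOp_eq (d : Plane) (θ : ℝ) (ψ : TBSpace) (n : Site) :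
    interOp hs d θ ℓ ψ n = interlayer hs d θ ℓ ψ n := by
  obtain ⟨C, hC⟩ := hh.isMultiplier_interSymbol hℓ
  have h : ∀ σ' : Fin 2, HasSum (fun m : ℤ × ℤ => (Real.sqrt 3 / 2 : ℝ) *
      ((hop hs (sitePos d θ n - sitePos d θ (n.1.rev, m, σ')) ℓ : ℂ) * ψ (n.1.rev, m, σ')))
      (pointEval (sitePos d θ n) (mulOp (interSymbol hs ℓ)
        (ContinuousLinearMap.adjoint (sampOp d θ n.1.rev σ') ψ))) := by
    intro σ'
    have h1 := inner_sampOp_left d θ n.1.rev σ' (mulOp (interSymbol hs ℓ)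
      (evalVec (sitePos d θ n))) ψ
    rw [← ContinuousLinearMap.adjoint_inner_right, inner_mulOp_left hC,
      ← pointEval_eq_inner] at h1
    simp only [conj_interSymbol, hh.pointEval_interSymbol hℓ, map_mul, Complex.conj_ofReal] at h1
    rw [← (finTwoArrowEquiv ℤ).hasSum_iff]
    refine h1.congr_fun fun m => ?_
    have e : hop hs (sitePos d θ (siteAt n.1.rev σ' m) - sitePos d θ n) ℓ =
        hop hs (sitePos d θ n - sitePos d θ (n.1.rev, (m 0, m 1), σ')) ℓ := by
      rw [hop, hop, norm_sub_rev]; rfl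
    rw [e]
    simp [siteAt, mul_assoc]
  rw [interOp_apply, interlayer, ← tsum_mul_left]
  have h2 := hasSum_sum (s := Finset.univ) fun σ' _ => h σ'
  rw [← h2.tsum_eq]
  refine tsum_congr fun m => ?_
  rw [Finset.mul_sum]

/-- The symbol M is real, so the adjoint of each block S M S* is the block with the two layers and
sublattices exchanged, and the sum is invariant under this exchange. -/
theorem inner_interOp (d : Plane) (θ : ℝ) (φ ψ : TBSpace) :
    inner ℂ (interOp hs d θ ℓ φ) ψ = inner ℂ φ (interOp hs d θ ℓ ψ) := by
  obtain ⟨C, hC⟩ := hh.isMultiplier_interSymbol hℓ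
  have h : ∀ i σ σ' j, inner ℂ (sampOp d θ i σ (mulOp (interSymbol hs ℓ)
      (ContinuousLinearMap.adjoint (sampOp d θ j σ') φ))) ψ =
      inner ℂ φ (sampOp d θ j σ' (mulOp (interSymbol hs ℓ)
      (ContinuousLinearMap.adjoint (sampOp d θ i σ) ψ))) := by
    intro i σ σ' j
    rw [← ContinuousLinearMap.adjoint_inner_right, inner_mulOp_left hC,
      ContinuousLinearMap.adjoint_inner_left]
    simp only [conj_interSymbol]
  simp only [interOp, sum_apply, ContinuousLinearMap.comp_apply, sum_inner,
    inner_sum]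
  simp only [h]
  rw [← Equiv.sum_comp Fin.revPerm]
  refine Finset.sum_congr rfl fun i _ => ?_
  rw [Finset.sum_comm]
  simp only [Fin.revPerm_apply, Fin.rev_rev]

end HoppingAssumption

/-! ### The intralayer Hamiltonian -/

/-- The offsets of the cells of the three neighbours of a site. -/
def bondOffset : Fin 3 → ℤ × ℤ := ![(0, 0), (1, 0), (0, 1)]

/-- The three neighbours of a site. -/
def neighbour (j : Fin 3) (n : Site) : Site :=
  if n.2.2 = 0 then (n.1, n.2.1 - bondOffset j, 1) else (n.1, n.2.1 + bondOffset j, 0)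

/-- The offsets from A to B and from B to A are opposite. Being an involution makes composition with
the neighbour map isometric and self-adjoint on ℓ². -/
theorem neighbour_involutive (j : Fin 3) : Function.Involutive (neighbour j) := by
  rintro ⟨i, m, σ⟩
  fin_cases σ <;> simp [neighbour]

theorem TBSpace.summable_sq (ψ : TBSpace) : Summable fun n => ‖ψ n‖ ^ 2 := by
  simpa using (lp.memℓp ψ).summable (by simp)

theorem memlp_neighbour (j : Fin 3) (ψ : TBSpace) : Memℓp (fun n => ψ (neighbour j n)) 2 :=
  memlp_two_of_summable (((neighbour_involutive j).toPerm.summable_iff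
    (f := fun n => ‖ψ n‖ ^ 2)).2 (TBSpace.summable_sq ψ))

/-- Composition with the neighbour map, as an operator. -/
def neighbourOp (j : Fin 3) : TBSpace →L[ℂ] TBSpace :=
  LinearMap.mkContinuous
    { toFun := fun ψ => ⟨fun n => ψ (neighbour j n), memlp_neighbour j ψ⟩
      map_add' := fun φ ψ => by
        ext n
        simp only [lp.coeFn_add, Pi.add_apply]
      map_smul' := fun c ψ => by
        ext n
        simp only [lp.coeFn_smul, Pi.smul_apply, RingHom.id_apply] }
    1 fun ψ => by
      rw [one_mul]
      refine (pow_le_pow_iff_left₀ (norm_nonneg _) (norm_nonneg _) two_ne_zero).1 ?_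
      rw [TBSpace.norm_sq_eq, TBSpace.norm_sq_eq]
      exact ((neighbour_involutive j).toPerm.tsum_eq fun n => ‖ψ n‖ ^ 2).le

theorem neighbourOp_apply (j : Fin 3) (ψ : TBSpace) (n : Site) :
    neighbourOp j ψ n = ψ (neighbour j n) := rfl

theorem inner_neighbourOp (j : Fin 3) (φ ψ : TBSpace) :
    inner ℂ (neighbourOp j φ) ψ = inner ℂ φ (neighbourOp j ψ) := by
  rw [lp.inner_eq_tsum, lp.inner_eq_tsum, ← (neighbour_involutive j).toPerm.tsum_eq]
  refine tsum_congr fun n => ?_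
  simp only [Function.Involutive.coe_toPerm, neighbourOp_apply, neighbour_involutive j n]

/-- The intralayer Hamiltonian, as an operator. -/
def intraOp : TBSpace →L[ℂ] TBSpace := (-(2 / Real.sqrt 3 : ℝ) : ℂ) • ∑ j : Fin 3, neighbourOp j

theorem intraOp_apply (ψ : TBSpace) (n : Site) :
    intraOp ψ n = (-(2 / Real.sqrt 3 : ℝ) : ℂ) * ∑ j : Fin 3, ψ (neighbour j n) := by
  simp only [intraOp, smul_apply, sum_apply, lp.coeFn_smul,
    lp.coeFn_sum, Pi.smul_apply, Finset.sum_apply, neighbourOp_apply, smul_eq_mul]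

theorem intraOp_eq (ψ : TBSpace) (n : Site) : intraOp ψ n = intralayer ψ n.1 n.2.1 n.2.2 := by
  rw [intraOp_apply, intralayer, Fin.sum_univ_three]
  congr 1
  obtain ⟨i, m, σ⟩ := n
  fin_cases σ <;> simp [neighbour, bondOffset, Prod.sub_def, Prod.add_def]

theorem inner_intraOp (φ ψ : TBSpace) : inner ℂ (intraOp φ) ψ = inner ℂ φ (intraOp ψ) := by
  simp only [intraOp, smul_apply, sum_apply, inner_smul_left,
    inner_smul_right, sum_inner, inner_sum, inner_neighbourOp, map_neg, Complex.conj_ofReal]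

/-- The tight-binding Hamiltonian, as an operator. -/
def hamOp (hs : ℝ → ℝ) (d : Plane) (θ ℓ : ℝ) : TBSpace →L[ℂ] TBSpace :=
  intraOp + interOp hs d θ ℓ

/-! ### Schrödinger evolution with a bounded Hamiltonian -/

section Evolution

variable {E : Type*} [NormedAddCommGroup E] [InnerProductSpace ℂ E] [CompleteSpace E]
variable {H : E →L[ℂ] E}

theorem norm_exp_I_smul (hH : IsSelfAdjoint H) (v : E) :
    ‖NormedSpace.exp (Complex.I • H) v‖ = ‖v‖ := by
  have h := (selfAdjoint.expUnitary ⟨H, hH⟩).2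
  rw [selfAdjoint.expUnitary_coe] at h
  exact ContinuousLinearMap.norm_map_of_mem_unitary h v

/-- Conjugation with the unitary group e^(iτH) removes H: the derivative of e^(iτH) η is e^(iτH) r,
of norm at most K. -/
theorem norm_le_of_hasDerivWithinAt_schrodinger (hH : IsSelfAdjoint H) {η r : ℝ → E} {K : ℝ}
    (hη : ∀ τ, 0 ≤ τ → HasDerivWithinAt η (-Complex.I • H (η τ) + r τ) (Ici 0) τ)
    (hr : ∀ τ, 0 ≤ τ → ‖r τ‖ ≤ K) (h0 : η 0 = 0) {τ : ℝ} (hτ : 0 ≤ τ) : ‖η τ‖ ≤ K * τ := by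
  set U : ℝ → E →L[ℂ] E := fun τ => NormedSpace.exp (τ • (Complex.I • H)) with hU
  have hUn : ∀ τ v, ‖U τ v‖ = ‖v‖ := by
    intro τ v
    have := norm_exp_I_smul (H := (τ : ℂ) • H) (by
      rw [IsSelfAdjoint, star_smul, hH.star_eq]; simp) v
    rw [← this, hU]
    simp only
    rw [smul_comm Complex.I, ← Complex.coe_smul τ]
  have hUd : ∀ τ, HasDerivAt U (U τ * (Complex.I • H)) τ := fun τ =>
    hasDerivAt_exp_smul_const (Complex.I • H) τ
  have hz : ∀ t, 0 ≤ t → HasDerivWithinAt (fun t => U t (η t)) (U t (r t)) (Ici 0) t := by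
    intro t ht
    have h1 := ((ContinuousLinearMap.restrictScalarsL ℂ E E ℝ ℝ).hasFDerivAt.comp_hasDerivAt t
      (hUd t)).hasDerivWithinAt (s := Ici 0)
    have h := h1.clm_apply (hη t ht)
    refine h.congr_deriv ?_
    change U t ((Complex.I • H) (η t)) + U t (-Complex.I • H (η t) + r t) = U t (r t)
    rw [smul_apply, map_add, neg_smul, map_neg, add_neg_cancel_left]
  have := norm_image_sub_le_of_norm_deriv_right_le_segment (f := fun t => U t (η t))
    (f' := fun t => U t (r t)) (C := K) (a := 0) (b := τ)
    (fun t ht => (hz t ht.1).continuousWithinAt.mono Icc_subset_Ici_self)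
    (fun t ht => (hz t ht.1).mono (Ici_subset_Ici.2 ht.1))
    (fun t ht => (hUn _ _).trans_le (hr t ht.1)) τ ⟨hτ, le_rfl⟩
  simpa [h0, hUn] using this

theorem exists_schrodinger (v : E) : ∃ ψ : ℝ → E, ψ 0 = v ∧
    ∀ τ, HasDerivAt ψ (-Complex.I • H (ψ τ)) τ := by
  refine ⟨fun τ => NormedSpace.exp (τ • (-Complex.I • H)) v, by simp, fun τ => ?_⟩
  have h := hasDerivAt_exp_smul_const' (𝕂 := ℝ) (-Complex.I • H) τ
  have h1 := (((ContinuousLinearMap.apply ℂ E v).restrictScalars ℝ).hasFDerivAt.comp_hasDerivAt τ h)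
  exact h1

end Evolution

/-! ### Scaled sampling -/

/-- The character `e^{2πia}`. -/
def echar (a : ℝ) : ℂ := Complex.exp (2 * Real.pi * Complex.I * (a : ℝ))

theorem echar_add (a b : ℝ) : echar (a + b) = echar a * echar b := by
  rw [echar, Complex.ofReal_add, mul_add, Complex.exp_add]; rfl

theorem norm_echar (a : ℝ) : ‖echar a‖ = 1 := norm_planeChar a

theorem conj_echar (a : ℝ) : (starRingEnd ℂ) (echar a) = echar (-a) := conj_planeChar a

theorem echar_zero : echar 0 = 1 := by simp [echar]

theorem echar_intCast (n : ℤ) : echar n = 1 := by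
  rw [echar, Complex.exp_eq_one_iff]
  exact ⟨n, by push_cast; ring⟩

theorem pointEval_echar (X : Plane) (y : L2) :
    pointEval X y = ∫ ξ : Plane, echar (inner ℝ ξ X) * (jw ξ ^ 2 * y ξ) := rfl

/-- Evaluation at a translated point. -/
theorem pointEval_add_point (X Y : Plane) (y : L2) :
    pointEval (X + Y) y = pointEval X (mulOp (fun ξ => echar (inner ℝ ξ Y)) y) := by
  rw [pointEval_echar, pointEval_echar]
  apply integral_congr_ae
  filter_upwards [coeFn_mulOp (isMultiplier_planeChar (g := fun ξ => inner ℝ ξ Y) (by fun_prop)) y]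
    with ξ h
  change mulOp (fun ξ => echar (inner ℝ ξ Y)) y ξ = echar (inner ℝ ξ Y) * y ξ at h
  rw [h, inner_add_right, echar_add]
  ring

/-- Translation in momentum space is modulation in position space. -/
theorem pointEval_shiftOp (X q : Plane) (y : L2) :
    pointEval X (shiftOp 2 q y) = echar (-inner ℝ q X) * pointEval X y := by
  rw [pointEval_echar, pointEval_echar, ← integral_const_mul,
    ← integral_add_right_eq_self (fun ξ => echar (-inner ℝ q X) *
      (echar (inner ℝ ξ X) * (jw ξ ^ 2 * y ξ))) q]
  apply integral_congr_ae
  rw [shiftOp_apply]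
  filter_upwards [coeFn_mulOp (isMultiplier_shiftRatio 2 q) (transOp q y), coeFn_transOp q y]
    with ξ h1 h2
  rw [h1, h2, shiftRatio, ← mul_assoc (echar _) (echar _), ← echar_add, inner_add_left]
  have := jw_ne_zero ξ
  rw [show -inner ℝ q X + (inner ℝ ξ X + inner ℝ q X) = inner ℝ ξ X by ring]
  field_simp

theorem memLp_dilation {γ : ℝ} (hγ : 0 < γ) (y : L2) :
    MemLp (fun η : Plane => (γ⁻¹ : ℂ) * y (γ⁻¹ • η)) 2 := by
  have hmap := Measure.map_addHaar_smul (volume : Measure Plane) (inv_ne_zero hγ.ne')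
  have h : MemLp (y : Plane → ℂ) 2 (Measure.map (fun η : Plane => γ⁻¹ • η) volume) := by
    rw [hmap]
    exact (Lp.memLp y).smul_measure ENNReal.ofReal_ne_top
  exact (h.comp_of_map (measurable_const_smul _).aemeasurable).const_mul _

/-- The dilation `η ↦ γ⁻¹ y(γ⁻¹ η)`. -/
def dilVec {γ : ℝ} (hγ : 0 < γ) (y : L2) : L2 := (memLp_dilation hγ y).toLp _

theorem coeFn_dilVec {γ : ℝ} (hγ : 0 < γ) (y : L2) :
    dilVec hγ y =ᵐ[volume] fun η => (γ⁻¹ : ℂ) * y (γ⁻¹ • η) := MemLp.coeFn_toLp _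

theorem norm_dilVec {γ : ℝ} (hγ : 0 < γ) (y : L2) : ‖dilVec hγ y‖ = ‖y‖ := by
  have h : ‖dilVec hγ y‖ ^ 2 = ‖y‖ ^ 2 := by
    rw [norm_sq_eq_integral, norm_sq_eq_integral]
    have h1 : ∫ η, ‖dilVec hγ y η‖ ^ 2 = ∫ η, γ⁻¹ ^ 2 * ‖y (γ⁻¹ • η)‖ ^ 2 := by
      apply integral_congr_ae
      filter_upwards [coeFn_dilVec hγ y] with η h
      rw [h, norm_mul, mul_pow, ← Complex.ofReal_inv, Complex.norm_real,
        Real.norm_of_nonneg (inv_nonneg.2 hγ.le)]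
    rw [h1, integral_const_mul, Measure.integral_comp_inv_smul volume (fun η => ‖y η‖ ^ 2),
      finrank_euclideanSpace_fin, abs_of_pos (by positivity), smul_eq_mul, ← mul_assoc, ← mul_pow,
      inv_mul_cancel₀ hγ.ne', one_pow, one_mul]
  exact (pow_left_inj₀ (norm_nonneg _) (norm_nonneg _) two_ne_zero).1 h

theorem jap_le_jap_of_norm_le {ξ η : Plane} (h : ‖ξ‖ ≤ ‖η‖) : jap ξ ≤ jap η :=
  Real.sqrt_le_sqrt (by gcongr)

theorem integral_comp_rescale {γ : ℝ} (hγ : 0 < γ) (k : Plane) (F : Plane → ℂ) :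
    ∫ η, F (γ⁻¹ • (η - k)) = (γ : ℂ) ^ 2 * ∫ ζ, F ζ := by
  rw [integral_sub_right_eq_self (fun η => F (γ⁻¹ • η)) k,
    Measure.integral_comp_inv_smul volume F, finrank_euclideanSpace_fin, abs_of_pos (by positivity),
    Complex.real_smul, Complex.ofReal_pow]

/-- The dilated wave packet at momentum `k` is a function sampled at unit scale. -/
theorem exists_lift {γ : ℝ} (hγ : 0 < γ) (hγ1 : γ ≤ 1) (k : Plane) (y : L2) : ∃ z : L2,
    ‖z‖ ≤ (1 + ‖k‖) ^ 2 * ‖y‖ ∧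
    (∀ᵐ η, jw η ^ 2 * z η = (γ⁻¹ : ℂ) * (jw (γ⁻¹ • (η - k)) ^ 2 * y (γ⁻¹ • (η - k)))) ∧
    ∀ X, pointEval X z = γ * (echar (inner ℝ k X) * pointEval (γ • X) y) := by
  -- As γ ≤ 1, the dilation only increases the bracket, so Peetre's inequality for η = (η − k) + k
  -- bounds the ratio independently of γ.
  have hm : IsMultiplier (fun η => (jw (γ⁻¹ • (η - k)) / jw η) ^ 2) ((1 + ‖k‖) ^ 2) := by
    refine ⟨((isMultiplier_jw.meas.comp (by fun_prop)).div isMultiplier_jw.meas).pow_const 2,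
      fun η => ?_⟩
    rw [norm_pow, norm_div, norm_jw, norm_jw, inv_div_inv]
    refine pow_le_pow_left₀ (div_nonneg (jap_pos _).le (jap_pos _).le) ?_ 2
    rw [div_le_iff₀ (jap_pos _), mul_comm]
    have h1 := jap_add_le (η - k) k
    rw [sub_add_cancel] at h1
    refine h1.trans (mul_le_mul_of_nonneg_right (jap_le_jap_of_norm_le ?_) (by positivity))
    rw [norm_smul, Real.norm_of_nonneg (inv_nonneg.2 hγ.le)]
    exact le_mul_of_one_le_left (norm_nonneg _) ((one_le_inv₀ hγ).2 hγ1)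
  have hz : ∀ᵐ η, jw η ^ 2 * mulOp (fun η => (jw (γ⁻¹ • (η - k)) / jw η) ^ 2)
      (transOp (-k) (dilVec hγ y)) η =
      (γ⁻¹ : ℂ) * (jw (γ⁻¹ • (η - k)) ^ 2 * y (γ⁻¹ • (η - k))) := by
    have h0 := (measurePreserving_add_right (volume : Measure Plane) (-k)).quasiMeasurePreserving.ae
      (coeFn_dilVec hγ y)
    filter_upwards [coeFn_mulOp hm (transOp (-k) (dilVec hγ y)), coeFn_transOp (-k) (dilVec hγ y),
      h0] with η h1 h2 h3
    rw [h1, h2, h3, ← sub_eq_add_neg]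
    have := jw_ne_zero η
    field_simp
  refine ⟨_, ?_, hz, fun X => ?_⟩
  · refine (norm_mulOp_le hm _).trans (le_of_eq ?_)
    rw [LinearIsometry.norm_map, norm_dilVec]
  · have e1 : pointEval X (mulOp (fun η => (jw (γ⁻¹ • (η - k)) / jw η) ^ 2)
        (transOp (-k) (dilVec hγ y))) = ∫ η, (fun ζ : Plane => echar (inner ℝ (γ • ζ + k) X) *
        ((γ⁻¹ : ℂ) * (jw ζ ^ 2 * y ζ))) (γ⁻¹ • (η - k)) := by
      rw [pointEval_echar]
      apply integral_congr_ae
      filter_upwards [hz] with η h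
      rw [h, smul_smul, mul_inv_cancel₀ hγ.ne', one_smul, sub_add_cancel]
    have e2 := integral_comp_rescale hγ k (fun ζ : Plane => echar (inner ℝ (γ • ζ + k) X) *
      ((γ⁻¹ : ℂ) * (jw ζ ^ 2 * y ζ)))
    refine e1.trans (e2.trans ?_)
    rw [pointEval_echar, ← integral_const_mul,
      ← integral_const_mul, ← integral_const_mul]
    congr 1
    funext ζ
    rw [inner_add_left, echar_add, real_inner_smul_left, inner_smul_right]
    have : (γ : ℂ) ≠ 0 := Complex.ofReal_ne_zero.2 hγ.ne'
    field_simp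

/-- Sampling of `γ f(γ ·)` at the sites of layer `i` and sublattice `σ`, where `f` has Fourier
transform `(1 + |ξ|²)⁻¹ y`. -/
def packFun (d : Plane) (θ γ : ℝ) (i σ : Fin 2) (y : L2) (n : Site) : ℂ :=
  if n.1 = i ∧ n.2.2 = σ then γ * pointEval (γ • sitePos d θ n) y else 0

/-- The lift at momentum k = 0. The prefactor γ is the L² normalization of the dilation in dimension
two, which bounds `packOp` uniformly in γ. -/
theorem exists_sampOp_eq_packFun (d : Plane) (θ : ℝ) {γ : ℝ} (hγ : γ ∈ Ioc (0 : ℝ) 1)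
    (i σ : Fin 2) (y : L2) : ∃ z : L2, ‖z‖ ≤ ‖y‖ ∧
      ⇑(sampOp d θ i σ z) = packFun d θ γ i σ y := by
  obtain ⟨z, hz, -, h⟩ := exists_lift hγ.1 hγ.2 0 y
  refine ⟨z, by simpa using hz, ?_⟩
  funext n
  simp [sampOp_apply, packFun, h, echar_zero]

/-- Sampling of `γ f(γ ·)` at the sites of layer `i` and sublattice `σ`, as an operator. -/
def packOp (d : Plane) (θ : ℝ) {γ : ℝ} (hγ : γ ∈ Ioc (0 : ℝ) 1) (i σ : Fin 2) : L2 →L[ℂ] TBSpace :=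
  LinearMap.mkContinuous
    { toFun := fun y => ⟨packFun d θ γ i σ y,
        (exists_sampOp_eq_packFun d θ hγ i σ y).choose_spec.2 ▸ lp.memℓp _⟩
      map_add' := fun u v => by
        ext n
        simp only [lp.coeFn_add, Pi.add_apply, packFun]
        split_ifs
        · simp only [pointEval_eq_inner, inner_add_right, mul_add]
        · simp
      map_smul' := fun c v => by
        ext n
        simp only [lp.coeFn_smul, Pi.smul_apply, packFun, RingHom.id_apply, smul_eq_mul]
        split_ifs
        · simp only [pointEval_eq_inner, inner_smul_right, mul_left_comm]
        · simp }
    sampBound fun y => by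
      obtain ⟨z, hz, h⟩ := exists_sampOp_eq_packFun d θ hγ i σ y
      have e : (⟨packFun d θ γ i σ y, h ▸ lp.memℓp _⟩ : TBSpace) = sampOp d θ i σ z :=
        lp.ext h.symm
      exact (congrArg norm e).trans_le ((norm_sampOp_le d θ i σ z).trans
        (mul_le_mul_of_nonneg_left hz sampBound_nonneg))

section packet

variable (d : Plane) (θ : ℝ) {γ : ℝ} (hγ : γ ∈ Ioc (0 : ℝ) 1)

theorem packOp_apply (i σ : Fin 2) (y : L2) (n : Site) : packOp d θ hγ i σ y n =
    if n.1 = i ∧ n.2.2 = σ then γ * pointEval (γ • sitePos d θ n) y else 0 := rfl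

theorem norm_packOp_le (i σ : Fin 2) (y : L2) : ‖packOp d θ hγ i σ y‖ ≤ sampBound * ‖y‖ :=
  (packOp d θ hγ i σ).le_of_opNorm_le (LinearMap.mkContinuous_norm_le _ sampBound_nonneg _) y

/-- Multiplication by the plane wave with frequency `k` at the sites. -/
def phaseOp (k : Plane) : TBSpace →L[ℂ] TBSpace :=
  LinearMap.mkContinuous
    { toFun := fun ψ => ⟨fun n => echar (inner ℝ k (sitePos d θ n)) * ψ n,
        memlp_two_of_summable (by
          simpa only [norm_mul, norm_echar, one_mul] using TBSpace.summable_sq ψ)⟩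
      map_add' := fun u v => by
        ext n
        simp only [lp.coeFn_add, Pi.add_apply, mul_add]
      map_smul' := fun c v => by
        ext n
        simp only [lp.coeFn_smul, Pi.smul_apply, RingHom.id_apply, smul_eq_mul, mul_left_comm] }
    1 fun ψ => by
      rw [one_mul]
      refine (pow_le_pow_iff_left₀ (norm_nonneg _) (norm_nonneg _) two_ne_zero).1 ?_
      rw [TBSpace.norm_sq_eq, TBSpace.norm_sq_eq]
      refine le_of_eq (tsum_congr fun n => ?_)
      change ‖echar (inner ℝ k (sitePos d θ n)) * ψ n‖ ^ 2 = ‖ψ n‖ ^ 2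
      rw [norm_mul, norm_echar, one_mul]

theorem phaseOp_apply (k : Plane) (ψ : TBSpace) (n : Site) :
    phaseOp d θ k ψ n = echar (inner ℝ k (sitePos d θ n)) * ψ n := rfl

theorem norm_phaseOp_le (k : Plane) (ψ : TBSpace) : ‖phaseOp d θ k ψ‖ ≤ ‖ψ‖ := by
  have := (phaseOp d θ k).le_of_opNorm_le (LinearMap.mkContinuous_norm_le _ zero_le_one _) ψ
  rwa [one_mul] at this

/-- The coordinates of the Dirac point `κ`. -/
def diracCoord : Fin 2 → ℝ := ![1 / 3, -1 / 3]

/-- The frequencies of the Dirac points `κ_i + G` of layer `i`. -/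
def diracFreq (i : Fin 2) (k : Fin 2 → ℤ) : Plane := dualPt θ i (diracCoord + intVec k)

/-- From κ = (b₁ − b₂)/3, the origin of the coordinates (1/3, −1/3). -/
theorem diracFreq_zero (i : Fin 2) : diracFreq θ i 0 = (2 * Real.pi)⁻¹ • layerDiracPt θ i := by
  rw [diracFreq, dualPt, layerDiracPt, ← rot_smul]
  congr 1
  have h0 : (diracCoord + intVec 0) 0 = 1 / 3 := by simp [diracCoord, intVec]
  have h1 : (diracCoord + intVec 0) 1 = -1 / 3 := by simp [diracCoord, intVec]
  apply Plane.ext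
  · rw [recipPt_zero, h0, h1]
    simp [diracPt]
    field_simp
    norm_num
  · rw [recipPt_one, h0, h1]
    simp [diracPt]
    norm_num

/-- The wave packet operator. -/
def waveOp : Envelope →L[ℂ] TBSpace :=
  ∑ i : Fin 2, ∑ σ : Fin 2, phaseOp d θ (diracFreq θ i 0) ∘L packOp d θ hγ i σ ∘L
    (ContinuousLinearMap.proj σ) ∘L
    (ContinuousLinearMap.proj (R := ℂ) (φ := fun _ : Fin 2 => Fin 2 → L2) i)

theorem waveOp_apply (y : Envelope) : waveOp d θ hγ y =
    ∑ i : Fin 2, ∑ σ : Fin 2, phaseOp d θ (diracFreq θ i 0) (packOp d θ hγ i σ (y i σ)) := by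
  simp only [waveOp, sum_apply]
  rfl

theorem sum_block (f : Fin 2 → Fin 2 → Site → ℂ) (n : Site)
    (h : ∀ i σ, ¬(n.1 = i ∧ n.2.2 = σ) → f i σ n = 0) :
    ∑ i : Fin 2, ∑ σ : Fin 2, f i σ n = f n.1 n.2.2 n := by
  rw [Finset.sum_eq_single n.1, Finset.sum_eq_single n.2.2]
  · exact fun σ _ hσ => h _ _ fun h => hσ h.2.symm
  · simp
  · exact fun i _ hi => Finset.sum_eq_zero fun σ _ => h _ _ fun h => hi h.1.symm
  · simp

theorem waveOp_apply_site (y : Envelope) (n : Site) : waveOp d θ hγ y n =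
    echar (inner ℝ (diracFreq θ n.1 0) (sitePos d θ n)) *
      (γ * pointEval (γ • sitePos d θ n) (y n.1 n.2.2)) := by
  rw [waveOp_apply]
  simp only [lp.coeFn_sum, Finset.sum_apply]
  rw [sum_block (fun i σ => ⇑(phaseOp d θ (diracFreq θ i 0) (packOp d θ hγ i σ (y i σ)))) n]
  · rw [phaseOp_apply, packOp_apply, if_pos ⟨rfl, rfl⟩]
  · intro i σ h
    simp only [phaseOp_apply, packOp_apply, if_neg h, mul_zero]

/-- The wave packet operator gives the wave packets. -/
theorem wavePacket_eq (y : Envelope) (n : Site) :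
    wavePacket d θ γ (envFourierInv ((scaleOp ^ 2) y)) n = waveOp d θ hγ y n := by
  rw [wavePacket, envFourierInv_apply, scaleOp_pow_apply, contRep_fourierInv, waveOp_apply_site,
    diracFreq_zero, real_inner_smul_left]
  rw [show Complex.exp (Complex.I * (inner ℝ (layerDiracPt θ n.1) (sitePos d θ n) : ℝ)) =
    echar ((2 * Real.pi)⁻¹ * inner ℝ (layerDiracPt θ n.1) (sitePos d θ n)) from ?_]
  · ring
  · rw [echar]
    congr 1
    push_cast
    have := Real.pi_ne_zero
    have h : (Real.pi : ℂ) ≠ 0 := Complex.ofReal_ne_zero.2 this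
    field_simp

end packet

/-! ### The intralayer Hamiltonian on wave packets -/

/-- The vectors from an `A` site to its neighbours. -/
def bondVec (j : Fin 3) : Plane :=
  siteShift 1 - ((bondOffset j).1 : ℝ) • latticeVec 0 - ((bondOffset j).2 : ℝ) • latticeVec 1

/-- The vectors from a site of layer `i` and sublattice `σ` to its neighbours. -/
def layerBond (θ : ℝ) (i σ : Fin 2) (j : Fin 3) : Plane :=
  rot (layerAngle θ i) (if σ = 0 then bondVec j else -bondVec j)

theorem sitePos_eq_rot (d : Plane) (θ : ℝ) (n : Site) : sitePos d θ n = rot (layerAngle θ n.1)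
    ((n.2.1.1 : ℝ) • latticeVec 0 + (n.2.1.2 : ℝ) • latticeVec 1 +
      (siteShift n.2.2 + (![-1 / 2, 1 / 2] n.1 : ℝ) • d)) := by
  rw [rot_add, rot_add, rot_smul, rot_smul]
  rfl

theorem sitePos_neighbour (d : Plane) (θ : ℝ) (j : Fin 3) (n : Site) :
    sitePos d θ (neighbour j n) = sitePos d θ n + layerBond θ n.1 n.2.2 j := by
  have h : (neighbour j n).1 = n.1 := by unfold neighbour; split_ifs <;> rfl
  rw [sitePos_eq_rot, sitePos_eq_rot, layerBond, h, ← rot_add]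
  congr 1
  obtain ⟨i, m, σ⟩ := n
  have h0 : siteShift 0 = 0 := rfl
  fin_cases σ
  · simp only [neighbour, bondVec, Fin.zero_eta, if_true, Prod.fst_sub, Prod.snd_sub, h0]
    push_cast
    module
  · simp only [neighbour, bondVec, Fin.mk_one, one_ne_zero, if_false, Prod.fst_add, Prod.snd_add, h0]
    push_cast
    module

/-- The symbol of the intralayer Hamiltonian on wave packets. -/
def intraSymbol (θ γ : ℝ) (i σ : Fin 2) (ξ : Plane) : ℂ :=
  (-(2 / Real.sqrt 3 : ℝ) : ℂ) * ∑ j : Fin 3,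
    echar (inner ℝ (diracFreq θ i 0 + γ • ξ) (layerBond θ i σ j))

theorem isMultiplier_echar {g : Plane → ℝ} (hg : Continuous g) :
    IsMultiplier (fun ξ => echar (g ξ)) 1 := isMultiplier_planeChar hg

theorem mulOp_sum {ι : Type*} (s : Finset ι) {m : ι → Plane → ℂ} {C : ℝ}
    (h : ∀ j, IsMultiplier (m j) C) (v : L2) :
    mulOp (fun ξ => ∑ j ∈ s, m j ξ) v = ∑ j ∈ s, mulOp (m j) v := by
  have hs : ∀ s : Finset ι, ∃ C', IsMultiplier (fun ξ => ∑ j ∈ s, m j ξ) C' := fun s => by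
    refine ⟨∑ j ∈ s, C, Finset.measurable_fun_sum s fun j _ => (h j).meas, fun ξ => ?_⟩
    exact (norm_sum_le _ _).trans (Finset.sum_le_sum fun j _ => (h j).le ξ)
  classical
  induction s using Finset.induction_on with
  | empty => simpa using mulOp_const 0 v
  | insert a s ha ih =>
    obtain ⟨C', h'⟩ := hs s
    simp only [Finset.sum_insert ha]
    rw [mulOp_add (h a) h', ih]

theorem pointEval_add (X : Plane) (u v : L2) :
    pointEval X (u + v) = pointEval X u + pointEval X v := by
  simp only [pointEval_eq_inner, inner_add_right]

theorem pointEval_smul (X : Plane) (c : ℂ) (v : L2) :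
    pointEval X (c • v) = c * pointEval X v := by
  simp only [pointEval_eq_inner, inner_smul_right]

theorem pointEval_sum {ι : Type*} (s : Finset ι) (X : Plane) (v : ι → L2) :
    pointEval X (∑ j ∈ s, v j) = ∑ j ∈ s, pointEval X (v j) := by
  simp only [pointEval_eq_inner, inner_sum]

theorem isMultiplier_bondTerm (θ γ : ℝ) (i σ : Fin 2) (j : Fin 3) :
    IsMultiplier (fun ξ => echar (inner ℝ (diracFreq θ i 0 + γ • ξ) (layerBond θ i σ j))) 1 :=
  isMultiplier_echar (by fun_prop)

theorem isMultiplier_intraSymbol (θ γ : ℝ) (i σ : Fin 2) :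
    ∃ C, IsMultiplier (intraSymbol θ γ i σ) C :=
  ⟨_, IsMultiplier.const_mul (C := 3) _ ⟨Finset.measurable_fun_sum _ fun j _ =>
    (isMultiplier_bondTerm θ γ i σ j).meas, fun ξ => (norm_sum_le _ _).trans (by simp [norm_echar])⟩⟩

section packet

variable (d : Plane) (θ : ℝ) {γ : ℝ} (hγ : γ ∈ Ioc (0 : ℝ) 1)

/-- A step along a bond multiplies the carrier wave by a phase and translates the envelope by γ
times the bond, which is a multiplier in momentum space. Bonds exchange the sublattices, hence
`σ.rev`. -/
theorem intraOp_waveOp (y : Envelope) : intraOp (waveOp d θ hγ y) =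
    waveOp d θ hγ fun i σ => mulOp (intraSymbol θ γ i σ) (y i σ.rev) := by
  apply lp.ext
  funext n
  rw [intraOp_apply, waveOp_apply_site]
  have h1 : ∀ j, (neighbour j n).1 = n.1 := fun j => by unfold neighbour; split_ifs <;> rfl
  have h2 : ∀ j, (neighbour j n).2.2 = n.2.2.rev := fun j => by
    obtain ⟨i, m, σ⟩ := n
    fin_cases σ <;> rfl
  simp only [waveOp_apply_site, sitePos_neighbour, h1, h2]
  unfold intraSymbol
  rw [mulOp_const_mul _ (C := 3) ⟨Finset.measurable_fun_sum _ fun j _ =>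
      (isMultiplier_bondTerm θ γ n.1 n.2.2 j).meas, fun ξ => (norm_sum_le _ _).trans
        (by simp [norm_echar])⟩,
    mulOp_sum _ fun j => isMultiplier_bondTerm θ γ n.1 n.2.2 j, pointEval_smul, pointEval_sum]
  rw [show ∀ a b c e : ℂ, a * (b * (c * e)) = c * (a * (b * e)) from fun _ _ _ _ => by ring]
  simp only [Finset.mul_sum]
  refine Finset.sum_congr rfl fun j _ => ?_
  have e : (fun ξ => echar (inner ℝ (diracFreq θ n.1 0 + γ • ξ) (layerBond θ n.1 n.2.2 j))) =
      fun ξ => echar (inner ℝ (diracFreq θ n.1 0) (layerBond θ n.1 n.2.2 j)) *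
        echar (inner ℝ ξ (γ • layerBond θ n.1 n.2.2 j)) := by
    funext ξ
    rw [← echar_add, inner_add_left, real_inner_smul_left, inner_smul_right]
  rw [e, mulOp_const_mul _ (isMultiplier_echar (by fun_prop)), pointEval_smul,
    ← pointEval_add_point, smul_add, inner_add_right, echar_add]
  ring

end packet

/-! ### The interlayer Hamiltonian on wave packets -/

namespace HoppingAssumption

variable {hs : ℝ → ℝ} {C₁ C₂ C₃ D₁ D₂ ℓ₀ : ℝ} (hh : HoppingAssumption hs C₁ C₂ C₃ D₁ D₂ ℓ₀)
variable {ℓ : ℝ} (hℓ : ℓ₀ ≤ ℓ)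
include hh hℓ

theorem isMultiplier_hopSymbol (a : Plane) (γ : ℝ) :
    IsMultiplier (fun ζ => hopSymbol hs ℓ (a + γ • ζ)) C₂ := by
  have h := hh.continuous_hopSymbol hℓ
  refine ⟨Continuous.measurable (by fun_prop), fun ζ => (hh.norm_hopSymbol_le hℓ _).trans ?_⟩
  refine mul_le_of_le_one_right hh.C₂_pos.le (Real.exp_le_one_iff.2 ?_)
  have := mul_nonneg (mul_pos hh.D₂_pos hh.ℓ₀_pos).le (norm_nonneg (a + γ • ζ))
  linarith

/-- One term of the Poisson sum: translation by G moves the packet from momentum k to k − G, the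
weights cancel the factor jap⁴ of `interSymbol`, and the substitution ξ = k − G + γζ returns to the
scale of the envelope. -/
theorem inner_interSymbol_evalVec {γ : ℝ} (hγ : 0 < γ) (X k G : Plane) {y z : L2}
    (hz : ∀ᵐ η, jw η ^ 2 * z η = (γ⁻¹ : ℂ) * (jw (γ⁻¹ • (η - k)) ^ 2 * y (γ⁻¹ • (η - k)))) :
    inner ℂ (mulOp (fun ξ => jw ξ ^ 2) (mulOp (interSymbol hs ℓ) (evalVec X)))
      (transOp G (mulOp (fun ξ => jw ξ ^ 2) z)) = (Real.sqrt 3 / 2 : ℝ) *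
        (echar (inner ℝ (k - G) X) * (γ * pointEval (γ • X)
          (mulOp (fun ζ => hopSymbol hs ℓ (k - G + γ • ζ)) y))) := by
  obtain ⟨C, hC⟩ := hh.isMultiplier_interSymbol hℓ
  have hG := (measurePreserving_add_right (volume : Measure Plane) G).quasiMeasurePreserving
  have e1 : inner ℂ (mulOp (fun ξ => jw ξ ^ 2) (mulOp (interSymbol hs ℓ) (evalVec X)))
      (transOp G (mulOp (fun ξ => jw ξ ^ 2) z)) = ∫ η, (fun ζ : Plane =>
        (Real.sqrt 3 / 2 : ℝ) * hopSymbol hs ℓ (k - G + γ • ζ) * echar (inner ℝ (k - G + γ • ζ) X) *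
          ((γ⁻¹ : ℂ) * (jw ζ ^ 2 * y ζ))) (γ⁻¹ • (η - (k - G))) := by
    rw [L2.inner_def]
    apply integral_congr_ae
    filter_upwards [coeFn_mulOp (isMultiplier_jw_pow 2) (mulOp (interSymbol hs ℓ) (evalVec X)),
      coeFn_mulOp hC (evalVec X), coeFn_evalVec X, coeFn_transOp G (mulOp (fun ξ => jw ξ ^ 2) z),
      hG.ae (coeFn_mulOp (isMultiplier_jw_pow 2) z), hG.ae hz] with ξ h1 h2 h3 h4 h5 h6
    change evalVec X ξ = echar (-inner ℝ ξ X) * jw ξ ^ 2 at h3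
    rw [RCLike.inner_apply, h1, h2, h3, h4, h5, h6, smul_smul, mul_inv_cancel₀ hγ.ne', one_smul,
      map_mul, map_mul, map_mul, map_pow, conj_jw, conj_interSymbol, conj_echar, neg_neg,
      interSymbol]
    have e2 : ξ - (k - G) = ξ + G - k := by abel
    have e3 : k - G + (ξ + G - k) = ξ := by abel
    rw [e2, e3]
    have := jw_mul_jap ξ
    push_cast
    linear_combination (Real.sqrt 3 / 2 * hopSymbol hs ℓ ξ * echar (inner ℝ ξ X) * ((γ⁻¹ : ℂ) *
      (jw (γ⁻¹ • (ξ + G - k)) ^ 2 * y (γ⁻¹ • (ξ + G - k))))) *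
      ((jw ξ * jap ξ) ^ 3 + (jw ξ * jap ξ) ^ 2 + jw ξ * jap ξ + 1) * this
  have e2 := integral_comp_rescale hγ (k - G) (fun ζ : Plane =>
    (Real.sqrt 3 / 2 : ℝ) * hopSymbol hs ℓ (k - G + γ • ζ) * echar (inner ℝ (k - G + γ • ζ) X) *
      ((γ⁻¹ : ℂ) * (jw ζ ^ 2 * y ζ)))
  refine e1.trans (e2.trans ?_)
  rw [pointEval_echar, ← integral_const_mul, ← integral_const_mul, ← integral_const_mul,
    ← integral_const_mul]
  apply integral_congr_ae
  filter_upwards [coeFn_mulOp (hh.isMultiplier_hopSymbol hℓ (k - G) γ) y] with ζ h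
  rw [h, inner_add_left (k - G), echar_add, real_inner_smul_left, inner_smul_right]
  have : (γ : ℂ) ≠ 0 := Complex.ofReal_ne_zero.2 hγ.ne'
  field_simp

/-- On the sites of one sublattice the packet coincides with a function sampled at unit scale
(`exists_lift`), so the lattice sum is an inner product of samples and Poisson summation applies.
The result is a sum over the Dirac points κ_j + G, with amplitudes ĥ. -/
theorem interOp_waveOp (d : Plane) (θ : ℝ) {γ : ℝ} (hγ : γ ∈ Ioc (0 : ℝ) 1) (y : Envelope)
    (n : Site) : interOp hs d θ ℓ (waveOp d θ hγ y) n = ∑ σ' : Fin 2, ∑' k : Fin 2 → ℤ,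
      echar (-inner ℝ (dualPt θ n.1.rev (intVec k)) (layerSiteShift d θ n.1.rev σ')) *
        (echar (inner ℝ (diracFreq θ n.1.rev k) (sitePos d θ n)) *
          (γ * pointEval (γ • sitePos d θ n)
            (mulOp (fun ζ => hopSymbol hs ℓ (diracFreq θ n.1.rev k + γ • ζ)) (y n.1.rev σ')))) := by
  obtain ⟨C, hC⟩ := hh.isMultiplier_interSymbol hℓ
  rw [interOp_apply]
  refine Finset.sum_congr rfl fun σ' _ => ?_
  generalize n.1.rev = i, sitePos d θ n = X
  obtain ⟨z, -, hz, hz'⟩ := exists_lift hγ.1 hγ.2 (diracFreq θ i 0) (y i σ')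
  have hM : ∀ u v : L2, inner ℂ u (mulOp (interSymbol hs ℓ) v) =
      inner ℂ (mulOp (interSymbol hs ℓ) u) v := fun u v => by
    rw [inner_mulOp_left hC]
    simp only [conj_interSymbol]
  have hW : inner ℂ (sampOp d θ i σ' (mulOp (interSymbol hs ℓ) (evalVec X))) (waveOp d θ hγ y) =
      inner ℂ (sampOp d θ i σ' (mulOp (interSymbol hs ℓ) (evalVec X))) (sampOp d θ i σ' z) := by
    refine (inner_sampOp_left d θ i σ' _ _).unique
      ((inner_sampOp_left d θ i σ' _ _).congr_fun fun m => ?_)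
    rw [sampOp_siteAt, hz', waveOp_apply_site]
    simp only [siteAt]
    ring
  -- The summation index is negated so that the momenta read κ + G instead of κ − G.
  rw [pointEval_eq_inner, hM, ContinuousLinearMap.adjoint_inner_right, hW, inner_sampOp_sampOp,
    ← (Equiv.neg (Fin 2 → ℤ)).tsum_eq, ← tsum_mul_left]
  refine tsum_congr fun k => ?_
  have hk : dualPt θ i (intVec (-k)) = -dualPt θ i (intVec k) := by
    rw [eq_neg_iff_add_eq_zero, ← dualPt_add]
    have h0 : intVec (-k) + intVec k = 0 := by funext j; simp [intVec]
    have h1 : recipPt 0 = 0 := by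
      apply Plane.ext
      · simp [recipPt_zero]
      · simp [recipPt_one]
    rw [h0, dualPt, h1]
    simpa using rot_smul (layerAngle θ i) 0 0
  have hf : diracFreq θ i 0 - dualPt θ i (intVec (-k)) = diracFreq θ i k := by
    have h0 : diracCoord + intVec 0 = diracCoord := by funext j; simp [intVec]
    rw [hk, sub_neg_eq_add, diracFreq, diracFreq, h0, dualPt_add]
  rw [Equiv.neg_apply, hh.inner_interSymbol_evalVec hℓ hγ.1 X (diracFreq θ i 0) _ hz, hf, hk,
    inner_neg_left]
  have hs3 : ((2 / Real.sqrt 3 : ℝ) : ℂ) * ((Real.sqrt 3 / 2 : ℝ) : ℂ) = 1 := by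
    rw [← Complex.ofReal_mul, div_mul_div_cancel₀' (by positivity), div_self (by positivity),
      Complex.ofReal_one]
  change ((2 / Real.sqrt 3 : ℝ) : ℂ) * (echar (-inner ℝ (dualPt θ i (intVec k))
    (layerSiteShift d θ i σ')) * _) = _
  linear_combination (echar (-inner ℝ (dualPt θ i (intVec k)) (layerSiteShift d θ i σ')) *
    (echar (inner ℝ (diracFreq θ i k) X) * (γ * pointEval (γ • X)
      (mulOp (fun ζ => hopSymbol hs ℓ (diracFreq θ i k + γ • ζ)) (y i σ'))))) * hs3

end HoppingAssumption

/-! ### The three momentum hops -/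

/-- The coordinates of the reciprocal lattice vectors `0`, `b_2`, `-b_1`. -/
def ringVec : Fin 3 → Fin 2 → ℤ := ![![0, 0], ![0, 1], ![-1, 0]]

theorem ringVec_injective : Function.Injective ringVec := by
  intro m n h
  have h0 := congrFun h 0
  have h1 := congrFun h 1
  fin_cases m <;> fin_cases n <;> simp_all [ringVec]

theorem intVec_zero : intVec 0 = 0 := by funext j; simp [intVec]

theorem recipPt_zero' : recipPt 0 = 0 := by
  apply Plane.ext
  · simp [recipPt_zero]
  · simp [recipPt_one]

theorem rot_zero (ζ : ℝ) : rot ζ 0 = 0 := by simpa using rot_smul ζ 0 0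

theorem dualPt_zero (θ : ℝ) (i : Fin 2) : dualPt θ i 0 = 0 := by
  rw [dualPt, recipPt_zero', rot_zero]

theorem diracFreq_eq_add (θ : ℝ) (i : Fin 2) (k : Fin 2 → ℤ) :
    diracFreq θ i k = diracFreq θ i 0 + dualPt θ i (intVec k) := by
  rw [diracFreq, diracFreq, intVec_zero, add_zero, dualPt_add]

theorem layerRecipVec_one (θ : ℝ) (i : Fin 2) :
    layerRecipVec θ i 1 = (2 * Real.pi) • dualPt θ i (intVec (ringVec 1)) := by
  rw [layerRecipVec, dualPt, ← rot_smul]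
  congr 1
  have h : Real.sqrt 3 ≠ 0 := by positivity
  have h3 := Real.sq_sqrt (show (0 : ℝ) ≤ 3 by norm_num)
  apply Plane.ext
  · simp only [recipVec, bondLength, PiLp.smul_apply, recipPt_zero, intVec, ringVec, smul_eq_mul,
      Matrix.cons_val_zero, Matrix.cons_val_one]
    push_cast
    field_simp
    linear_combination (-4 : ℝ) * h3
  · simp only [recipVec, bondLength, PiLp.smul_apply, recipPt_one, intVec, ringVec, smul_eq_mul,
      Matrix.cons_val_zero, Matrix.cons_val_one]
    push_cast
    field_simp
    linear_combination (4 : ℝ) * h3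

theorem layerRecipVec_zero (θ : ℝ) (i : Fin 2) :
    layerRecipVec θ i 0 = -((2 * Real.pi) • dualPt θ i (intVec (ringVec 2))) := by
  rw [layerRecipVec, dualPt, ← rot_smul, ← rot_neg]
  congr 1
  have h : Real.sqrt 3 ≠ 0 := by positivity
  have h3 := Real.sq_sqrt (show (0 : ℝ) ≤ 3 by norm_num)
  apply Plane.ext
  · simp only [recipVec, bondLength, PiLp.smul_apply, PiLp.neg_apply, recipPt_zero, intVec, ringVec,
      smul_eq_mul, Matrix.cons_val_zero, Matrix.cons_val_one, Matrix.cons_val]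
    push_cast
    field_simp
    linear_combination (4 : ℝ) * h3
  · simp only [recipVec, bondLength, PiLp.smul_apply, PiLp.neg_apply, recipPt_one, intVec, ringVec,
      smul_eq_mul, Matrix.cons_val_zero, Matrix.cons_val_one, Matrix.cons_val]
    push_cast
    field_simp
    linear_combination (4 : ℝ) * h3

theorem layerDiracPt_eq (θ : ℝ) (i : Fin 2) :
    layerDiracPt θ i = (2 * Real.pi) • diracFreq θ i 0 := by
  rw [diracFreq_zero, smul_smul, mul_inv_cancel₀ (by positivity), one_smul]

theorem momentumShift_eq (θ : ℝ) (m : Fin 3) : momentumShift θ m =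
    (2 * Real.pi) • (diracFreq θ 0 (ringVec m) - diracFreq θ 1 (ringVec m)) := by
  rw [diracFreq_eq_add, diracFreq_eq_add θ 1]
  have h0 : intVec (ringVec 0) = 0 := by funext j; fin_cases j <;> simp [intVec, ringVec]
  fin_cases m
  · simp only [momentumShift, layerDiracPt_eq, Fin.zero_eta, h0, dualPt_zero, Matrix.cons_val]
    module
  · simp only [momentumShift, layerDiracPt_eq, layerRecipVec_one, Fin.mk_one, Matrix.cons_val]
    module
  · simp only [momentumShift, layerDiracPt_eq, layerRecipVec_zero, Fin.reduceFinMk, Matrix.cons_val]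
    module

theorem hoppingMatrix_eq (d : Plane) (θ : ℝ) (m : Fin 3) (σ σ' : Fin 2) :
    hoppingMatrix d θ m σ σ' =
      echar (inner ℝ (dualPt θ 0 (intVec (ringVec m))) (layerSiteShift d θ 0 σ) -
        inner ℝ (dualPt θ 1 (intVec (ringVec m))) (layerSiteShift d θ 1 σ')) := by
  have h0 : intVec (ringVec 0) = 0 := by funext j; fin_cases j <;> simp [intVec, ringVec]
  fin_cases m
  · simp [hoppingMatrix, h0, dualPt_zero, echar_zero]
  · simp only [hoppingMatrix, layerRecipVec_one, Fin.mk_one, Matrix.cons_val, real_inner_smul_left,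
      echar]
    congr 1
    push_cast
    ring
  · simp only [hoppingMatrix, layerRecipVec_zero, Fin.reduceFinMk, Matrix.cons_val, inner_neg_left,
      real_inner_smul_left, echar]
    congr 1
    push_cast
    ring

theorem fin_two_eq_one {i : Fin 2} (h : i ≠ 0) : i = 1 := by
  fin_cases i
  · exact absurd rfl h
  · rfl

/-- Conjugation negates the phase and so exchanges the roles of the layers; one formula covers both
off-diagonal blocks. -/
theorem couplingCoeff_bmCoeff (lam₀ : ℝ) (d : Plane) (θ : ℝ) (i : Fin 2) (m : Fin 3) (σ σ' : Fin 2) :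
    couplingCoeff (bmCoeff lam₀ d θ) i m σ σ' = lam₀ *
      echar (inner ℝ (dualPt θ i (intVec (ringVec m))) (layerSiteShift d θ i σ) -
        inner ℝ (dualPt θ i.rev (intVec (ringVec m))) (layerSiteShift d θ i.rev σ')) := by
  unfold couplingCoeff
  split_ifs with h
  · subst h
    rw [bmCoeff, hoppingMatrix_eq]; rfl
  · obtain rfl := fin_two_eq_one h
    rw [bmCoeff, hoppingMatrix_eq, map_mul, Complex.conj_ofReal, conj_echar, neg_sub]; rfl

theorem norm_bmCoeff (lam₀ : ℝ) (h : 0 ≤ lam₀) (d : Plane) (θ : ℝ) (m : Fin 3) (σ σ' : Fin 2) :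
    ‖bmCoeff lam₀ d θ m σ σ'‖ = lam₀ := by
  rw [bmCoeff, hoppingMatrix_eq, norm_mul, norm_echar, mul_one, Complex.norm_real,
    Real.norm_of_nonneg h]

theorem couplingShift_bmShift (θ γ : ℝ) (i : Fin 2) (m : Fin 3) : couplingShift (bmShift θ γ) i m =
    γ⁻¹ • (diracFreq θ i (ringVec m) - diracFreq θ i.rev (ringVec m)) := by
  have h : bmShift θ γ m = γ⁻¹ • (diracFreq θ 0 (ringVec m) - diracFreq θ 1 (ringVec m)) := by
    rw [bmShift, momentumShift_eq, smul_comm γ⁻¹, smul_smul, inv_mul_cancel₀ (by positivity),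
      one_smul]
  unfold couplingShift
  split_ifs with hi
  · subst hi
    rw [h]; rfl
  · obtain rfl := fin_two_eq_one hi
    rw [h, ← smul_neg, neg_sub]; rfl

/-- The phases of the interlayer Hamiltonian. -/
def interPhase (d : Plane) (θ : ℝ) (i σ : Fin 2) (k : Fin 2 → ℤ) : ℂ :=
  echar (-inner ℝ (dualPt θ i (intVec k)) (layerSiteShift d θ i σ))

theorem sitePos_eq_siteAt (d : Plane) (θ : ℝ) (n : Site) : sitePos d θ n =
    ((n.2.1.1 : ℝ) • layerLatticeVec θ n.1 0 + (n.2.1.2 : ℝ) • layerLatticeVec θ n.1 1) +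
      layerSiteShift d θ n.1 n.2.2 := rfl

/-- A reciprocal vector divided by 2π pairs with lattice vectors to integers, so on the sites of a
layer its plane wave depends on the sublattice only. -/
theorem echar_dualPt_sitePos (d : Plane) (θ : ℝ) (k : Fin 2 → ℤ) (n : Site) :
    echar (inner ℝ (dualPt θ n.1 (intVec k)) (sitePos d θ n)) =
      echar (inner ℝ (dualPt θ n.1 (intVec k)) (layerSiteShift d θ n.1 n.2.2)) := by
  rw [sitePos_eq_siteAt, inner_add_right, inner_dualPt, echar_add]
  have : (n.2.1.1 : ℝ) * intVec k 0 + (n.2.1.2 : ℝ) * intVec k 1 =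
      ((n.2.1.1 * k 0 + n.2.1.2 * k 1 : ℤ) : ℝ) := by
    simp [intVec]
  rw [this, echar_intCast, one_mul]

section ring

variable (lam₀ : ℝ) (d : Plane) (θ : ℝ) {γ : ℝ} (hγ : γ ∈ Ioc (0 : ℝ) 1)

/-- The coupling of the Bistritzer-MacDonald Hamiltonian on wave packets. -/
theorem waveOp_couplingOp (y : Envelope) (n : Site) :
    (γ • waveOp d θ hγ (couplingOp (bmCoeff lam₀ d θ) (bmShift θ γ) 2 y) : TBSpace) n =
      ∑ σ' : Fin 2, ∑ m : Fin 3, interPhase d θ n.1.rev σ' (ringVec m) *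
        (echar (inner ℝ (diracFreq θ n.1.rev (ringVec m)) (sitePos d θ n)) *
          (γ * (lam₀ * γ * pointEval (γ • sitePos d θ n) (y n.1.rev σ')))) := by
  rw [lp.coeFn_smul, Pi.smul_apply, waveOp_apply_site, couplingOp_apply, pointEval_sum,
    Complex.real_smul]
  simp only [pointEval_sum, pointEval_smul, pointEval_shiftOp, Finset.mul_sum]
  refine Finset.sum_congr rfl fun σ' _ => Finset.sum_congr rfl fun m _ => ?_
  rw [couplingCoeff_bmCoeff, couplingShift_bmShift, real_inner_smul_left, inner_smul_right,
    inv_mul_cancel_left₀ hγ.1.ne', interPhase]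
  have h := echar_dualPt_sitePos d θ (ringVec m) n
  -- On the sites, the carrier wave of one layer, the phase of T_n and the modulation by 𝔰_n combine
  -- to the plane wave at the Dirac point κ_j + G_n of the other layer.
  have e : echar (inner ℝ (diracFreq θ n.1 0) (sitePos d θ n)) *
      (echar (inner ℝ (dualPt θ n.1 (intVec (ringVec m))) (layerSiteShift d θ n.1 n.2.2) -
        inner ℝ (dualPt θ n.1.rev (intVec (ringVec m))) (layerSiteShift d θ n.1.rev σ')) *
      echar (-inner ℝ (diracFreq θ n.1 (ringVec m) - diracFreq θ n.1.rev (ringVec m))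
        (sitePos d θ n))) =
      echar (-inner ℝ (dualPt θ n.1.rev (intVec (ringVec m))) (layerSiteShift d θ n.1.rev σ')) *
        echar (inner ℝ (diracFreq θ n.1.rev (ringVec m)) (sitePos d θ n)) := by
    rw [sub_eq_add_neg (inner ℝ _ _ : ℝ), echar_add, ← h, diracFreq_eq_add θ n.1 (ringVec m),
      inner_sub_left, inner_add_left]
    simp only [← echar_add]
    congr 1
    ring
  linear_combination (γ * (lam₀ * γ) * pointEval (γ • sitePos d θ n) (y n.1.rev σ')) * e

end ring

/-- The symbols of the part of the interlayer Hamiltonian on wave packets that is not captured by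
the Bistritzer-MacDonald Hamiltonian. -/
def interResidual (hs : ℝ → ℝ) (lam₀ θ ℓ γ : ℝ) (i : Fin 2) (k : Fin 2 → ℤ) (ζ : Plane) : ℂ :=
  (hopSymbol hs ℓ (diracFreq θ i k + γ • ζ) -
    if k ∈ Finset.univ.image ringVec then (lam₀ * γ : ℂ) else 0) * jw ζ ^ 4

theorem norm_tsum_le_of_bound {F : Type*} [NormedAddCommGroup F] [CompleteSpace F] {ι : Type*}
    {f : ι → F} {B : ι → ℝ} (hB : Summable B) (h : ∀ k, ‖f k‖ ≤ B k) :
    Summable f ∧ ‖∑' k, f k‖ ≤ ∑' k, B k :=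
  ⟨Summable.of_norm_bounded hB h, tsum_of_norm_bounded hB.hasSum h⟩

theorem hasSum_lp_apply {ι : Type*} {f : ι → TBSpace} {a : TBSpace} (h : HasSum f a) (n : Site) :
    HasSum (fun k => f k n) (a n) :=
  h.mapL (lp.evalCLM ℂ (fun _ : Site => ℂ) 2 n)

namespace HoppingAssumption

variable {hs : ℝ → ℝ} {C₁ C₂ C₃ D₁ D₂ ℓ₀ : ℝ} (hh : HoppingAssumption hs C₁ C₂ C₃ D₁ D₂ ℓ₀)
variable {ℓ : ℝ} (hℓ : ℓ₀ ≤ ℓ)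
include hh hℓ

/-- Subtracting the Bistritzer-MacDonald coupling from the Poisson sum changes only its three ring
terms. Each difference is a wave packet with multiplier `interResidual`, into which four weights of
the envelope are absorbed, and summability of `B` gives norm convergence. The 8 counts the triples
(i, σ, σ'). -/
theorem exists_inter_residual (lam₀ : ℝ) (d : Plane) (θ : ℝ) {γ : ℝ} (hγ : γ ∈ Ioc (0 : ℝ) 1)
    {B : (Fin 2 → ℤ) → ℝ} (hB : Summable B)
    (hres : ∀ i k, IsMultiplier (interResidual hs lam₀ θ ℓ γ i k) (B k)) (v : Envelope) :
    ‖interOp hs d θ ℓ (waveOp d θ hγ ((scaleOp ^ 4) v)) -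
      γ • waveOp d θ hγ (couplingOp (bmCoeff lam₀ d θ) (bmShift θ γ) 2 ((scaleOp ^ 4) v))‖ ≤
      8 * (sampBound * (∑' k, B k) * ‖v‖) := by
  set r : Fin 2 → Fin 2 → Fin 2 → (Fin 2 → ℤ) → TBSpace := fun i σ σ' k =>
    interPhase d θ i.rev σ' k • phaseOp d θ (diracFreq θ i.rev k) (packOp d θ hγ i σ
      (mulOp (interResidual hs lam₀ θ ℓ γ i.rev k) (v i.rev σ'))) with hr
  have hrB : ∀ i σ σ' k, ‖r i σ σ' k‖ ≤ B k * (sampBound * ‖v‖) := by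
    intro i σ σ' k
    have hBk := (hres i.rev k).nonneg
    rw [hr, norm_smul, interPhase, norm_echar, one_mul]
    refine (norm_phaseOp_le d θ _ _).trans ((norm_packOp_le d θ hγ i σ _).trans ?_)
    refine (mul_le_mul_of_nonneg_left (norm_mulOp_le (hres i.rev k) _) sampBound_nonneg).trans ?_
    have := mul_le_mul_of_nonneg_left (norm_component_le v i.rev σ')
      (mul_nonneg sampBound_nonneg hBk)
    linarith
  have hB' : Summable fun k => B k * (sampBound * ‖v‖) := hB.mul_right _
  have hR := fun i σ σ' => norm_tsum_le_of_bound hB' (hrB i σ σ')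
  have key : interOp hs d θ ℓ (waveOp d θ hγ ((scaleOp ^ 4) v)) -
      γ • waveOp d θ hγ (couplingOp (bmCoeff lam₀ d θ) (bmShift θ γ) 2 ((scaleOp ^ 4) v)) =
      ∑ i : Fin 2, ∑ σ : Fin 2, ∑ σ' : Fin 2, ∑' k, r i σ σ' k := by
    rw [sub_eq_iff_eq_add]
    apply lp.ext
    funext n
    rw [hh.interOp_waveOp hℓ, lp.coeFn_add, Pi.add_apply, waveOp_couplingOp]
    simp only [lp.coeFn_sum, Finset.sum_apply]
    have hsum := fun i σ σ' => hasSum_lp_apply (hR i σ σ').1.hasSum n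
    rw [sum_block (fun i σ n => ∑ σ' : Fin 2, (∑' k, r i σ σ' k : TBSpace) n) n,
      ← Finset.sum_add_distrib]
    · refine Finset.sum_congr rfl fun σ' _ => ?_
      refine HasSum.tsum_eq ?_
      set g : (Fin 2 → ℤ) → ℂ := fun k => interPhase d θ n.1.rev σ' k *
        (echar (inner ℝ (diracFreq θ n.1.rev k) (sitePos d θ n)) *
          (γ * (lam₀ * γ * pointEval (γ • sitePos d θ n) ((scaleOp ^ 4) v n.1.rev σ')))) with hg
      have h1 : HasSum (fun k => if k ∈ Finset.univ.image ringVec then g k else 0)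
          (∑ m : Fin 3, g (ringVec m)) := by
        have h2 := hasSum_sum_of_ne_finset_zero (L := SummationFilter.unconditional _)
          (f := fun k => if k ∈ Finset.univ.image ringVec then g k else 0)
          (s := Finset.univ.image ringVec) fun k hk => if_neg hk
        rw [Finset.sum_image fun a _ b _ h => ringVec_injective h] at h2
        simpa using h2
      refine ((hsum n.1 n.2.2 σ').add h1).congr_fun fun k => ?_
      have hm := hh.isMultiplier_hopSymbol hℓ (diracFreq θ n.1.rev k) γ
      have h3 : mulOp (interResidual hs lam₀ θ ℓ γ n.1.rev k) (v n.1.rev σ') =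
          mulOp (fun ζ => hopSymbol hs ℓ (diracFreq θ n.1.rev k + γ • ζ))
            ((scaleOp ^ 4) v n.1.rev σ') -
          (if k ∈ Finset.univ.image ringVec then (lam₀ * γ : ℂ) else 0) •
            (scaleOp ^ 4) v n.1.rev σ' := by
        rw [scaleOp_pow_apply, ← mulOp_const, ← mulOp_sub hm (IsMultiplier.const _),
          mulOp_mulOp (hm.sub (IsMultiplier.const _)) (isMultiplier_jw_pow 4)]
        rfl
      rw [hr, lp.coeFn_smul, Pi.smul_apply, phaseOp_apply, packOp_apply, if_pos ⟨rfl, rfl⟩, h3,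
        sub_eq_add_neg, ← neg_smul, pointEval_add, pointEval_smul, smul_eq_mul]
      change interPhase d θ n.1.rev σ' k * _ = _
      split_ifs
      · rw [hg]; ring
      · ring
    · intro i σ h
      refine Finset.sum_eq_zero fun σ' _ => ?_
      refine (hsum i σ σ').unique (hasSum_zero.congr_fun fun k => ?_)
      simp only [hr, lp.coeFn_smul, Pi.smul_apply, phaseOp_apply, packOp_apply, if_neg h, mul_zero,
        smul_zero]
  rw [key]
  have h8 : ∀ i σ σ', ‖∑' k, r i σ σ' k‖ ≤ sampBound * (∑' k, B k) * ‖v‖ := fun i σ σ' => by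
    refine (hR i σ σ').2.trans (le_of_eq ?_)
    rw [tsum_mul_right]; ring
  calc ‖∑ i : Fin 2, ∑ σ : Fin 2, ∑ σ' : Fin 2, ∑' k, r i σ σ' k‖
      ≤ ∑ i : Fin 2, ∑ σ : Fin 2, ∑ σ' : Fin 2, sampBound * (∑' k, B k) * ‖v‖ :=
        norm_sum_le_of_le _ fun i _ => norm_sum_le_of_le _ fun σ _ =>
          norm_sum_le_of_le _ fun σ' _ => h8 i σ σ'
    _ = _ := by simp only [Finset.sum_const, Finset.card_univ, Fintype.card_fin]; ring

end HoppingAssumption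

/-! ### The intralayer symbol near the Dirac point -/

/-- The squared left side is (2 − 2 cos ζ)|v|², and 2 − 2 cos ζ ≤ ζ². -/
theorem norm_rot_sub_le (ζ : ℝ) (v : Plane) : ‖rot ζ v - v‖ ≤ |ζ| * ‖v‖ := by
  rw [← pow_le_pow_iff_left₀ (norm_nonneg _) (by positivity) two_ne_zero, mul_pow, sq_abs,
    norm_sq_plane, norm_sq_plane, PiLp.sub_apply, PiLp.sub_apply, rot_apply_zero, rot_apply_one]
  have h := Real.cos_sq_add_sin_sq ζ
  have h2 := Real.one_sub_sq_div_two_le_cos (x := ζ)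
  have e : (Real.cos ζ * v 0 - Real.sin ζ * v 1 - v 0) ^ 2 +
      (Real.sin ζ * v 0 + Real.cos ζ * v 1 - v 1) ^ 2 =
      (2 - 2 * Real.cos ζ) * (v 0 ^ 2 + v 1 ^ 2) := by
    linear_combination (v 0 ^ 2 + v 1 ^ 2) * h
  rw [e]
  have : 2 - 2 * Real.cos ζ ≤ ζ ^ 2 := by linarith
  gcongr

theorem norm_echar_taylor_le (x : ℝ) :
    ‖echar x - 1 - 2 * Real.pi * Complex.I * x‖ ≤ (2 * Real.pi * x) ^ 2 := by
  have hd : ∀ t : ℝ, HasDerivAt (fun t : ℝ => Complex.exp (t * Complex.I))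
      (Complex.I * Complex.exp (t * Complex.I)) t := by
    intro t
    have := ((Complex.ofRealCLM.hasDerivAt (x := t)).mul_const Complex.I).cexp
    simpa [mul_comm] using this
  have hl : ∀ s t : ℝ, ‖Complex.exp (s * Complex.I) - Complex.exp (t * Complex.I)‖ ≤ |s - t| := by
    intro s t
    have := Convex.norm_image_sub_le_of_norm_hasDerivWithin_le (C := 1) (s := univ)
      (fun u _ => (hd u).hasDerivWithinAt) (fun u _ => by
        rw [norm_mul, Complex.norm_I, Complex.norm_exp_ofReal_mul_I, one_mul]) convex_univ
      (mem_univ t) (mem_univ s)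
    simpa using this
  have h := norm_taylor_le (f := fun t : ℝ => Complex.exp (t * Complex.I))
    (f' := fun t : ℝ => Complex.I * Complex.exp (t * Complex.I)) hd (fun s t => by
      rw [← mul_sub, norm_mul, Complex.norm_I, one_mul]
      exact hl s t) 0 (2 * Real.pi * x)
  refine le_trans (le_of_eq ?_) h
  congr 1
  simp [echar]
  ring_nf

theorem bondVec_apply (j : Fin 3) : bondVec j = ![!₂[0, 1 / Real.sqrt 3],
    !₂[-1 / 2, 1 / Real.sqrt 3 - Real.sqrt 3 / 2],
    !₂[1 / 2, 1 / Real.sqrt 3 - Real.sqrt 3 / 2]] j := by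
  fin_cases j <;> apply Plane.ext <;>
    simp [bondVec, bondOffset, siteShift, latticeVec, bondLength] <;> norm_num

theorem norm_bondVec_le (j : Fin 3) : ‖bondVec j‖ ≤ 1 := by
  have h : Real.sqrt 3 ≠ 0 := by positivity
  have h3 := Real.sq_sqrt (show (0 : ℝ) ≤ 3 by norm_num)
  rw [← pow_le_pow_iff_left₀ (norm_nonneg _) zero_le_one two_ne_zero, norm_sq_plane]
  have e1 : (1 / Real.sqrt 3) ^ 2 = 1 / 3 := by rw [div_pow, h3]; norm_num
  have e2 : (1 / Real.sqrt 3 - Real.sqrt 3 / 2) ^ 2 = 1 / 12 := by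
    rw [sub_sq, e1, div_pow, h3]
    field_simp
    norm_num
  rw [bondVec_apply]
  fin_cases j
  · simp [-one_div, e1]; norm_num
  · simp [-one_div, e2]; norm_num
  · simp [-one_div, e2]; norm_num

theorem recipPt_diracCoord : recipPt (diracCoord + intVec 0) = !₂[2 / 3, 0] := by
  rw [intVec_zero, add_zero]
  apply Plane.ext
  · simp [recipPt_zero, diracCoord]; norm_num
  · simp [recipPt_one, diracCoord]; norm_num

/-- The sign of the bond vectors of a sublattice. -/
def bondSign (σ : Fin 2) : ℝ := if σ = 0 then 1 else -1

theorem layerBond_eq (θ : ℝ) (i σ : Fin 2) (j : Fin 3) :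
    layerBond θ i σ j = bondSign σ • rot (layerAngle θ i) (bondVec j) := by
  unfold layerBond bondSign
  split_ifs
  · rw [one_smul]
  · rw [rot_neg, neg_one_smul]

theorem echar_third : echar (1 / 3) = -1 / 2 + Real.sqrt 3 / 2 * Complex.I := by
  rw [echar, show (2 * Real.pi * Complex.I * ((1 / 3 : ℝ) : ℂ) : ℂ) =
    ((Real.pi - Real.pi / 3 : ℝ) : ℂ) * Complex.I by push_cast; ring, Complex.exp_mul_I,
    ← Complex.ofReal_cos, ← Complex.ofReal_sin, Real.cos_pi_sub, Real.sin_pi_sub,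
    Real.cos_pi_div_three, Real.sin_pi_div_three]
  push_cast
  ring

theorem echar_neg_third : echar (-(1 / 3)) = -1 / 2 - Real.sqrt 3 / 2 * Complex.I := by
  rw [← conj_echar, echar_third]
  simp [Complex.conj_ofNat]
  ring

/-- The phases of the Bloch state at the Dirac point. -/
def bondPhase (σ : Fin 2) (j : Fin 3) : ℂ :=
  echar (bondSign σ * inner ℝ (recipPt (diracCoord + intVec 0)) (bondVec j))

theorem bondPhase_eq (σ : Fin 2) (j : Fin 3) : bondPhase σ j =
    ![1, -1 / 2 - bondSign σ * (Real.sqrt 3 / 2 * Complex.I),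
      -1 / 2 + bondSign σ * (Real.sqrt 3 / 2 * Complex.I)] j := by
  rw [bondPhase, recipPt_diracCoord, inner_plane, bondVec_apply]
  have e5 : echar (-1 / 3) = -1 / 2 - Real.sqrt 3 / 2 * Complex.I := by
    rw [← echar_neg_third]; norm_num
  have e6 : echar (-(-1 / 3)) = -1 / 2 + Real.sqrt 3 / 2 * Complex.I := by
    rw [← echar_third]; norm_num
  unfold bondSign
  fin_cases j
  · simp [echar_zero]
  · fin_cases σ
    · simp [-one_div, e5]
    · simp [-one_div, e6]
  · fin_cases σ
    · simp [-one_div, echar_third]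
    · simp [-one_div, echar_neg_third]; ring

/-- The three phases are the cube roots of unity; this is why the intralayer symbol vanishes at the
Dirac point. -/
theorem sum_bondPhase (σ : Fin 2) : ∑ j : Fin 3, bondPhase σ j = 0 := by
  simp only [Fin.sum_univ_three, bondPhase_eq, Matrix.cons_val]
  ring

/-- The linear term of the intralayer symbol. The prefactor 2/√3 is what normalizes the Dirac
velocity to 1. -/
theorem sum_bondPhase_mul (σ : Fin 2) (ξ : Plane) :
    (-(2 / Real.sqrt 3 : ℝ) : ℂ) * ∑ j : Fin 3, bondPhase σ j *
      (2 * Real.pi * Complex.I * (bondSign σ * inner ℝ ξ (bondVec j) : ℝ)) =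
      ![(starRingEnd ℂ) (diracSymbol ξ), diracSymbol ξ] σ := by
  have h : (Real.sqrt 3 : ℂ) ≠ 0 := Complex.ofReal_ne_zero.2 (by positivity)
  have h3 : (Real.sqrt 3 : ℂ) ^ 2 = 3 := by
    rw [← Complex.ofReal_pow, Real.sq_sqrt (by norm_num)]; norm_num
  have hI := Complex.I_sq
  simp only [Fin.sum_univ_three, bondPhase_eq, bondVec_apply, inner_plane, Matrix.cons_val,
    PiLp.toLp_apply]
  unfold bondSign
  fin_cases σ
  · simp [diracSymbol, Complex.conj_ofNat]
    field_simp
    ring_nf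
    simp only [h3, hI]
    ring
  · simp [diracSymbol]
    field_simp
    ring_nf
    simp only [h3, hI]
    ring

theorem norm_layerAngle (θ : ℝ) (i : Fin 2) : |layerAngle θ i| = |θ| / 2 := by
  fin_cases i <;> simp [layerAngle, abs_div]

/-- The Dirac point rotates together with the bonds, so its phases do not depend on θ; the rotation
survives only in the terms with ξ. -/
theorem intraSymbol_eq (θ γ : ℝ) (i σ : Fin 2) (ξ : Plane) : intraSymbol θ γ i σ ξ =
    (-(2 / Real.sqrt 3 : ℝ) : ℂ) * ∑ j : Fin 3, bondPhase σ j *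
      echar (γ * (bondSign σ * inner ℝ ξ (rot (layerAngle θ i) (bondVec j)))) := by
  unfold intraSymbol
  congr 1
  refine Finset.sum_congr rfl fun j _ => ?_
  rw [bondPhase, ← echar_add, layerBond_eq, inner_add_left, diracFreq, dualPt, inner_smul_right,
    inner_rot, real_inner_smul_left, inner_smul_right]

/-- The intralayer Hamiltonian is a Dirac operator to leading order. -/
theorem norm_intraSymbol_sub_le {θ γ : ℝ} (hθ : 0 ≤ θ) (hγ : 0 ≤ γ) (i σ : Fin 2) (ξ : Plane) :
    ‖intraSymbol θ γ i σ ξ - γ * ![(starRingEnd ℂ) (diracSymbol ξ), diracSymbol ξ] σ‖ ≤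
      6 * (4 * Real.pi ^ 2 * γ ^ 2 + Real.pi * γ * θ) * jap ξ ^ 2 := by
  set x : Fin 3 → ℝ := fun j => γ * (bondSign σ * inner ℝ ξ (rot (layerAngle θ i) (bondVec j)))
    with hx
  set w : Fin 3 → ℝ := fun j => γ * (bondSign σ * inner ℝ ξ (bondVec j)) with hw
  have hs : |bondSign σ| = 1 := by unfold bondSign; split_ifs <;> simp
  have hxn : ∀ j, |x j| ≤ γ * ‖ξ‖ := fun j => by
    rw [hx, abs_mul, abs_mul, hs, one_mul, abs_of_nonneg hγ]
    refine mul_le_mul_of_nonneg_left ((abs_real_inner_le_norm _ _).trans ?_) hγ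
    rw [norm_rot]
    exact mul_le_of_le_one_right (norm_nonneg _) (norm_bondVec_le j)
  have hxw : ∀ j, |x j - w j| ≤ γ * (‖ξ‖ * (θ / 2)) := fun j => by
    have : x j - w j =
        γ * (bondSign σ * inner ℝ ξ (rot (layerAngle θ i) (bondVec j) - bondVec j)) := by
      rw [hx, hw, inner_sub_right]; ring
    rw [this, abs_mul, abs_mul, hs, one_mul, abs_of_nonneg hγ]
    refine mul_le_mul_of_nonneg_left ((abs_real_inner_le_norm _ _).trans ?_) hγ
    refine mul_le_mul_of_nonneg_left ((norm_rot_sub_le _ _).trans ?_) (norm_nonneg _)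
    rw [norm_layerAngle, abs_of_nonneg hθ]
    exact mul_le_of_le_one_right (by positivity) (norm_bondVec_le j)
  -- The zeroth order cancels by `sum_bondPhase`, and the first order with unrotated bonds is the
  -- Dirac symbol. There remain the Taylor remainder in x and the rotation error x − w.
  have e : intraSymbol θ γ i σ ξ - γ * ![(starRingEnd ℂ) (diracSymbol ξ), diracSymbol ξ] σ =
      (-(2 / Real.sqrt 3 : ℝ) : ℂ) * ∑ j : Fin 3, bondPhase σ j *
        (echar (x j) - 1 - 2 * Real.pi * Complex.I * w j) := by
    rw [intraSymbol_eq, ← sum_bondPhase_mul]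
    have h0 := sum_bondPhase σ
    simp only [Fin.sum_univ_three] at h0 ⊢
    simp only [hw]
    push_cast
    linear_combination (2 / (Real.sqrt 3 : ℂ)) * (-h0)
  have hj : ∀ j, ‖bondPhase σ j * (echar (x j) - 1 - 2 * Real.pi * Complex.I * w j)‖ ≤
      (4 * Real.pi ^ 2 * γ ^ 2 + Real.pi * γ * θ) * jap ξ ^ 2 := fun j => by
    rw [bondPhase, norm_mul, norm_echar, one_mul]
    have h1 := norm_echar_taylor_le (x j)
    have h2 : ‖(2 * Real.pi * Complex.I * (x j - w j) : ℂ)‖ = 2 * Real.pi * |x j - w j| := by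
      rw [← Complex.ofReal_sub, norm_mul, Complex.norm_real, Real.norm_eq_abs]
      simp [abs_of_pos Real.pi_pos]
    have h3 : echar (x j) - 1 - 2 * Real.pi * Complex.I * w j =
        (echar (x j) - 1 - 2 * Real.pi * Complex.I * x j) +
          2 * Real.pi * Complex.I * (x j - w j) := by ring
    rw [h3]
    refine (norm_add_le _ _).trans ((add_le_add h1 h2.le).trans ?_)
    have h4 : (2 * Real.pi * x j) ^ 2 ≤ 4 * Real.pi ^ 2 * (γ * ‖ξ‖) ^ 2 := by
      rw [mul_pow, mul_pow, ← sq_abs (x j)]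
      have := pow_le_pow_left₀ (abs_nonneg _) (hxn j) 2
      have hp := Real.pi_pos
      nlinarith [sq_nonneg Real.pi]
    have h5 : 2 * Real.pi * |x j - w j| ≤ 2 * Real.pi * (γ * (‖ξ‖ * (θ / 2))) :=
      mul_le_mul_of_nonneg_left (hxw j) (by positivity)
    have h6 : ‖ξ‖ ^ 2 ≤ jap ξ ^ 2 := pow_le_pow_left₀ (norm_nonneg _) (norm_le_jap ξ) 2
    have h7 : ‖ξ‖ ≤ jap ξ ^ 2 := by rw [jap_sq]; nlinarith [sq_nonneg (‖ξ‖ - 1)]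
    have h8 := mul_le_mul_of_nonneg_left h6 (by positivity : 0 ≤ 4 * Real.pi ^ 2 * γ ^ 2)
    have h9 := mul_le_mul_of_nonneg_left h7 (by positivity : 0 ≤ Real.pi * γ * θ)
    nlinarith
  rw [e, norm_mul]
  have h2 : ‖(-(2 / Real.sqrt 3 : ℝ) : ℂ)‖ ≤ 2 := by
    rw [norm_neg, Complex.norm_real, Real.norm_of_nonneg (by positivity)]
    refine div_le_self (by norm_num) (Real.one_le_sqrt.2 (by norm_num))
  have h3 := norm_sum_le_of_le Finset.univ fun j _ => hj j
  rw [Finset.sum_const, Finset.card_univ, Fintype.card_fin, nsmul_eq_mul] at h3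
  refine (mul_le_mul h2 h3 (norm_nonneg _) (by norm_num)).trans (le_of_eq ?_)
  push_cast
  ring

/-- The symbol of the part of the intralayer Hamiltonian that is not a Dirac operator. -/
def intraResidual (θ γ : ℝ) (i σ : Fin 2) (ξ : Plane) : ℂ :=
  intraSymbol θ γ i σ ξ * jw ξ ^ 4 - γ * (jw ξ ^ 3 * diracMatrix σ σ.rev ξ)

/-- The error grows like jap², and the four available weights absorb it. -/
theorem isMultiplier_intraResidual {θ γ : ℝ} (hθ : 0 ≤ θ) (hγ : 0 ≤ γ) (i σ : Fin 2) :
    IsMultiplier (intraResidual θ γ i σ) (6 * (4 * Real.pi ^ 2 * γ ^ 2 + Real.pi * γ * θ)) := by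
  obtain ⟨C, hC⟩ := isMultiplier_intraSymbol θ γ i σ
  refine ⟨((hC.mul (isMultiplier_jw_pow 4)).sub (((isMultiplier_jw_pow 3).mul
    (isMultiplier_diracMatrix σ σ.rev)).const_mul γ)).meas, fun ξ => ?_⟩
  have e : intraResidual θ γ i σ ξ = (intraSymbol θ γ i σ ξ -
      γ * ![(starRingEnd ℂ) (diracSymbol ξ), diracSymbol ξ] σ) * jw ξ ^ 4 := by
    unfold intraResidual diracMatrix
    fin_cases σ <;> simp <;> ring
  rw [e, norm_mul, norm_pow, norm_jw]
  refine (mul_le_mul_of_nonneg_right (norm_intraSymbol_sub_le hθ hγ i σ ξ)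
    (by positivity [jap_pos ξ])).trans ?_
  rw [mul_assoc]
  refine mul_le_of_le_one_right (by positivity) ?_
  have h := one_le_jap ξ
  rw [inv_pow, mul_inv_le_iff₀ (by positivity), one_mul]
  exact pow_le_pow_right₀ h (by norm_num)

/-! ### The interlayer symbol near the reciprocal lattice -/

/-- The reflection exchanging two vectors of equal length preserves both h and Lebesgue measure. -/
theorem hopFT_eq_of_norm_eq (hs : ℝ → ℝ) (ℓ : ℝ) {ξ ξ' : Plane} (h : ‖ξ‖ = ‖ξ'‖) :
    hopFT hs ξ ℓ = hopFT hs ξ' ℓ := by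
  set T := (ℝ ∙ (ξ - ξ'))ᗮ.reflection with hT
  have e : T ξ = ξ' := Submodule.reflection_sub h
  unfold hopFT
  rw [← e, ← T.measurePreserving.integral_comp T.toHomeomorph.measurableEmbedding
    (fun r => Complex.exp (-Complex.I * (inner ℝ (T ξ) r : ℝ)) * (hop hs r ℓ : ℂ))]
  congr 1
  funext r
  rw [T.inner_map_map, hop, hop, T.norm_map]

theorem norm_diracPt : ‖diracPt‖ = 4 * Real.pi / 3 := by
  rw [← pow_left_inj₀ (norm_nonneg _) (by positivity) two_ne_zero, norm_sq_plane]
  simp [diracPt]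

/-- The square of the norm of `diracFreq`, in integer coordinates. -/
theorem norm_sq_diracFreq (θ : ℝ) (i : Fin 2) (k : Fin 2 → ℤ) : ‖diracFreq θ i k‖ ^ 2 =
    4 / 3 * (1 / 3 + ((k 0 ^ 2 - k 0 * k 1 + k 1 ^ 2 + k 0 - k 1 : ℤ) : ℝ)) := by
  rw [diracFreq, norm_dualPt, norm_sq_recipPt]
  simp only [Pi.add_apply, diracCoord, intVec, Matrix.cons_val_zero, Matrix.cons_val_one]
  push_cast
  ring

theorem norm_diracFreq_of_mem (θ : ℝ) (i : Fin 2) {k : Fin 2 → ℤ}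
    (hk : k ∈ Finset.univ.image ringVec) : ‖diracFreq θ i k‖ = 2 / 3 := by
  rw [← pow_left_inj₀ (norm_nonneg _) (by positivity) two_ne_zero, norm_sq_diracFreq]
  obtain ⟨m, -, rfl⟩ := Finset.mem_image.1 hk
  fin_cases m <;> simp [ringVec] <;> norm_num

/-- The squared length is (4/3)(1/3 + N) with an integer N that is at least 1 off the ring. The
bound 4/3 is twice |κ|/(2π), and this factor 2 is what the hypothesis D₁/D₂ < 2 is matched to. -/
theorem le_norm_diracFreq_of_notMem (θ : ℝ) (i : Fin 2) {k : Fin 2 → ℤ}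
    (hk : k ∉ Finset.univ.image ringVec) : 4 / 3 ≤ ‖diracFreq θ i k‖ := by
  have hN : 1 ≤ k 0 ^ 2 - k 0 * k 1 + k 1 ^ 2 + k 0 - k 1 := by
    by_contra! h
    refine hk (Finset.mem_image.2 ?_)
    -- 4N = (2k₀ − k₁ + 1)² + (3k₁ + 1)(k₁ − 1), and similarly for k₀, so N ≤ 0 leaves four
    -- candidates; (−1, 1) has N = 1, and the others are the ring.
    have h1 : k 1 ≤ 1 := by nlinarith [sq_nonneg (2 * k 0 - k 1 + 1)]
    have h2 : 0 ≤ k 1 := by nlinarith [sq_nonneg (2 * k 0 - k 1 + 1)]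
    have h3 : k 0 ≤ 0 := by nlinarith [sq_nonneg (2 * k 1 - k 0 - 1)]
    have h4 : -1 ≤ k 0 := by nlinarith [sq_nonneg (2 * k 1 - k 0 - 1)]
    have e : k = ![k 0, k 1] := by funext j; fin_cases j <;> rfl
    have c1 : k 1 = 0 ∨ k 1 = 1 := by omega
    have c0 : k 0 = 0 ∨ k 0 = -1 := by omega
    rcases c1 with c1 | c1 <;> rcases c0 with c0 | c0 <;> rw [c0, c1] at e h
    · exact ⟨0, Finset.mem_univ _, e.symm⟩
    · exact ⟨2, Finset.mem_univ _, e.symm⟩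
    · exact ⟨1, Finset.mem_univ _, e.symm⟩
    · norm_num at h
  rw [← pow_le_pow_iff_left₀ (by norm_num) (norm_nonneg _) two_ne_zero, norm_sq_diracFreq]
  have : (1 : ℝ) ≤ ((k 0 ^ 2 - k 0 * k 1 + k 1 ^ 2 + k 0 - k 1 : ℤ) : ℝ) := by exact_mod_cast hN
  linarith

/-- High envelope momenta: if γ|ζ| ≥ δ, each weight in ζ is worth a factor γ. The weight in η,
needed for the sum over reciprocal vectors, is transferred to η + γζ, where the hopping symbol
decays. -/
theorem norm_jw_pow_four_mul_le {η ζ : Plane} {γ δ : ℝ} (hδ : 0 < δ) (hγ : 0 ≤ γ)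
    (h : δ ≤ γ * ‖ζ‖) : jap η ^ 4 * (jap ζ ^ 4)⁻¹ ≤ (1 + δ⁻¹) ^ 4 * γ ^ 4 * jap (η + γ • ζ) ^ 4 := by
  have hz := jap_pos ζ
  have h1 : jap η ≤ jap (η + γ • ζ) * ((1 + δ⁻¹) * γ * jap ζ) := by
    have h2 := jap_add_le (η + γ • ζ) (-(γ • ζ))
    rw [add_neg_cancel_right, norm_neg, norm_smul, Real.norm_of_nonneg hγ] at h2
    refine h2.trans (mul_le_mul_of_nonneg_left ?_ (jap_pos _).le)
    have h3 : 1 ≤ δ⁻¹ * (γ * ‖ζ‖) := by rwa [le_inv_mul_iff₀ hδ, mul_one]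
    have h4 : (1 + δ⁻¹) * (γ * ‖ζ‖) ≤ (1 + δ⁻¹) * (γ * jap ζ) := by
      have := norm_le_jap ζ
      gcongr
    linarith
  rw [mul_inv_le_iff₀ (by positivity)]
  refine (pow_le_pow_left₀ (jap_pos η).le h1 4).trans (le_of_eq ?_)
  ring

/-- The same transfer of weight without the gain in γ, for low envelope momenta. -/
theorem jap_pow_four_mul_le {η ζ : Plane} {γ : ℝ} (hγ : 0 ≤ γ) (hγ1 : γ ≤ 1) :
    jap η ^ 4 * (jap ζ ^ 4)⁻¹ ≤ 16 * jap (η + γ • ζ) ^ 4 := by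
  have hz := jap_pos ζ
  have h1 : jap η ≤ jap (η + γ • ζ) * (2 * jap ζ) := by
    have h2 := jap_add_le (η + γ • ζ) (-(γ • ζ))
    rw [add_neg_cancel_right, norm_neg, norm_smul, Real.norm_of_nonneg hγ] at h2
    refine h2.trans (mul_le_mul_of_nonneg_left ?_ (jap_pos _).le)
    have h4 := mul_le_of_le_one_left (norm_nonneg ζ) hγ1
    linarith [norm_le_jap ζ, one_le_jap ζ]
  rw [mul_inv_le_iff₀ (by positivity)]
  refine (pow_le_pow_left₀ (jap_pos η).le h1 4).trans (le_of_eq ?_)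
  ring

theorem Regime.hopFT_of_norm_eq {hs : ℝ → ℝ} {ℓ₀ lam₀ lam₁ γ θ ℓ : ℝ}
    (hr : Regime hs ℓ₀ lam₀ lam₁ γ θ ℓ) {ξ : Plane} (hξ : ‖ξ‖ = 4 * Real.pi / 3) :
    hopFT hs ξ ℓ = ((lam₀ * γ : ℝ) : ℂ) := by
  rw [← hr.balance]
  exact hopFT_eq_of_norm_eq hs ℓ (hξ.trans norm_diracPt.symm)

namespace HoppingAssumption

variable {hs : ℝ → ℝ} {C₁ C₂ C₃ D₁ D₂ ℓ₀ : ℝ} (hh : HoppingAssumption hs C₁ C₂ C₃ D₁ D₂ ℓ₀)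
include hh

theorem ratio_bounds : 1 / 2 < D₂ / D₁ ∧ D₂ / D₁ ≤ 1 := by
  have h1 := hh.D₁_pos
  have h2 := hh.D₂_pos
  have h3 := hh.one_le_ratio
  have h4 := hh.ratio_lt_two
  rw [one_le_div h2] at h3
  rw [div_lt_iff₀ h2] at h4
  rw [lt_div_iff₀ h1, div_le_one h1]
  constructor <;> linarith

variable {lam₀ lam₁ γ θ ℓ : ℝ} (hr : Regime hs ℓ₀ lam₀ lam₁ γ θ ℓ) (hγ1 : γ ≤ 1)
  (hlam₀ : 0 < lam₀)
include hr hγ1 hlam₀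

/-- The balance condition and the lower bound on ĥ give e^(−D₁ℓ|κ|) ≤ λ₀γ/C₁. The power D₂s/D₁ of
this converts decay in ℓ at radius s|κ| into a power of γ, whose exponent may be lowered because γ ≤
1. -/
theorem exp_le_rpow {s t : ℝ} (hs : 0 ≤ s) (ht : t ≤ D₂ / D₁ * s) :
    Real.exp (-D₂ * ℓ * (4 * Real.pi / 3 * s)) ≤ (lam₀ / C₁) ^ (D₂ / D₁ * s) * γ ^ t := by
  have hD₁ := hh.D₁_pos
  have hC₁ := hh.C₁_pos
  have hγ := hr.γ_pos
  have hα := hh.ratio_bounds.1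
  have h1 := hh.lower ℓ hr.le_ℓ diracPt rfl
  rw [hr.balance, Complex.ofReal_re, norm_diracPt] at h1
  have h2 : Real.exp (-D₁ * ℓ * (4 * Real.pi / 3)) ≤ lam₀ / C₁ * γ := by
    rw [div_mul_eq_mul_div, le_div_iff₀ hC₁]; linarith
  have h3 := Real.rpow_le_rpow (Real.exp_pos _).le h2 (by positivity : 0 ≤ D₂ / D₁ * s)
  rw [← Real.exp_mul, Real.mul_rpow (by positivity) hγ.le] at h3
  have e : -D₁ * ℓ * (4 * Real.pi / 3) * (D₂ / D₁ * s) = -D₂ * ℓ * (4 * Real.pi / 3 * s) := by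
    field_simp
  rw [e] at h3
  refine h3.trans (mul_le_mul_of_nonneg_left ?_ (by positivity))
  exact Real.rpow_le_rpow_of_exponent_ge hγ hγ1 ht

end HoppingAssumption

namespace HoppingAssumption

variable {hs : ℝ → ℝ} {C₁ C₂ C₃ D₁ D₂ ℓ₀ : ℝ} (hh : HoppingAssumption hs C₁ C₂ C₃ D₁ D₂ ℓ₀)
variable {lam₀ lam₁ γ θ ℓ : ℝ} (hr : Regime hs ℓ₀ lam₀ lam₁ γ θ ℓ) (hγ1 : γ ≤ 1)
  (hlam₀ : 0 < lam₀)
include hh hr hγ1 hlam₀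

/-- The Fourier transform near the circle of radius `|κ|`. -/
theorem norm_hopFT_sub_le {c : ℝ} (hc : c = D₂ / D₁ - 1 / 2) {p q : Plane}
    (hp : ‖p‖ = 4 * Real.pi / 3) (hq : ‖q‖ ≤ c * (4 * Real.pi / 3)) :
    ‖hopFT hs (p + q) ℓ - (lam₀ * γ : ℝ)‖ ≤
      C₃ * ((lam₀ / C₁) ^ (D₂ / D₁ * (1 - c)) * γ ^ c) * ‖q‖ := by
  obtain ⟨hα, hα1⟩ := hh.ratio_bounds
  rw [← hr.hopFT_of_norm_eq hp]
  refine (hh.lipschitz ℓ hr.le_ℓ _ _).trans ?_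
  rw [add_sub_cancel_left]
  have hℓ := hh.ℓ_pos hr.le_ℓ
  have hD := hh.D₂_pos
  refine mul_le_mul_of_nonneg_right (mul_le_mul_of_nonneg_left ?_ hh.C₃_pos.le) (norm_nonneg _)
  -- The segment avoids the disc of radius (1 − c)|κ|. With D₂/D₁ = c + 1/2 the available exponent
  -- (c + 1/2)(1 − c) is at least c, because c ≤ 1/2.
  refine le_trans (Real.exp_le_exp.2 ?_) (hh.exp_le_rpow hr hγ1 hlam₀ (s := 1 - c) (t := c)
    (by linarith) (by rw [hc]; nlinarith))
  have hd : 4 * Real.pi / 3 * (1 - c) ≤ Metric.infDist 0 (segment ℝ (p + q) p) := by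
    rw [Metric.le_infDist ⟨p, right_mem_segment ℝ _ _⟩]
    intro x hx
    have hsub := (convex_closedBall p ‖q‖).segment_subset (x := p + q) (y := p)
      (by simp [Metric.mem_closedBall, dist_eq_norm]) (by simp)
    have h1 := hsub hx
    rw [Metric.mem_closedBall, dist_eq_norm] at h1
    rw [dist_zero_left]
    have h2 := norm_sub_norm_le p x
    rw [norm_sub_rev] at h2
    linarith
  have := mul_le_mul_of_nonneg_left hd (mul_pos hD hℓ).le
  linarith

/-- The Fourier transform away from the disc of radius `|κ|`. -/
theorem norm_hopSymbol_mul_le_of_le {c : ℝ} (hc : c = D₂ / D₁ - 1 / 2) {x : Plane}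
    (hx : 4 * Real.pi / 3 * (2 - c) ≤ 2 * Real.pi * ‖x‖) :
    ‖hopSymbol hs ℓ x‖ * jap x ^ 4 ≤ C₂ * ((lam₀ / C₁) ^ (D₂ / D₁ * (2 - c)) * γ ^ (1 + c)) *
      Real.exp (D₂ * ℓ₀ * (4 * Real.pi / 3 * (2 - c))) *
      (Nat.factorial 4 / (D₂ * ℓ₀) ^ 4 * Real.exp (D₂ * ℓ₀)) := by
  obtain ⟨hα, hα1⟩ := hh.ratio_bounds
  have hD := hh.D₂_pos
  have hℓ₀ := hh.ℓ₀_pos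
  -- Here (c + 1/2)(2 − c) = 1 + 3c/2 − c² ≥ 1 + c, again because c ≤ 1/2.
  have h1 := hh.exp_le_rpow hr hγ1 hlam₀ (s := 2 - c) (t := 1 + c)
    (by linarith) (by rw [hc]; nlinarith)
  -- Beyond the radius (2 − c)|κ| only the rate D₂ℓ₀ is used; this leaves exponential decay in x
  -- that is uniform in ℓ and absorbs jap⁴.
  have h2 : Real.exp (-D₂ * ℓ * ‖(2 * Real.pi) • x‖) ≤
      Real.exp (-D₂ * ℓ * (4 * Real.pi / 3 * (2 - c))) *
        (Real.exp (D₂ * ℓ₀ * (4 * Real.pi / 3 * (2 - c))) * Real.exp (-(D₂ * ℓ₀) * ‖x‖)) := by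
    rw [← Real.exp_add, ← Real.exp_add, Real.exp_le_exp, norm_smul,
      Real.norm_of_nonneg (by positivity)]
    have e1 : 0 ≤ (D₂ * ℓ - D₂ * ℓ₀) * (2 * Real.pi * ‖x‖ - 4 * Real.pi / 3 * (2 - c)) :=
      mul_nonneg (by nlinarith [hr.le_ℓ]) (by linarith)
    have e2 : D₂ * ℓ₀ * ‖x‖ ≤ D₂ * ℓ₀ * (2 * Real.pi * ‖x‖) := by
      refine mul_le_mul_of_nonneg_left ?_ (by positivity)
      exact le_mul_of_one_le_left (norm_nonneg _) (by linarith [Real.pi_gt_three])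
    linarith
  have h3 := one_add_pow_mul_exp_le (mul_pos hD hℓ₀) (norm_nonneg x) 4
  have h4 : jap x ^ 4 ≤ (1 + ‖x‖) ^ 4 := pow_le_pow_left₀ (jap_pos x).le (jap_le_one_add x) 4
  have hC := hh.C₂_pos
  have hγ := hr.γ_pos
  have hC₁ := hh.C₁_pos
  calc ‖hopSymbol hs ℓ x‖ * jap x ^ 4
      ≤ C₂ * (Real.exp (-D₂ * ℓ * (4 * Real.pi / 3 * (2 - c))) *
        (Real.exp (D₂ * ℓ₀ * (4 * Real.pi / 3 * (2 - c))) * Real.exp (-(D₂ * ℓ₀) * ‖x‖))) *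
          (1 + ‖x‖) ^ 4 := by
        refine mul_le_mul ((hh.upper ℓ hr.le_ℓ _).trans
          (mul_le_mul_of_nonneg_left h2 hC.le)) h4 (pow_nonneg (jap_pos x).le 4) (by positivity)
    _ = C₂ * Real.exp (-D₂ * ℓ * (4 * Real.pi / 3 * (2 - c))) *
        Real.exp (D₂ * ℓ₀ * (4 * Real.pi / 3 * (2 - c))) *
          ((1 + ‖x‖) ^ 4 * Real.exp (-(D₂ * ℓ₀) * ‖x‖)) := by ring
    _ ≤ _ := by gcongr

end HoppingAssumption

theorem jap_pow_four_le_of_norm_eq {η : Plane} (h : ‖η‖ = 2 / 3) : jap η ^ 4 ≤ 3 := by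
  have : jap η ^ 4 = (jap η ^ 2) ^ 2 := by ring
  rw [this, jap_sq, h]
  norm_num

theorem norm_mul_inv_jap_le (ζ : Plane) : ‖ζ‖ * (jap ζ ^ 4)⁻¹ ≤ 1 := by
  have h := one_le_jap ζ
  rw [mul_inv_le_iff₀ (by positivity), one_mul]
  exact (norm_le_jap ζ).trans (le_self_pow₀ h (by norm_num))

namespace HoppingAssumption

variable {hs : ℝ → ℝ} {C₁ C₂ C₃ D₁ D₂ ℓ₀ : ℝ} (hh : HoppingAssumption hs C₁ C₂ C₃ D₁ D₂ ℓ₀)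
include hh

/-- For γ|ζ| ≤ δ, the Lipschitz bound gives γ^c · γ|ζ| on the ring, and the decay at radius (2 −
c)|κ| gives γ^(1+c) off it. For γ|ζ| ≥ δ the four weights give γ⁴. The factor jap⁻⁴ makes the bounds
summable over the reciprocal lattice. -/
theorem exists_isMultiplier_interResidual {c lam₀ : ℝ} (hc : c = D₂ / D₁ - 1 / 2)
    (hlam₀ : 0 < lam₀) : ∃ K, 0 ≤ K ∧ ∀ {lam₁ γ θ ℓ : ℝ}, Regime hs ℓ₀ lam₀ lam₁ γ θ ℓ → γ ≤ 1 →
      ∀ i k, IsMultiplier (interResidual hs lam₀ θ ℓ γ i k)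
        (K * γ ^ (1 + c) * (jap (diracFreq θ i k) ^ 4)⁻¹) := by
  obtain ⟨hα, hα1⟩ := hh.ratio_bounds
  have hC₁ := hh.C₁_pos
  have hC₂ := hh.C₂_pos
  have hC₃ := hh.C₃_pos
  have hD := hh.D₂_pos
  have hℓ₀ := hh.ℓ₀_pos
  have hc0 : 0 < c := by linarith
  have hc1 : c ≤ 1 / 2 := by linarith
  -- The radius c|κ| in frequency units, where |κ|/(2π) = 2/3.
  set δ : ℝ := c * (2 / 3) with hδ
  have hδ0 : 0 < δ := by positivity
  set F : ℝ := Nat.factorial 4 / (D₂ * ℓ₀) ^ 4 * Real.exp (D₂ * ℓ₀) with hF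
  -- K₁ and K₂ belong to the ring and to the other Dirac points for γ|ζ| ≤ δ; K₃ and K₄ to the
  -- hopping symbol and to the constant λ₀γ for γ|ζ| ≥ δ.
  set K₁ : ℝ := 6 * Real.pi * C₃ * (lam₀ / C₁) ^ (D₂ / D₁ * (1 - c)) with hK₁
  set K₂ : ℝ := 16 * (C₂ * (lam₀ / C₁) ^ (D₂ / D₁ * (2 - c)) *
    Real.exp (D₂ * ℓ₀ * (4 * Real.pi / 3 * (2 - c))) * F) with hK₂
  set K₃ : ℝ := (1 + δ⁻¹) ^ 4 * (C₂ * F) with hK₃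
  set K₄ : ℝ := 3 * lam₀ * (δ⁻¹) ^ 4 with hK₄
  have hF0 : 0 ≤ F := by positivity
  have hK₁0 : 0 ≤ K₁ := by positivity
  have hK₂0 : 0 ≤ K₂ := by positivity
  have hK₃0 : 0 ≤ K₃ := by positivity
  have hK₄0 : 0 ≤ K₄ := by positivity
  refine ⟨K₁ + K₂ + K₃ + K₄, by positivity, fun {lam₁ γ θ ℓ} hr hγ1 i k =>
    ⟨?_, fun ζ => ?_⟩⟩
  · exact ((hh.isMultiplier_hopSymbol hr.le_ℓ _ γ).sub (IsMultiplier.const _)).meas.mul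
      (isMultiplier_jw_pow 4).meas
  have hγ := hr.γ_pos
  set η := diracFreq θ i k with hη
  have hjη := jap_pos η
  have hjζ := jap_pos ζ
  set G := γ ^ (1 + c) with hG
  have hG0 : 0 ≤ G := by positivity
  have hγG : ∀ n : ℕ, 2 ≤ n → γ ^ n ≤ G := fun n hn => by
    rw [hG, ← Real.rpow_natCast]
    refine Real.rpow_le_rpow_of_exponent_ge hγ hγ1 ?_
    have : (2 : ℝ) ≤ n := by exact_mod_cast hn
    linarith
  rw [← div_eq_mul_inv, le_div_iff₀ (by positivity), interResidual, norm_mul, norm_pow, norm_jw,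
    inv_pow]
  have hcast : (lam₀ * γ : ℂ) = ((lam₀ * γ : ℝ) : ℂ) := by push_cast; rfl
  have hsplit : (K₁ + K₂ + K₃ + K₄) * G = K₁ * G + K₂ * G + K₃ * G + K₄ * G := by ring
  have h1G := mul_nonneg hK₁0 hG0
  have h2G := mul_nonneg hK₂0 hG0
  have h3G := mul_nonneg hK₃0 hG0
  have h4G := mul_nonneg hK₄0 hG0
  rw [hsplit]
  rcases le_total (γ * ‖ζ‖) δ with hlow | hhigh
  · split_ifs with hk
    · have hn := norm_diracFreq_of_mem θ i hk
      have h1 := hh.norm_hopFT_sub_le hr hγ1 hlam₀ hc (p := (2 * Real.pi) • η)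
        (q := (2 * Real.pi) • (γ • ζ))
        (by rw [norm_smul, hn, Real.norm_of_nonneg (by positivity)]; ring)
        (by
          rw [norm_smul, norm_smul, Real.norm_of_nonneg (by positivity), Real.norm_of_nonneg hγ.le]
          have := mul_le_mul_of_nonneg_left hlow (by positivity : 0 ≤ 2 * Real.pi)
          rw [hδ] at this
          linarith)
      rw [← smul_add, norm_smul, norm_smul, Real.norm_of_nonneg (by positivity),
        Real.norm_of_nonneg hγ.le, ← hcast] at h1
      have h2 := jap_pow_four_le_of_norm_eq hn
      have h3 := norm_mul_inv_jap_le ζ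
      have h4 : γ ^ c * γ = G := by rw [hG, add_comm, Real.rpow_add_one hγ.ne']
      calc ‖hopSymbol hs ℓ (η + γ • ζ) - lam₀ * γ‖ * (jap ζ ^ 4)⁻¹ * jap η ^ 4
          ≤ C₃ * ((lam₀ / C₁) ^ (D₂ / D₁ * (1 - c)) * γ ^ c) * (2 * Real.pi * (γ * ‖ζ‖)) *
            (jap ζ ^ 4)⁻¹ * 3 := by
            refine mul_le_mul (mul_le_mul_of_nonneg_right h1 (by positivity)) h2 (by positivity)
              (by positivity)
        _ = K₁ * (γ ^ c * γ) * (‖ζ‖ * (jap ζ ^ 4)⁻¹) := by rw [hK₁]; ring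
        _ ≤ K₁ * G := by rw [h4]; exact mul_le_of_le_one_right h1G h3
        _ ≤ _ := by linarith
    · have hn := le_norm_diracFreq_of_notMem θ i hk
      have hx : 4 * Real.pi / 3 * (2 - c) ≤ 2 * Real.pi * ‖η + γ • ζ‖ := by
        have h5 := norm_sub_le (η + γ • ζ) (γ • ζ)
        rw [add_sub_cancel_right, norm_smul γ, Real.norm_of_nonneg hγ.le] at h5
        have h6 : 2 / 3 * (2 - c) ≤ ‖η + γ • ζ‖ := by rw [hδ] at hlow; linarith
        have := mul_le_mul_of_nonneg_left h6 (by positivity : 0 ≤ 2 * Real.pi)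
        linarith
      have h1 := hh.norm_hopSymbol_mul_le_of_le hr hγ1 hlam₀ hc hx
      have h2 := jap_pow_four_mul_le (η := η) (ζ := ζ) hγ.le hγ1
      rw [sub_zero]
      calc ‖hopSymbol hs ℓ (η + γ • ζ)‖ * (jap ζ ^ 4)⁻¹ * jap η ^ 4
          = ‖hopSymbol hs ℓ (η + γ • ζ)‖ * (jap η ^ 4 * (jap ζ ^ 4)⁻¹) := by ring
        _ ≤ ‖hopSymbol hs ℓ (η + γ • ζ)‖ * (16 * jap (η + γ • ζ) ^ 4) :=
            mul_le_mul_of_nonneg_left h2 (norm_nonneg _)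
        _ = 16 * (‖hopSymbol hs ℓ (η + γ • ζ)‖ * jap (η + γ • ζ) ^ 4) := by ring
        _ ≤ _ := mul_le_mul_of_nonneg_left h1 (by norm_num)
        _ = K₂ * G := by rw [hK₂]; ring
        _ ≤ _ := by linarith
  · have h1 := norm_jw_pow_four_mul_le (η := η) hδ0 hγ.le hhigh
    have h2 := hh.norm_hopSymbol_mul_le hr.le_ℓ (η + γ • ζ) 4
    have h3 : ‖hopSymbol hs ℓ (η + γ • ζ)‖ * (jap ζ ^ 4)⁻¹ * jap η ^ 4 ≤ K₃ * G := by
      calc ‖hopSymbol hs ℓ (η + γ • ζ)‖ * (jap ζ ^ 4)⁻¹ * jap η ^ 4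
          = ‖hopSymbol hs ℓ (η + γ • ζ)‖ * (jap η ^ 4 * (jap ζ ^ 4)⁻¹) := by ring
        _ ≤ ‖hopSymbol hs ℓ (η + γ • ζ)‖ *
            ((1 + δ⁻¹) ^ 4 * γ ^ 4 * jap (η + γ • ζ) ^ 4) :=
            mul_le_mul_of_nonneg_left h1 (norm_nonneg _)
        _ = (1 + δ⁻¹) ^ 4 * γ ^ 4 * (‖hopSymbol hs ℓ (η + γ • ζ)‖ * jap (η + γ • ζ) ^ 4) := by ring
        _ ≤ (1 + δ⁻¹) ^ 4 * γ ^ 4 * (C₂ * F) := mul_le_mul_of_nonneg_left h2 (by positivity)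
        _ = K₃ * γ ^ 4 := by rw [hK₃]; ring
        _ ≤ K₃ * G := mul_le_mul_of_nonneg_left (hγG 4 (by norm_num)) hK₃0
    split_ifs with hk
    · have hn := norm_diracFreq_of_mem θ i hk
      have h5 := jap_pow_four_le_of_norm_eq hn
      have h6 : (jap ζ ^ 4)⁻¹ ≤ (δ⁻¹) ^ 4 * γ ^ 4 := by
        rw [inv_le_iff_one_le_mul₀ (by positivity)]
        have : 1 ≤ δ⁻¹ * γ * jap ζ := by
          rw [mul_assoc, le_inv_mul_iff₀ hδ0, mul_one]
          exact hhigh.trans (mul_le_mul_of_nonneg_left (norm_le_jap ζ) hγ.le)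
        have := one_le_pow₀ this (n := 4)
        calc (1 : ℝ) ≤ _ := this
          _ = _ := by ring
      have h7 : lam₀ * γ * (jap ζ ^ 4)⁻¹ * jap η ^ 4 ≤ K₄ * G := by
        calc lam₀ * γ * (jap ζ ^ 4)⁻¹ * jap η ^ 4
            ≤ lam₀ * γ * ((δ⁻¹) ^ 4 * γ ^ 4) * 3 := by gcongr
          _ = K₄ * γ ^ 5 := by rw [hK₄]; ring
          _ ≤ K₄ * G := mul_le_mul_of_nonneg_left (hγG 5 (by norm_num)) hK₄0
      have h8 := norm_sub_le (hopSymbol hs ℓ (η + γ • ζ)) (lam₀ * γ)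
      have h9 : ‖(lam₀ * γ : ℂ)‖ = lam₀ * γ := by
        rw [hcast, Complex.norm_real, Real.norm_of_nonneg (by positivity)]
      rw [h9] at h8
      have h10 : ‖hopSymbol hs ℓ (η + γ • ζ) - lam₀ * γ‖ * (jap ζ ^ 4)⁻¹ * jap η ^ 4 ≤
          (‖hopSymbol hs ℓ (η + γ • ζ)‖ + lam₀ * γ) * (jap ζ ^ 4)⁻¹ * jap η ^ 4 := by
        gcongr
      linarith
    · rw [sub_zero]
      linarith

end HoppingAssumption

/-! ### The Hamiltonian on wave packets -/

theorem summable_weight : Summable (fun k : Fin 2 → ℤ =>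
      (jap (recipPt (diracCoord + intVec k)) ^ 4)⁻¹) ∧
    ∑' k : Fin 2 → ℤ, (jap (recipPt (diracCoord + intVec k)) ^ 4)⁻¹ ≤ weightSum := by
  have h0 : ∀ k : Fin 2 → ℤ, 0 ≤ (jap (recipPt (diracCoord + intVec k)) ^ 4)⁻¹ := fun k => by
    positivity [jap_pos (recipPt (diracCoord + intVec k))]
  have h := tsum_weight_le 0 0 diracCoord
  simp only [jap, norm_dualPt] at h
  have hs : Summable fun k : Fin 2 → ℤ => (jap (recipPt (diracCoord + intVec k)) ^ 4)⁻¹ := by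
    have := ENNReal.summable_toReal (h.trans_lt ENNReal.ofReal_lt_top).ne
    exact this.congr fun k => ENNReal.toReal_ofReal (h0 k)
  refine ⟨hs, ?_⟩
  rw [← ENNReal.ofReal_le_ofReal_iff weightSum_nonneg, ENNReal.ofReal_tsum_of_nonneg h0 hs]
  exact h

theorem jap_diracFreq (θ : ℝ) (i : Fin 2) (k : Fin 2 → ℤ) :
    jap (diracFreq θ i k) = jap (recipPt (diracCoord + intVec k)) := by
  rw [jap, diracFreq, norm_dualPt, jap]

section packet

variable (d : Plane) (θ : ℝ) {γ : ℝ} (hγ : γ ∈ Ioc (0 : ℝ) 1)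

theorem norm_waveOp_le (y : Envelope) : ‖waveOp d θ hγ y‖ ≤ 4 * sampBound * ‖y‖ := by
  rw [waveOp_apply]
  refine (norm_sum_le_of_le _ fun i _ => norm_sum_le_of_le _ fun σ _ =>
    (norm_phaseOp_le d θ _ _).trans ((norm_packOp_le d θ hγ i σ _).trans
      (mul_le_mul_of_nonneg_left (norm_component_le y i σ) sampBound_nonneg))).trans ?_
  simp only [Finset.sum_const, Finset.card_univ, Fintype.card_fin]
  exact le_of_eq (by ring)

/-- The difference is itself a wave packet, with the envelope multiplied by `intraResidual`. -/
theorem norm_intra_residual_le (hθ : 0 ≤ θ) (y : Envelope) :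
    ‖intraOp (waveOp d θ hγ ((scaleOp ^ 4) y)) -
      γ • waveOp d θ hγ ((scaleOp ^ 3) (kineticOp y))‖ ≤
      4 * sampBound * (6 * (4 * Real.pi ^ 2 * γ ^ 2 + Real.pi * γ * θ) * ‖y‖) := by
  have hγ0 : 0 < γ := hγ.1
  have e : intraOp (waveOp d θ hγ ((scaleOp ^ 4) y)) -
      γ • waveOp d θ hγ ((scaleOp ^ 3) (kineticOp y)) =
      waveOp d θ hγ fun i σ => mulOp (intraResidual θ γ i σ) (y i σ.rev) := by
    rw [intraOp_waveOp, RCLike.real_smul_eq_coe_smul (K := ℂ) γ, ← map_smul, ← map_sub]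
    congr 1
    funext i σ
    obtain ⟨C, hC⟩ := isMultiplier_intraSymbol θ γ i σ
    have hk : kineticOp y i σ = mulOp (diracMatrix σ σ.rev) (y i σ.rev) := by
      have hz : ∀ τ v, mulOp (diracMatrix τ τ) v = 0 := by
        intro τ v
        have : diracMatrix τ τ = fun _ => 0 := by
          funext ξ; fin_cases τ <;> simp [diracMatrix]
        rw [this, mulOp_const, zero_smul]
      rw [kineticOp, matOp_apply]
      fin_cases σ
      · rw [Fin.zero_eta, hz, zero_add]; rfl
      · rw [Fin.mk_one, hz, add_zero]; rfl
    simp only [Pi.sub_apply, Pi.smul_apply, scaleOp_pow_apply, hk]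
    have h3 := (isMultiplier_jw_pow 3).mul (isMultiplier_diracMatrix σ σ.rev)
    rw [mulOp_mulOp hC (isMultiplier_jw_pow 4),
      mulOp_mulOp (isMultiplier_jw_pow 3) (isMultiplier_diracMatrix σ σ.rev),
      ← mulOp_const_mul _ h3, ← mulOp_sub (hC.mul (isMultiplier_jw_pow 4)) (h3.const_mul _)]
    rfl
  rw [e]
  refine (norm_waveOp_le d θ hγ _).trans (mul_le_mul_of_nonneg_left ?_
    (mul_nonneg (by norm_num) sampBound_nonneg))
  refine norm_envelope_le (by positivity) fun i σ => ?_
  exact (norm_mulOp_le (isMultiplier_intraResidual hθ hγ0.le i σ) _).trans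
    (mul_le_mul_of_nonneg_left (norm_component_le y i σ.rev) (by positivity))

end packet

namespace HoppingAssumption

variable {hs : ℝ → ℝ} {C₁ C₂ C₃ D₁ D₂ ℓ₀ : ℝ} (hh : HoppingAssumption hs C₁ C₂ C₃ D₁ D₂ ℓ₀)
include hh

/-- On wave packets, the tight-binding Hamiltonian is the Bistritzer-MacDonald Hamiltonian to
leading order. -/
theorem exists_norm_residual_le {c lam₀ lam₁ : ℝ} (hc : c = D₂ / D₁ - 1 / 2) (hlam₀ : 0 < lam₀)
    (hlam₁ : 0 < lam₁) : ∃ K, 0 ≤ K ∧ ∀ {γ θ ℓ : ℝ}, Regime hs ℓ₀ lam₀ lam₁ γ θ ℓ →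
      ∀ (hγ : γ ∈ Ioc (0 : ℝ) 1) (d : Plane) (y : Envelope),
        ‖hamOp hs d θ ℓ (waveOp d θ hγ ((scaleOp ^ 4) y)) - γ • waveOp d θ hγ
          ((scaleOp ^ 3) (kineticOp y) +
            couplingOp (bmCoeff lam₀ d θ) (bmShift θ γ) 2 ((scaleOp ^ 4) y))‖ ≤
          K * γ ^ (1 + c) * ‖y‖ := by
  obtain ⟨K, hK, hres⟩ := hh.exists_isMultiplier_interResidual hc hlam₀
  obtain ⟨hα, hα1⟩ := hh.ratio_bounds
  have hS := sampBound_nonneg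
  have hW := weightSum_nonneg
  set K₁ : ℝ := 4 * sampBound * (6 * (4 * Real.pi ^ 2 + Real.pi * lam₁)) with hK₁
  have hK₁0 : 0 ≤ K₁ := by positivity
  refine ⟨K₁ + 8 * (sampBound * (K * weightSum)), by positivity, fun {γ θ ℓ} hr hγ d y => ?_⟩
  have hγ0 := hr.γ_pos
  set G := γ ^ (1 + c) with hG
  have hG0 : 0 ≤ G := by positivity
  have hγG : γ ^ 2 ≤ G := by
    rw [hG, ← Real.rpow_natCast]
    exact Real.rpow_le_rpow_of_exponent_ge hγ0 hγ.2 (by push_cast; linarith)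
  have hintra := norm_intra_residual_le d θ hγ hr.θ_pos.le y
  obtain ⟨hw, hw'⟩ := summable_weight
  have hinter := hh.exists_inter_residual hr.le_ℓ lam₀ d θ hγ (hw.mul_left (K * G))
    (fun i k => by rw [← jap_diracFreq θ i k]; exact hres hr hγ.2 i k) y
  rw [tsum_mul_left] at hinter
  have h1 : 4 * sampBound * (6 * (4 * Real.pi ^ 2 * γ ^ 2 + Real.pi * γ * θ) * ‖y‖) ≤
      K₁ * G * ‖y‖ := by
    -- The regime θ ≤ λ₁γ makes the rotation error quadratic in γ.
    have h2 : 4 * Real.pi ^ 2 * γ ^ 2 + Real.pi * γ * θ ≤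
        (4 * Real.pi ^ 2 + Real.pi * lam₁) * γ ^ 2 := by
      have := mul_le_mul_of_nonneg_left hr.θ_le (by positivity : 0 ≤ Real.pi * γ)
      linarith
    calc 4 * sampBound * (6 * (4 * Real.pi ^ 2 * γ ^ 2 + Real.pi * γ * θ) * ‖y‖)
        ≤ 4 * sampBound * (6 * ((4 * Real.pi ^ 2 + Real.pi * lam₁) * γ ^ 2) * ‖y‖) := by gcongr
      _ = K₁ * γ ^ 2 * ‖y‖ := by rw [hK₁]; ring
      _ ≤ K₁ * G * ‖y‖ := by gcongr
  have h3 : 8 * (sampBound * (K * G *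
      ∑' k : Fin 2 → ℤ, (jap (recipPt (diracCoord + intVec k)) ^ 4)⁻¹) * ‖y‖) ≤
      8 * (sampBound * (K * G * weightSum) * ‖y‖) := by gcongr
  have e : hamOp hs d θ ℓ (waveOp d θ hγ ((scaleOp ^ 4) y)) - γ • waveOp d θ hγ
      ((scaleOp ^ 3) (kineticOp y) +
        couplingOp (bmCoeff lam₀ d θ) (bmShift θ γ) 2 ((scaleOp ^ 4) y)) =
      (intraOp (waveOp d θ hγ ((scaleOp ^ 4) y)) -
        γ • waveOp d θ hγ ((scaleOp ^ 3) (kineticOp y))) +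
      (interOp hs d θ ℓ (waveOp d θ hγ ((scaleOp ^ 4) y)) -
        γ • waveOp d θ hγ (couplingOp (bmCoeff lam₀ d θ) (bmShift θ γ) 2 ((scaleOp ^ 4) y))) := by
    rw [map_add, smul_add, hamOp, add_apply]
    abel
  rw [e]
  refine (norm_add_le _ _).trans ((add_le_add hintra hinter).trans ?_)
  linarith

variable {ℓ : ℝ} (hℓ : ℓ₀ ≤ ℓ)
include hℓ

theorem isSelfAdjoint_hamOp (d : Plane) (θ : ℝ) : IsSelfAdjoint (hamOp hs d θ ℓ) := by
  rw [ContinuousLinearMap.isSelfAdjoint_iff', eq_comm, ContinuousLinearMap.eq_adjoint_iff]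
  intro φ ψ
  rw [hamOp, add_apply, add_apply, inner_add_left, inner_add_right, inner_intraOp,
    hh.inner_interOp hℓ]

theorem hamOp_apply (d : Plane) (θ : ℝ) (ψ : TBSpace) (n : Site) :
    hamOp hs d θ ℓ ψ n = tbHamiltonian hs d θ ℓ ψ n := by
  rw [hamOp, add_apply, lp.coeFn_add, Pi.add_apply, intraOp_eq, hh.interOp_eq hℓ, tbHamiltonian]

theorem isSchrodingerSolution_iff (d : Plane) (θ : ℝ) (ψ : ℝ → TBSpace) :
    IsSchrodingerSolution hs d θ ℓ ψ ↔
      ∀ τ, 0 ≤ τ → HasDerivWithinAt ψ (-Complex.I • hamOp hs d θ ℓ (ψ τ)) (Ici 0) τ := by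
  refine forall₂_congr fun τ hτ => ⟨?_, fun h => ⟨_, h, fun n => ?_⟩⟩
  · rintro ⟨ψ', h, hn⟩
    have e : ψ' = -Complex.I • hamOp hs d θ ℓ (ψ τ) := by
      apply lp.ext
      funext n
      rw [lp.coeFn_smul, Pi.smul_apply, hh.hamOp_apply hℓ, ← hn n, smul_eq_mul, ← mul_assoc,
        neg_mul, Complex.I_mul_I, neg_neg, one_mul]
    rwa [← e]
  · rw [lp.coeFn_smul, Pi.smul_apply, hh.hamOp_apply hℓ, smul_eq_mul, ← mul_assoc,
        mul_neg, Complex.I_mul_I, neg_neg, one_mul]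

theorem isSchrodingerSolution_unique (d : Plane) (θ : ℝ) {φ ψ : ℝ → TBSpace}
    (hφ : IsSchrodingerSolution hs d θ ℓ φ) (hψ : IsSchrodingerSolution hs d θ ℓ ψ)
    (h0 : φ 0 = ψ 0) {τ : ℝ} (hτ : 0 ≤ τ) : φ τ = ψ τ := by
  rw [hh.isSchrodingerSolution_iff hℓ] at hφ hψ
  have := norm_le_of_hasDerivWithinAt_schrodinger (hh.isSelfAdjoint_hamOp hℓ d θ)
    (η := fun τ => φ τ - ψ τ) (r := 0) (K := 0) (fun τ hτ => by
      have := (hφ τ hτ).sub (hψ τ hτ)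
      rwa [← smul_sub, ← map_sub, ← add_zero (-Complex.I • _)] at this) (by simp)
    (by simp [h0]) hτ
  rw [zero_mul, norm_le_zero_iff] at this
  exact sub_eq_zero.1 this

end HoppingAssumption

/-! ### Evolution of the envelopes -/

/-- The shift is the difference of a single vector of length 2/3 rotated by ∓θ/2, divided by γ. This
makes the Sobolev constants of the flow independent of γ and θ. -/
theorem norm_bmShift_le {θ γ lam₁ : ℝ} (hθ : 0 ≤ θ) (hγ : 0 < γ) (h : θ ≤ lam₁ * γ) (m : Fin 3) :
    ‖bmShift θ γ m‖ ≤ lam₁ := by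
  have e : bmShift θ γ m = γ⁻¹ • (diracFreq θ 0 (ringVec m) - diracFreq θ 1 (ringVec m)) :=
    couplingShift_bmShift θ γ 0 m
  set v := recipPt (diracCoord + intVec (ringVec m)) with hv
  have hv1 : ‖v‖ ≤ 1 := by
    have := norm_diracFreq_of_mem θ 0 (Finset.mem_image_of_mem ringVec (Finset.mem_univ m))
    rw [diracFreq, norm_dualPt, ← hv] at this
    rw [this]; norm_num
  have h1 : ∀ i, ‖rot (layerAngle θ i) v - v‖ ≤ θ / 2 := fun i => by
    refine (norm_rot_sub_le _ _).trans ?_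
    rw [norm_layerAngle, abs_of_nonneg hθ]
    exact mul_le_of_le_one_right (by positivity) hv1
  have h2 : ‖diracFreq θ 0 (ringVec m) - diracFreq θ 1 (ringVec m)‖ ≤ θ := by
    have := norm_sub_le (rot (layerAngle θ 0) v - v) (rot (layerAngle θ 1) v - v)
    rw [sub_sub_sub_cancel_right] at this
    exact this.trans (by linarith [h1 0, h1 1])
  rw [e, norm_smul, norm_inv, Real.norm_of_nonneg hγ.le, inv_mul_le_iff₀ hγ]
  linarith

section evolution

variable (lam₀ : ℝ) (d : Plane) (θ γ : ℝ)

theorem isBMSolution_of_isScaleSolution {x : ℝ → Envelope}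
    (h : IsScaleSolution scaleOp (generator (bmCoeff lam₀ d θ) (bmShift θ γ)) 1 x) :
    IsBMSolution lam₀ d θ γ (envFourierInv (scaleOp (x 0)))
      (fun T => envFourierInv (scaleOp (x T))) := by
  refine ⟨rfl, fun T hT => ⟨fun i σ => ?_, _, envFourierInv.comp_hasDerivWithinAt_real (h T hT),
    fun i σ => ?_⟩⟩
  · simpa using memSobolev_envFourierInv 1 (x T) i σ
  · rw [bmHamiltonian_eq, ← coe_const_smul, map_smul, Pi.smul_apply, Pi.smul_apply, smul_smul,
      mul_neg, Complex.I_mul_I, neg_neg, one_smul]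

/-- Membership in H¹ at each time provides the vector at level 1. Conservation of the norm thus
applies to every solution in the sense of `IsBMSolution`, which is what uniqueness requires. -/
theorem exists_isScaleSolution_of_isBMSolution {f₀ : Envelope} {f : ℝ → Envelope}
    (h : IsBMSolution lam₀ d θ γ f₀ f) : ∃ x : ℝ → Envelope,
      IsScaleSolution scaleOp (generator (bmCoeff lam₀ d θ) (bmShift θ γ)) 1 x ∧
      ∀ T, 0 ≤ T → f T = envFourierInv (scaleOp (x T)) := by
  have h1 : ∀ T, ∃ v : Envelope, 0 ≤ T → f T = envFourierInv (scaleOp v) := by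
    intro T
    by_cases hT : 0 ≤ T
    · choose v hv using ((h.2 T hT).1 : ∀ i σ, ∃ v : L2, _)
      refine ⟨envFourier v, fun _ => ?_⟩
      rw [← envFourierInv_envFourier (f T)]
      congr 1
      funext i σ
      have h2 := (bessel_eq_iff 1 (f T i σ) (v i σ)).1 (by simpa using hv i σ)
      simpa [envFourier_apply, scaleOp_apply] using h2
    · exact ⟨0, fun h => absurd h hT⟩
  choose x hx using h1
  refine ⟨x, fun T hT => ?_, hx⟩
  obtain ⟨-, f', hf', hH⟩ := h.2 T hT
  have h2 : f' = envFourierInv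
      (-Complex.I • generator (bmCoeff lam₀ d θ) (bmShift θ γ) 1 (x T)) := by
    funext i σ
    have h3 := hH i σ
    rw [hx T hT, bmHamiltonian_eq, ← coe_const_smul] at h3
    have h4 : Complex.I • f' i σ = _ := toTemperedDistribution_injective h3
    rw [map_smul, Pi.smul_apply, Pi.smul_apply, ← h4, smul_smul, neg_mul, Complex.I_mul_I, neg_neg,
      one_smul]
  have h3 := envFourier.comp_hasDerivWithinAt_real hf'
  rw [h2, envFourier_envFourierInv] at h3
  refine h3.congr (fun t ht => ?_) ?_
  · rw [hx t ht, envFourier_envFourierInv]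
  · rw [hx T hT, envFourier_envFourierInv]

theorem isBMSolution_unique {f₀ : Envelope} {f g : ℝ → Envelope}
    (hf : IsBMSolution lam₀ d θ γ f₀ f) (hg : IsBMSolution lam₀ d θ γ f₀ g) {T : ℝ} (hT : 0 ≤ T) :
    f T = g T := by
  obtain ⟨x, hx, hfx⟩ := exists_isScaleSolution_of_isBMSolution lam₀ d θ γ hf
  obtain ⟨y, hy, hgy⟩ := exists_isScaleSolution_of_isBMSolution lam₀ d θ γ hg
  have hz : IsScaleSolution scaleOp (generator (bmCoeff lam₀ d θ) (bmShift θ γ)) 1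
      (fun T => x T - y T) := fun T hT => by
    have := (hx T hT).sub (hy T hT)
    rw [← smul_sub, ← map_sub] at this
    simp only [map_sub] at this ⊢
    exact this
  have h0 : scaleOp (x 0) = scaleOp (y 0) := by
    rw [← envFourier_envFourierInv (scaleOp (x 0)), ← envFourier_envFourierInv (scaleOp (y 0)),
      ← hfx 0 le_rfl, ← hgy 0 le_rfl, hf.1, hg.1]
  have h1 := norm_conserved _ _ hz hT
  simp only [map_sub, h0, sub_self, norm_zero, mul_zero] at h1
  rw [hfx T hT, hgy T hT, sub_eq_zero.1 (norm_le_zero_iff.1 h1)]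

theorem scaleOp_pow_couplingOp (c : Fin 3 → Fin 2 → Fin 2 → ℂ) (q : Fin 3 → Plane) (s n : ℕ)
    (v : Envelope) :
    (scaleOp ^ n) (couplingOp c q (s + n) v) = couplingOp c q s ((scaleOp ^ n) v) := by
  induction n generalizing v with
  | zero => rfl
  | succ n ih =>
    rw [pow_succ]
    change (scaleOp ^ n) (scaleOp (couplingOp c q (s + n + 1) v)) =
      couplingOp c q s ((scaleOp ^ n) (scaleOp v))
    rw [scaleOp_couplingOp, ih]

theorem scaleOp_pow_six (v : Envelope) : (scaleOp ^ 6) v = (scaleOp ^ 2) ((scaleOp ^ 4) v) := by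
  rw [show 6 = 2 + 4 from rfl, pow_add]
  rfl

/-- The evolution of the envelopes in momentum space. -/
theorem exists_envelope_evolution {lam₁ M : ℝ} (hlam₀ : 0 ≤ lam₀)
    (hq : ∀ m, ‖bmShift θ γ m‖ ≤ lam₁) (hM : 0 ≤ M) {f₀ : Envelope}
    (hf₀ : ∀ i σ, eSobolevNorm 8 (f₀ i σ : 𝓢'(Plane, ℂ)) ≤ ENNReal.ofReal M) :
    ∃ y : ℝ → Envelope,
      IsBMSolution lam₀ d θ γ f₀ (fun T => envFourierInv ((scaleOp ^ 6) (y T))) ∧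
      (∀ T i σ, MemSobolev 8 2 (envFourierInv ((scaleOp ^ 6) (y T)) i σ : 𝓢'(Plane, ℂ))) ∧
      (∀ T, 0 ≤ T → HasDerivWithinAt (fun T => (scaleOp ^ 4) (y T))
        (-Complex.I • ((scaleOp ^ 3) (kineticOp (y T)) +
          couplingOp (bmCoeff lam₀ d θ) (bmShift θ γ) 2 ((scaleOp ^ 4) (y T)))) (Ici 0) T) ∧
      ∀ T, 0 ≤ T → ‖y T‖ ≤ evolutionConst lam₀ lam₁ 6 * M := by
  obtain ⟨v₀, hv₀, hf⟩ := exists_of_eSobolevNorm_le (s := 8) hM (by exact_mod_cast hf₀)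
  obtain ⟨v, rfl, hv⟩ := exists_isScaleSolution (bmCoeff lam₀ d θ) (bmShift θ γ) v₀
  have hJA := scaleOp_generator (bmCoeff lam₀ d θ) (bmShift θ γ)
  -- Bookkeeping of levels: `scaleOp (v T)` solves at level 7, hence y = `scaleOp (scaleOp (v T))`
  -- at level 6, and the envelope has Fourier transform `scaleOp ^ 6` of y. Two of these six weights
  -- belong to sampling and four to the residual.
  have h6 := hv.lower hJA
  have h1 := ((((h6.lower hJA).lower hJA).lower hJA).lower hJA).lower hJA
  have e0 : f₀ = envFourierInv ((scaleOp ^ 8) (v 0)) := by rw [← hf, envFourierInv_envFourier]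
  refine ⟨fun T => scaleOp (scaleOp (v T)), ?_, fun T i σ => ?_, fun T hT => ?_, fun T hT => ?_⟩
  · rw [e0]
    exact isBMSolution_of_isScaleSolution lam₀ d θ γ h1
  · exact_mod_cast memSobolev_envFourierInv 8 (v T) i σ
  · have := (scaleOp ^ 3).comp_hasDerivWithinAt_real (h6 T hT)
    rw [map_smul, generator_apply, map_add] at this
    have e : (scaleOp ^ 3) (scaleOp (couplingOp (bmCoeff lam₀ d θ) (bmShift θ γ) 6
        (scaleOp (scaleOp (v T))))) = couplingOp (bmCoeff lam₀ d θ) (bmShift θ γ) 2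
          ((scaleOp ^ 4) (scaleOp (scaleOp (v T)))) :=
      scaleOp_pow_couplingOp _ _ 2 4 _
    rw [e] at this
    exact this
  · refine (norm_evolution_le _ _ (fun m σ σ' => (norm_bmCoeff lam₀ hlam₀ d θ m σ σ').le) hq 6 hv
      hT).trans (mul_le_mul_of_nonneg_left
        ((norm_scaleOp_le _).trans ((norm_scaleOp_le _).trans hv₀)) ?_)
    have hb := (norm_nonneg _).trans (hq 0)
    exact scaleConst_nonneg (by norm_num) (fun s => by unfold generatorBound; positivity)
      (fun s => by positivity) 6

end evolution

/-- Duhamel's principle for an approximate solution in a slow time. -/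
theorem norm_sub_le_of_approximate_evolution {E F : Type*} [NormedAddCommGroup E]
    [InnerProductSpace ℂ E] [CompleteSpace E] [NormedAddCommGroup F] [NormedSpace ℂ F]
    {H : E →L[ℂ] E} (hH : IsSelfAdjoint H) (W : F →L[ℂ] E) {γ K : ℝ} (hγ : 0 ≤ γ) {u g : ℝ → F}
    (hu : ∀ T, 0 ≤ T → HasDerivWithinAt u (-Complex.I • g T) (Ici 0) T) {ψ : ℝ → E}
    (hψ : ∀ τ, 0 ≤ τ → HasDerivWithinAt ψ (-Complex.I • H (ψ τ)) (Ici 0) τ)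
    (h0 : ψ 0 = W (u 0)) (hK : ∀ T, 0 ≤ T → ‖H (W (u T)) - γ • W (g T)‖ ≤ K) {τ : ℝ}
    (hτ : 0 ≤ τ) : ‖ψ τ - W (u (γ * τ))‖ ≤ K * τ := by
  refine norm_le_of_hasDerivWithinAt_schrodinger hH (η := fun τ => ψ τ - W (u (γ * τ)))
    (r := fun τ => -Complex.I • (H (W (u (γ * τ))) - γ • W (g (γ * τ)))) (fun τ hτ => ?_)
    (fun τ hτ => ?_) (by simp [h0]) hτ
  · have h1 := W.comp_hasDerivWithinAt_real (hu (γ * τ) (mul_nonneg hγ hτ))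
    -- The chain rule for the slow time T = γτ produces the factor γ in front of `W (g T)`.
    have h2 : HasDerivWithinAt (fun τ : ℝ => γ * τ) γ (Ici 0) τ := by
      simpa using ((hasDerivAt_id τ).const_mul γ).hasDerivWithinAt
    have h3 := h1.scomp τ h2 (fun t ht => mul_nonneg hγ ht)
    refine ((hψ τ hτ).sub h3).congr_deriv ?_
    rw [map_sub, map_smul, smul_comm γ (-Complex.I)]
    simp only [smul_sub]
    abel
  · rw [norm_smul, norm_neg, Complex.norm_I, one_mul]
    exact hK _ (mul_nonneg hγ hτ)

namespace HoppingAssumption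

variable {hs : ℝ → ℝ} {C₁ C₂ C₃ D₁ D₂ ℓ₀ : ℝ} (hh : HoppingAssumption hs C₁ C₂ C₃ D₁ D₂ ℓ₀)
include hh

/-- Existence, uniqueness and approximation of wave packets. -/
theorem exists_wavePacket_approximation {c lam₀ lam₁ : ℝ} (hc : c = D₂ / D₁ - 1 / 2)
    (hlam₀ : 0 < lam₀) (hlam₁ : 0 < lam₁) : ∃ C, 0 < C ∧
    ∀ (γ θ ℓ : ℝ) (d : Plane), Regime hs ℓ₀ lam₀ lam₁ γ θ ℓ → γ < 1 →
      ∀ (M : ℝ) (f₀ : Envelope), 0 ≤ M →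
        (∀ i σ, eSobolevNorm 8 (f₀ i σ : 𝓢'(Plane, ℂ)) ≤ ENNReal.ofReal M) →
      ∃ (f : ℝ → Envelope) (ψ η : ℝ → TBSpace),
        IsBMSolution lam₀ d θ γ f₀ f ∧
        (∀ g, IsBMSolution lam₀ d θ γ f₀ g → ∀ T, 0 ≤ T → g T = f T) ∧
        (∀ T, 0 ≤ T → ∀ i σ, MemSobolev 8 2 (f T i σ : 𝓢'(Plane, ℂ)) ∧ HasContRep (f T i σ)) ∧
        IsSchrodingerSolution hs d θ ℓ ψ ∧
        (∀ n, ψ 0 n = wavePacket d θ γ f₀ n) ∧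
        (∀ φ, IsSchrodingerSolution hs d θ ℓ φ → (∀ n, φ 0 n = wavePacket d θ γ f₀ n) →
          ∀ τ, 0 ≤ τ → φ τ = ψ τ) ∧
        (∀ τ, 0 ≤ τ → ∀ n, ψ τ n = wavePacket d θ γ (f (γ * τ)) n + η τ n) ∧
        ∀ τ, 0 ≤ τ → ‖η τ‖ ≤ C * M * γ ^ (1 + c) * τ := by
  obtain ⟨K, hK, hres⟩ := hh.exists_norm_residual_le hc hlam₀ hlam₁
  -- The maximum with 1 only ensures that the constant is positive.
  refine ⟨max (K * evolutionConst lam₀ lam₁ 6) 1, lt_max_of_lt_right one_pos,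
    fun γ θ ℓ d hr hγ1 M f₀ hM hf₀ => ?_⟩
  have hγ : γ ∈ Ioc (0 : ℝ) 1 := ⟨hr.γ_pos, hγ1.le⟩
  have hγ0 := hr.γ_pos
  obtain ⟨y, hf, hsob, hy, hyM⟩ := exists_envelope_evolution lam₀ d θ γ hlam₀.le
    (norm_bmShift_le hr.θ_pos.le hr.γ_pos hr.θ_le) hM hf₀
  have hpack : ∀ T n, wavePacket d θ γ (envFourierInv ((scaleOp ^ 6) (y T))) n =
      waveOp d θ hγ ((scaleOp ^ 4) (y T)) n := fun T n => by
    rw [scaleOp_pow_six, wavePacket_eq d θ hγ]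
  obtain ⟨ψ, hψ0, hψ⟩ := exists_schrodinger (H := hamOp hs d θ ℓ)
    (waveOp d θ hγ ((scaleOp ^ 4) (y 0)))
  have hψS : IsSchrodingerSolution hs d θ ℓ ψ := (hh.isSchrodingerSolution_iff hr.le_ℓ d θ ψ).2
    fun τ _ => (hψ τ).hasDerivWithinAt
  have hψ0' : ∀ n, ψ 0 n = wavePacket d θ γ f₀ n := fun n => by
    rw [hψ0, ← hpack, ← hf.1]
  refine ⟨_, ψ, fun τ => ψ τ - waveOp d θ hγ ((scaleOp ^ 4) (y (γ * τ))), hf,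
    fun g hg T hT => isBMSolution_unique lam₀ d θ γ hg hf hT, fun T _ i σ => ⟨hsob T i σ, ?_⟩, hψS,
    hψ0', fun φ hφ h0 τ hτ => hh.isSchrodingerSolution_unique hr.le_ℓ d θ hφ hψS ?_ hτ,
    fun τ _ n => ?_, fun τ hτ => ?_⟩
  · beta_reduce
    rw [scaleOp_pow_six, envFourierInv_apply, scaleOp_pow_apply 2]
    exact hasContRep_fourierInv _
  · apply lp.ext
    funext n
    rw [h0, hψ0']
  · rw [hpack, lp.coeFn_sub, Pi.sub_apply, add_sub_cancel]
  · have hG : 0 ≤ γ ^ (1 + c) := by positivity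
    refine norm_sub_le_of_approximate_evolution (hh.isSelfAdjoint_hamOp hr.le_ℓ d θ)
      (waveOp d θ hγ) hγ0.le hy (fun τ _ => (hψ τ).hasDerivWithinAt) hψ0 (fun T hT => ?_) hτ
    calc _ ≤ K * γ ^ (1 + c) * ‖y T‖ := hres hr hγ d _
      _ ≤ K * γ ^ (1 + c) * (evolutionConst lam₀ lam₁ 6 * M) := by
          gcongr
          exact hyM T hT
      _ = K * evolutionConst lam₀ lam₁ 6 * M * γ ^ (1 + c) := by ring
      _ ≤ _ := by
          gcongr
          exact le_max_left _ _

end HoppingAssumption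

/-- The error bound is small on the long time scale. -/
theorem exists_error_le {C T₁ M c ν ε : ℝ} (hν : ν < c) (hC : 0 ≤ C) (hM : 0 ≤ M) (hT : 0 ≤ T₁)
    (hε : 0 < ε) : ∃ γ₁, 0 < γ₁ ∧ ∀ γ, 0 < γ → γ < γ₁ → ∀ τ ≤ T₁ * γ ^ (-(1 + ν)),
      C * M * γ ^ (1 + c) * τ ≤ ε := by
  set A := C * M * T₁ with hA
  have hA0 : 0 ≤ A := by positivity
  have ht : Tendsto (fun γ : ℝ => A * γ ^ (c - ν)) (𝓝 0) (𝓝 0) := by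
    have := (Real.continuousAt_rpow_const 0 (c - ν) (Or.inr (by linarith))).tendsto.const_mul A
    rwa [Real.zero_rpow (by linarith), mul_zero] at this
  obtain ⟨γ₁, hγ₁, h⟩ := Metric.eventually_nhds_iff.1 (ht.eventually (ge_mem_nhds hε))
  refine ⟨γ₁, hγ₁, fun γ hγ hγ' τ hτ => ?_⟩
  have h1 := h (y := γ) (by rwa [Real.dist_0_eq_abs, abs_of_pos hγ])
  have hG : 0 ≤ C * M * γ ^ (1 + c) := by positivity
  calc C * M * γ ^ (1 + c) * τ ≤ C * M * γ ^ (1 + c) * (T₁ * γ ^ (-(1 + ν))) :=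
        mul_le_mul_of_nonneg_left hτ hG
    _ = A * (γ ^ (1 + c) * γ ^ (-(1 + ν))) := by rw [hA]; ring
    _ = A * γ ^ (c - ν) := by rw [← Real.rpow_add hγ]; congr 2; ring
    _ ≤ ε := h1

end TBG

end

/-! ### The approximation theorem for wave packets -/

theorem mainTheorem1 (hs : ℝ → ℝ) (C₁ C₂ C₃ D₁ D₂ ℓ₀ : ℝ)
    (hh : TBG.HoppingAssumption hs C₁ C₂ C₃ D₁ D₂ ℓ₀)
    (lam₀ lam₁ : ℝ) (hlam₀ : 0 < lam₀) (hlam₁ : 0 < lam₁) :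
    ∃ c γ₀ C : ℝ, 0 < c ∧ 0 < γ₀ ∧ 0 < C ∧
      -- existence and uniqueness of both evolutions, and the bound on the corrector
      (∀ (γ θ ℓ : ℝ) (d : TBG.Plane), TBG.Regime hs ℓ₀ lam₀ lam₁ γ θ ℓ → γ < γ₀ →
        ∀ (M : ℝ) (f₀ : TBG.Envelope), 0 ≤ M →
          (∀ i σ, TBG.eSobolevNorm 8 (f₀ i σ : 𝓢'(TBG.Plane, ℂ)) ≤ ENNReal.ofReal M) →
        ∃ (f : ℝ → TBG.Envelope) (ψ η : ℝ → TBG.TBSpace),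
          TBG.IsBMSolution lam₀ d θ γ f₀ f ∧
          (∀ g, TBG.IsBMSolution lam₀ d θ γ f₀ g → ∀ T, 0 ≤ T → g T = f T) ∧
          (∀ T, 0 ≤ T → ∀ i σ, MemSobolev 8 2 (f T i σ : 𝓢'(TBG.Plane, ℂ)) ∧
            TBG.HasContRep (f T i σ)) ∧
          TBG.IsSchrodingerSolution hs d θ ℓ ψ ∧
          (∀ n, ψ 0 n = TBG.wavePacket d θ γ f₀ n) ∧
          (∀ φ, TBG.IsSchrodingerSolution hs d θ ℓ φ →
            (∀ n, φ 0 n = TBG.wavePacket d θ γ f₀ n) → ∀ τ, 0 ≤ τ → φ τ = ψ τ) ∧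
          (∀ τ, 0 ≤ τ → ∀ n, ψ τ n = TBG.wavePacket d θ γ (f (γ * τ)) n + η τ n) ∧
          ∀ τ, 0 ≤ τ → ‖η τ‖ ≤ C * M * γ ^ (1 + c) * τ) ∧
      -- the corrector tends to zero, uniformly on the long time scale
      (∀ ν T₁ M : ℝ, 0 ≤ ν → ν < c → 0 < T₁ → 0 ≤ M → ∀ ε : ℝ, 0 < ε →
        ∃ γ₁ : ℝ, 0 < γ₁ ∧
          ∀ (γ θ ℓ : ℝ) (d : TBG.Plane), TBG.Regime hs ℓ₀ lam₀ lam₁ γ θ ℓ → γ < γ₁ →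
          ∀ f₀ : TBG.Envelope,
            (∀ i σ, TBG.eSobolevNorm 8 (f₀ i σ : 𝓢'(TBG.Plane, ℂ)) ≤ ENNReal.ofReal M) →
          ∀ (f : ℝ → TBG.Envelope) (ψ η : ℝ → TBG.TBSpace),
            TBG.IsBMSolution lam₀ d θ γ f₀ f →
            TBG.IsSchrodingerSolution hs d θ ℓ ψ →
            (∀ n, ψ 0 n = TBG.wavePacket d θ γ f₀ n) →
            (∀ τ, 0 ≤ τ → ∀ n, ψ τ n = TBG.wavePacket d θ γ (f (γ * τ)) n + η τ n) →
            ∀ τ ∈ Icc 0 (T₁ * γ ^ (-(1 + ν))), ‖η τ‖ ≤ ε) := by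
  obtain ⟨C, hC, h⟩ := hh.exists_wavePacket_approximation rfl hlam₀ hlam₁
  have hc : 0 < D₂ / D₁ - 1 / 2 := by linarith [hh.ratio_bounds.1]
  -- The exponent is positive because D₁/D₂ < 2. The only smallness used is γ < 1.
  refine ⟨D₂ / D₁ - 1 / 2, 1, C, hc, one_pos, hC, h, fun ν T₁ M _ hνc hT₁ hM ε hε => ?_⟩
  obtain ⟨γ₁, hγ₁, hsmall⟩ := TBG.exists_error_le hνc hC.le hM hT₁.le hε
  refine ⟨min γ₁ 1, lt_min hγ₁ one_pos,
    fun γ θ ℓ d hr hγ f₀ hf₀ f ψ η hf hψ hψ0 hη τ hτ => ?_⟩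
  obtain ⟨f', ψ', η', -, hf', -, -, -, hψ', hη', hb⟩ :=
    h γ θ ℓ d hr (hγ.trans_le (min_le_right _ _)) M f₀ hM hf₀
  -- Uniqueness of f and ψ forces any corrector to be the one constructed in the first part, so its
  -- bound applies.
  have e : η τ = η' τ := by
    apply lp.ext
    funext n
    have h1 := hη τ hτ.1 n
    rw [hψ' ψ hψ hψ0 τ hτ.1, hf' f hf _ (mul_nonneg hr.γ_pos.le hτ.1), hη' τ hτ.1 n] at h1
    exact (add_left_cancel h1).symm
  rw [e]
  exact (hb τ hτ.1).trans (hsmall γ hr.γ_pos (hγ.trans_le (min_le_left _ _)) τ hτ.2)
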